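/- **Setting.** Fix $\bar\alpha\in(0,1)$. An *admissible vorticity* is a radial function $\bar\Omega(x)=g(|x|)$ on $\mathbb R^2$, where $g:[0,\infty)\to\mathbb R$ is $C^\infty$ (up to $0$), $g(r)=r^{-\bar\alpha}$ for $r\ge 2$, and $g(r)=g(0)+\tfrac{g''(0)}2r^2$ for $r$ in a neighborhood of $0$. Put $\zeta(r)=r^{-2}\int_0^r\rho\, g(\rho)\,d\rho$, $x^\perp=(-x_2,x_1)$ and $\bar V(x)=\zeta(|x|)x^\perp$. For an integer $m\ge 2$ let $L^2_m$ be the closed subspace of those $\vartheta\in L^2(\mathbb R^2;\mathbb C)$ with $\vartheta=\vartheta\circ R_{2\pi/m}$, where $R_\theta$ is the counterclockwise rotation by $\theta$ around the origin. With $K_2(x)=\frac{x^\perp}{2\pi|x|^2}$, let $\vartheta\mapsto K_2*\vartheta$ also denote the extension to $L^2_m$ (by continuity in the sense of distributions; its values are represented by $L^2_{\rm loc}$ vector fields) of the convolution with $K_2$ on the $m$-fold symmetric Schwartz functions. Consider on $L^2_m$ the unbounded operator $$L_{\rm st}(\Omega)=-\operatorname{div}(\bar V\,\Omega)-\big((K_2*\Omega)\cdot\nabla\big)\bar\Omega,\qquad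 D_m(L_{\rm st})=\{\Omega\in L^2_m:\ \operatorname{div}(\bar V\,\Omega)\in L^2\},$$ the divergence being taken in the sense of distributions. Its spectrum $\operatorname{spec}_m(L_{\rm st})$ is the set of those $z\in\mathbb C$ for which $L_{\rm st}-z$ does not have a bounded inverse $L^2_m\to L^2_m$; its discrete spectrum consists of the isolated points $z$ of $\operatorname{spec}_m(L_{\rm st})$ for which the Riesz projector $\frac1{2\pi i}\oint(w-L_{\rm st})^{-1}\,dw$ (over a small circle around $z$) has finite rank. **Theorem 3.1.** (a) For every integer $m\ge 2$ and every admissible $\bar\Omega$, each $z\in\operatorname{spec}_m(L_{\rm st})$ with $\operatorname{Re}z\neq0$ belongs to the discrete spectrum of $L_{\rm st}$; if moreover $\operatorname{Im}z=0$, then there is a nontrivial real-valued $\Omega\in D_m(L_{\rm st})$ with $L_{\rm st}(\Omega)=z\,\Omega$. (b) There are an admissible $\bar\Omega$ and an integer $m\ge2$ such that $\operatorname{spec}_m(L_{\rm st})\cap\{z:\operatorname{Re}z>0\}$ is nonempty. -/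

import Mathlib

open MeasureTheory Filter Topology
open scoped ContDiff SchwartzMap

namespace EulerVortex

/-! ### Unbounded operators on a complex normed space

An unbounded operator `A` with domain `D(A) ⊆ E` is given by its graph:
`A x y` means `x ∈ D(A)` and `A x = y`. -/

section UnboundedOperators

variable {E : Type*} [NormedAddCommGroup E] [NormedSpace ℂ E]

/-- `B` is a bounded operator on the whole of `E`, and it is the (two-sided) inverse of
`A - z : D(A) → E`.  The implication from left to right says `B (A - z) x = x` on `D(A)`; the one
from right to left, applied to `x = B w` and `y = w + z x`, says that `B` maps `E` into `D(A)` and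
`(A - z) B w = w`. -/
def IsBoundedInverse (A : E → E → Prop) (z : ℂ) (B : E →L[ℂ] E) : Prop :=
  ∀ x y : E, A x y ↔ B (y - z • x) = x

theorem IsBoundedInverse.unique {A : E → E → Prop} {z : ℂ} {B B' : E →L[ℂ] E}
    (h : IsBoundedInverse A z B) (h' : IsBoundedInverse A z B') : B = B' := by
  ext w
  have h1 : A (B w) (w + z • B w) := (h _ _).2 (by simp)
  have h2 := (h' _ _).1 h1
  simpa using h2.symm

/-- The spectrum of `A`: the complement of the set of those `z` for which `A - z` has a
bounded inverse defined on `E`. -/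
def spec (A : E → E → Prop) : Set ℂ :=
  {z | ¬ ∃ B : E →L[ℂ] E, IsBoundedInverse A z B}

open Classical in
/-- The operator `(A - z)⁻¹` for `z` outside the spectrum of `A`. -/
noncomputable def boundedInverse (A : E → E → Prop) (z : ℂ) : E →L[ℂ] E :=
  if h : ∃ B : E →L[ℂ] E, IsBoundedInverse A z B then h.choose else 0

/-- The Riesz projector `(2πi)⁻¹ ∮ (w - A)⁻¹ dw`, the integral being taken counterclockwise over
the circle of radius `ε` around `z`. -/
noncomputable def rieszProjector (A : E → E → Prop) (z : ℂ) (ε : ℝ) : E →L[ℂ] E :=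
  (2 * (Real.pi : ℂ) * Complex.I)⁻¹ • ∮ w in C(z, ε), -(boundedInverse A w)

/-- The discrete spectrum of `A`: the isolated points of the spectrum whose Riesz projector has
finite rank. -/
def discreteSpec (A : E → E → Prop) : Set ℂ :=
  {z | z ∈ spec A ∧
    (∃ ε : ℝ, 0 < ε ∧ Metric.closedBall z ε ∩ spec A = {z}) ∧
    ∀ ε : ℝ, 0 < ε → Metric.closedBall z ε ∩ spec A = {z} →
      FiniteDimensional ℂ (rieszProjector A z ε).range}

end UnboundedOperators

/-! ### The plane and the space of `m`-fold symmetric functions -/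

/-- The Euclidean plane. -/
abbrev Plane : Type := EuclideanSpace ℝ (Fin 2)

/-- `x^⊥ = (-x₂, x₁)`. -/
noncomputable def perp (x : Plane) : Plane := !₂[-(x 1), x 0]

/-- The counterclockwise rotation by the angle `θ` around the origin. -/
noncomputable def rot (θ : ℝ) (x : Plane) : Plane :=
  !₂[Real.cos θ * x 0 - Real.sin θ * x 1, Real.sin θ * x 0 + Real.cos θ * x 1]

theorem measurePreserving_rot (θ : ℝ) :
    MeasurePreserving (rot θ) (volume : Measure Plane) volume := by
  let f : Plane →ₗ[ℝ] Plane :=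
    { toFun := rot θ
      map_add' := fun x y => by
        ext i; fin_cases i <;> simp [rot] <;> ring
      map_smul' := fun c x => by
        ext i; fin_cases i <;> simp [rot] <;> ring }
  have hf : ∀ x, ‖f x‖ = ‖x‖ := fun x => by
    have h : (Real.cos θ * x 0 - Real.sin θ * x 1) ^ 2 + (Real.sin θ * x 0 + Real.cos θ * x 1) ^ 2
        = x 0 ^ 2 + x 1 ^ 2 := by
      linear_combination (x 0 ^ 2 + x 1 ^ 2) * Real.sin_sq_add_cos_sq θ
    simp [f, rot, EuclideanSpace.norm_eq, Fin.sum_univ_two, h]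
  let e : Plane →ₗᵢ[ℝ] Plane := ⟨f, hf⟩
  exact (e.toLinearIsometryEquiv rfl).measurePreserving

/-- The closed subspace `L²_m` of `L²(ℝ²; ℂ)` of the `m`-fold symmetric functions: those `ϑ` with
`ϑ = ϑ ∘ R_{2π/m}` (almost everywhere).  It carries the norm of `L²`. -/
noncomputable def L2m (m : ℕ) : Submodule ℂ (Lp ℂ 2 (volume : Measure Plane)) where
  carrier := {ϑ | ∀ᵐ x, ϑ (rot (2 * Real.pi / m) x) = ϑ x}
  zero_mem' := by
    have h := Lp.coeFn_zero ℂ 2 (volume : Measure Plane)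
    have h' := (measurePreserving_rot (2 * Real.pi / m)).quasiMeasurePreserving.ae h
    filter_upwards [h, h'] with x hx hx'
    simp_all
  add_mem' := by
    intro a b ha hb
    simp only [Set.mem_ofPred_eq] at ha hb ⊢
    have h := Lp.coeFn_add a b
    have h' := (measurePreserving_rot (2 * Real.pi / m)).quasiMeasurePreserving.ae h
    filter_upwards [h, h', ha, hb] with x hx hx' hax hbx
    rw [hx, hx', Pi.add_apply, Pi.add_apply, hax, hbx]
  smul_mem' := by
    intro c a ha
    simp only [Set.mem_ofPred_eq] at ha ⊢
    have h := Lp.coeFn_smul c a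
    have h' := (measurePreserving_rot (2 * Real.pi / m)).quasiMeasurePreserving.ae h
    filter_upwards [h, h', ha] with x hx hx' hax
    rw [hx, hx', Pi.smul_apply, Pi.smul_apply, hax]

/-! ### The background vortex -/

/-- The admissible radial profiles `g` with decay exponent `α`: `g` is smooth on `[0, ∞)` (up to
the end point), equals `r^{-α}` for `r ≥ 2`, and is of the form `g(0) + c r²` (necessarily with
`c = g''(0)/2`) near `0`.  The values of `g` on `(-∞, 0)` play no role. -/
structure IsProfile (α : ℝ) (g : ℝ → ℝ) : Prop where
  smooth : ContDiffOn ℝ ∞ g (Set.Ici 0)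
  decay : ∀ r : ℝ, 2 ≤ r → g r = r ^ (-α)
  near_zero : ∃ c δ : ℝ, 0 < δ ∧ ∀ r : ℝ, 0 ≤ r → r < δ → g r = g 0 + c * r ^ 2

/-- The vorticity `Ω̄(x) = g(|x|)` of the vortex. -/
noncomputable def vorticity (g : ℝ → ℝ) (x : Plane) : ℝ := g ‖x‖

/-- `ζ(r) = r⁻² ∫₀^r ρ g(ρ) dρ` (only its values at `r > 0` matter). -/
noncomputable def zeta (g : ℝ → ℝ) (r : ℝ) : ℝ := (r ^ 2)⁻¹ * ∫ ρ in (0 : ℝ)..r, ρ * g ρ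

/-- The velocity field `V̄(x) = ζ(|x|) x^⊥` of the vortex. -/
noncomputable def velocity (g : ℝ → ℝ) (x : Plane) : Plane := zeta g ‖x‖ • perp x

/-! ### The Biot–Savart law on `L²_m` -/

/-- The Biot–Savart kernel `K₂(x) = x^⊥ / (2π|x|²)`. -/
noncomputable def biotSavartKernel (x : Plane) : Plane := (2 * Real.pi * ‖x‖ ^ 2)⁻¹ • perp x

/-- The `i`-th component of the convolution `K₂ * f`. -/
noncomputable def biotSavart (f : Plane → ℂ) (i : Fin 2) (x : Plane) : ℂ :=
  ∫ y, (biotSavartKernel (x - y) i : ℂ) * f y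

/-- `v = K₂ * ϑ` for `ϑ ∈ L²_m`, where `K₂ *` is the extension by continuity of the operator
`ϑ ↦ K₂ * ϑ` from the Schwartz functions in `L²_m` (with the `L²` norm) to `L²_m`, with values in
the distributions: `v` is in `L²_loc`, and is the distributional limit of `K₂ * ϑₙ` for a sequence
of `m`-fold symmetric Schwartz functions `ϑₙ` converging to `ϑ` in `L²`. -/
def IsBiotSavart (m : ℕ) (ϑ : L2m m) (v : Fin 2 → Plane → ℂ) : Prop :=
  (∀ (i : Fin 2) (R : ℝ), MemLp (v i) 2 (volume.restrict (Metric.ball 0 R))) ∧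
  ∃ s : ℕ → 𝓢(Plane, ℂ),
    (∀ n x, s n (rot (2 * Real.pi / m) x) = s n x) ∧
    Tendsto (fun n => eLpNorm (fun x => s n x - (ϑ : Lp ℂ 2 (volume : Measure Plane)) x) 2 volume)
      atTop (𝓝 0) ∧
    ∀ φ : Plane → ℝ, ContDiff ℝ ∞ φ → HasCompactSupport φ → ∀ i : Fin 2,
      Tendsto (fun n => ∫ x, (φ x : ℂ) * biotSavart (s n) i x) atTop
        (𝓝 (∫ x, (φ x : ℂ) * v i x))

/-! ### The linearized operator -/

/-- `D = div (W Ω)` in the sense of distributions, for a vector field `W` and a complex valued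
function `Ω` on the plane. -/
def IsWeakDiv (W : Plane → Plane) (Ω D : Plane → ℂ) : Prop :=
  ∀ φ : Plane → ℝ, ContDiff ℝ ∞ φ → HasCompactSupport φ →
    ∫ x, (φ x : ℂ) * D x = -∫ x, ((fderiv ℝ φ x (W x) : ℝ) : ℂ) * Ω x

/-- `(v · ∇) f = v₁ ∂₁ f + v₂ ∂₂ f` for a complex vector field `v` and a real function `f`. -/
noncomputable def advect (v : Fin 2 → Plane → ℂ) (f : Plane → ℝ) (x : Plane) : ℂ :=
  ∑ i : Fin 2, v i x * ((fderiv ℝ f x (EuclideanSpace.single i 1) : ℝ) : ℂ)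

/-- The graph of the operator `L_st(Ω) = - div (V̄ Ω) - (K₂ * Ω · ∇) Ω̄` on `L²_m`, whose domain
consists of the `Ω ∈ L²_m` with `div (V̄ Ω) ∈ L²`. -/
def Lst (m : ℕ) (g : ℝ → ℝ) (Ω F : L2m m) : Prop :=
  ∃ (D : Lp ℂ 2 (volume : Measure Plane)) (v : Fin 2 → Plane → ℂ),
    IsWeakDiv (velocity g) (Ω : Lp ℂ 2 (volume : Measure Plane)) D ∧
    IsBiotSavart m Ω v ∧
    ∀ᵐ x, (F : Lp ℂ 2 (volume : Measure Plane)) x = - D x - advect v (vorticity g) x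

end EulerVortex

/-!
Spectral discreteness and instability of radial vortices for the linearized Euler equations.

The linearized operator is the sum of the transport operator `Ω ↦ - div (V̄ Ω)` and of the operator
`T : Ω ↦ - ((K₂ * Ω) · ∇) Ω̄`. The flow of `V̄` rotates every circle around the origin rigidly, so that
it preserves the area and acts on `L²_m` as a group of isometries. Hence the resolvent of the transport
operator exists off the imaginary axis: it is a Laplace transform of the group, of norm at most
`|Re z|⁻¹` (`isBoundedInverse_transportResolvent`). On `m`-fold symmetric functions, `m ≥ 2`, the
kernel `K₂(x - y)` may be replaced by `K₂(x - y) + K₂(y)` for `|y| ≥ 2|x|`, which decays faster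
(`biotSavart_eq_symVelocity`). Together with the decay of `∇Ω̄` this makes `T` a limit of operators of
finite rank (`exists_advectOp`): near the diagonal its kernel is small by Schur's test, and the rest is
Hilbert–Schmidt. By the analytic Fredholm theorem the spectrum off the imaginary axis is isolated and
consists of eigenvalues. A Riesz projector there is an idempotent and a limit of operators of finite
rank, so it has finite rank (`mem_discreteSpec_of_perturbation`). The operator commutes with the complex
conjugation, so the real part of an eigenfunction `Ω` for a real eigenvalue, or the real part of `iΩ`,
is a real eigenfunction (`exists_real_eigenfunction`).

For the instability, a solution `ψ` of the integral form of Rayleigh's equation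
`ψ(r) = -(2m)⁻¹ ∫ (min(r, s) / max(r, s))^m g'(s) ψ(s) / (ζ(s) - c) ds` with `Im c ≠ 0` yields the
eigenfunction `e^{imθ} g' ψ / (r (ζ - c))` for the eigenvalue `-imc` (`mem_spec_of_rayleigh`). The
profile is a mollified annular patch, whose gradient is concentrated near the radii `1` and `√2`
(`exists_profile`). For infinitely thin rings and `m = 4` Rayleigh's equation reduces to a `2 × 2`
system whose determinant vanishes at `c = 1/8 + i/32`. For thin rings the equation still reduces to such
a system, by inverting an operator close to the identity (`exists_remainder`, `exists_neumann`), with a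
matrix that is close to the limiting one and holomorphic in `c`; the root persists by the maximum
principle applied to the reciprocal of the determinant (`exists_det_eq_zero`).
-/


namespace EulerVortex

/-! ### Limits of operators of finite rank -/

section FiniteRank

variable {E F G : Type*} [NormedAddCommGroup E] [NormedSpace ℂ E] [NormedAddCommGroup F]
  [NormedSpace ℂ F] [NormedAddCommGroup G] [NormedSpace ℂ G]

variable (E F) in
/-- The bounded operators of finite rank. -/
def finiteRank : Submodule ℂ (E →L[ℂ] F) where
  carrier := {T | FiniteDimensional ℂ T.range}
  zero_mem' := by
    have h : (0 : E →L[ℂ] F).range = ⊥ := by ext; simp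
    change FiniteDimensional ℂ (0 : E →L[ℂ] F).range
    rw [h]
    infer_instance
  add_mem' := by
    intro S T hS hT
    simp only [Set.mem_ofPred_eq] at hS hT ⊢
    refine Submodule.finiteDimensional_of_le (S₂ := S.range ⊔ T.range) ?_
    rintro _ ⟨x, rfl⟩
    exact Submodule.add_mem_sup ⟨x, rfl⟩ ⟨x, rfl⟩
  smul_mem' := by
    intro c T hT
    simp only [Set.mem_ofPred_eq] at hT ⊢
    refine Submodule.finiteDimensional_of_le (S₂ := T.range) ?_
    rintro _ ⟨x, rfl⟩
    exact ⟨c • x, by simp⟩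

variable (E F) in
/-- The norm closure of the operators of finite rank.  On a Hilbert space these are the compact
operators, but only this approximation property is used. -/
noncomputable def approxFiniteRank : Submodule ℂ (E →L[ℂ] F) := (finiteRank E F).topologicalClosure

theorem mem_approxFiniteRank_iff {T : E →L[ℂ] F} :
    T ∈ approxFiniteRank E F ↔ ∀ ε > 0, ∃ S ∈ finiteRank E F, ‖T - S‖ < ε := by
  rw [approxFiniteRank, ← SetLike.mem_coe, Submodule.topologicalClosure_coe, Metric.mem_closure_iff]
  simp only [SetLike.mem_coe, dist_eq_norm]

theorem isClosed_approxFiniteRank : IsClosed (approxFiniteRank E F : Set (E →L[ℂ] F)) :=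
  Submodule.isClosed_topologicalClosure _

theorem mem_approxFiniteRank_of_forall {T : E →L[ℂ] F}
    (h : ∀ ε > 0, ∃ S ∈ approxFiniteRank E F, ‖T - S‖ < ε) : T ∈ approxFiniteRank E F := by
  rw [← SetLike.mem_coe, ← isClosed_approxFiniteRank.closure_eq, Metric.mem_closure_iff]
  simpa only [SetLike.mem_coe, dist_eq_norm] using h

theorem comp_mem_approxFiniteRank (S : F →L[ℂ] G) {T : E →L[ℂ] F}
    (hT : T ∈ approxFiniteRank E F) : S ∘L T ∈ approxFiniteRank E G := by
  have hc : Continuous fun T : E →L[ℂ] F => S ∘L T := (ContinuousLinearMap.compL ℂ E F G S).continuous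
  refine map_mem_closure (f := fun T : E →L[ℂ] F => S ∘L T) hc hT fun T hT => ?_
  have hT' : FiniteDimensional ℂ T.range := hT
  have : (S ∘L T).range = T.range.map (S : F →ₗ[ℂ] G) := by
    ext; simp
  change FiniteDimensional ℂ (S ∘L T).range
  rw [this]
  infer_instance

theorem approxFiniteRank_comp {T : F →L[ℂ] G} (hT : T ∈ approxFiniteRank F G) (S : E →L[ℂ] F) :
    T ∘L S ∈ approxFiniteRank E G := by
  have hc : Continuous fun T : F →L[ℂ] G => T ∘L S :=
    ((ContinuousLinearMap.compL ℂ E F G).flip S).continuous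
  refine map_mem_closure (f := fun T : F →L[ℂ] G => T ∘L S) hc hT fun T hT => ?_
  have hT' : FiniteDimensional ℂ T.range := hT
  refine Submodule.finiteDimensional_of_le (S₂ := T.range) ?_
  rintro _ ⟨x, rfl⟩
  exact ⟨S x, rfl⟩

/-- A closed subspace contains the contour integrals of the functions with values in it. -/
theorem circleIntegral_mem [CompleteSpace E] {J : Submodule ℂ E} (hJ : IsClosed (J : Set E))
    {f : ℂ → E} {c : ℂ} {R : ℝ} (hR : 0 ≤ R) (hf : ContinuousOn f (Metric.sphere c R))
    (hmem : ∀ z ∈ Metric.sphere c R, f z ∈ J) : (∮ z in C(c, R), f z) ∈ J := by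
  have hint : CircleIntegrable f c R := hf.circleIntegrable hR
  have : IsClosed (J : Set E) := hJ
  have : IsClosed (J.toAddSubgroup : Set E) := hJ
  rw [← Submodule.Quotient.mk_eq_zero]
  change J.mkQL _ = 0
  rw [circleIntegral, ← ContinuousLinearMap.intervalIntegral_comp_comm _ hint.out]
  refine (intervalIntegral.integral_congr (g := fun _ => 0) fun θ _ => ?_).trans (by simp)
  have h0 : J.mkQL (f (circleMap c R θ)) = 0 :=
    (Submodule.Quotient.mk_eq_zero J).2 (hmem _ (circleMap_mem_sphere c hR θ))
  simp only [map_smul, h0, smul_zero]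

/-- A projection that is a limit of operators of finite rank has finite rank. -/
theorem finiteDimensional_range_of_idempotent {P : E →L[ℂ] E} (hP : P ∈ approxFiniteRank E E)
    (hPP : P * P = P) : FiniteDimensional ℂ P.range := by
  obtain ⟨S, hS, hlt⟩ := mem_approxFiniteRank_iff.1 hP 1 one_pos
  have hS' : FiniteDimensional ℂ S.range := hS
  let f : P.range →ₗ[ℂ] S.range :=
    (S : E →ₗ[ℂ] E).rangeRestrict ∘ₗ P.range.subtype
  refine FiniteDimensional.of_injective f ?_
  rw [injective_iff_map_eq_zero]
  rintro ⟨x, y, rfl⟩ hx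
  have h1 : S (P y) = 0 := congrArg Subtype.val hx
  have h2 : P (P y) = P y := congrArg (fun T : E →L[ℂ] E => T y) hPP
  have h3 : ‖P y‖ ≤ ‖P - S‖ * ‖P y‖ := by
    simpa [h1, h2] using (P - S).le_opNorm (P y)
  have h4 : ‖P y‖ = 0 := by
    by_contra hne
    have : 0 < ‖P y‖ := lt_of_le_of_ne (norm_nonneg _) (Ne.symm hne)
    nlinarith
  exact Subtype.ext (norm_eq_zero.1 h4)

end FiniteRank

/-! ### The analytic Fredholm theorem -/

section Fredholm

variable {E V : Type*} [NormedAddCommGroup E] [NormedSpace ℂ E] [NormedAddCommGroup V]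
  [NormedSpace ℂ V] [FiniteDimensional ℂ V]

theorem analyticAt_det {N : ℂ → V →L[ℂ] V} {z : ℂ} (hN : AnalyticAt ℂ N z) :
    AnalyticAt ℂ (fun w => LinearMap.det (N w : V →ₗ[ℂ] V)) z := by
  classical
  let b := Module.finBasis ℂ V
  have h : (fun w => LinearMap.det (N w : V →ₗ[ℂ] V)) = fun w =>
      ∑ σ : Equiv.Perm (Fin (Module.finrank ℂ V)), ((Equiv.Perm.sign σ : ℤ) : ℂ) *
        ∏ i, b.repr (N w (b i)) (σ i) := by
    ext w
    rw [← LinearMap.det_toMatrix b, Matrix.det_apply']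
    simp [LinearMap.toMatrix_apply]
  rw [h]
  refine Finset.analyticAt_fun_sum _ fun σ _ => analyticAt_const.mul ?_
  refine Finset.analyticAt_fun_prod _ fun i _ => ?_
  let ℓ : (V →L[ℂ] V) →ₗ[ℂ] ℂ :=
    (Finsupp.lapply (σ i) ∘ₗ b.repr.toLinearMap) ∘ₗ
      (ContinuousLinearMap.apply ℂ V (b i)).toLinearMap
  have hℓ : Continuous ℓ := by
    have : Continuous (Finsupp.lapply (σ i) ∘ₗ b.repr.toLinearMap : V →ₗ[ℂ] ℂ) :=
      LinearMap.continuous_of_finiteDimensional _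
    exact this.comp (ContinuousLinearMap.apply ℂ V (b i)).continuous
  exact (ContinuousLinearMap.analyticAt (⟨ℓ, hℓ⟩ : (V →L[ℂ] V) →L[ℂ] ℂ) (N z)).comp hN

/-- If the determinant of the finite-dimensional reduction `1 - Ψ u⁻¹ Φ` vanishes, then
`u - Φ Ψ` has a nontrivial kernel. -/
theorem exists_ker_of_det_eq_zero {u u' : E →L[ℂ] E} (hu : u * u' = 1) {Φ : V →L[ℂ] E}
    {Ψ : E →L[ℂ] V}
    (hdet : LinearMap.det ((1 - Ψ ∘L u' ∘L Φ : V →L[ℂ] V) : V →ₗ[ℂ] V) = 0) :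
    ∃ x ≠ 0, u x = Φ (Ψ x) := by
  obtain ⟨v, hv, hv0⟩ := SetLike.exists_of_lt (LinearMap.bot_lt_ker_of_det_eq_zero hdet)
  have hv1 : v = Ψ (u' (Φ v)) := by
    have : v - Ψ (u' (Φ v)) = 0 := by simpa using hv
    exact sub_eq_zero.1 this
  refine ⟨u' (Φ v), fun h0 => hv0 ?_, ?_⟩
  · rw [h0, map_zero] at hv1
    simp [hv1]
  · rw [← hv1]
    exact congrArg (fun T : E →L[ℂ] E => T (Φ v)) hu

/-- If the determinant of the finite-dimensional reduction `1 - Ψ u⁻¹ Φ` does not vanish, then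
`u - Φ Ψ` is invertible. -/
theorem isUnit_of_det_ne_zero {u u' : E →L[ℂ] E} (hu : u * u' = 1) (hu' : u' * u = 1)
    {Φ : V →L[ℂ] E} {Ψ : E →L[ℂ] V}
    (hdet : LinearMap.det ((1 - Ψ ∘L u' ∘L Φ : V →L[ℂ] V) : V →ₗ[ℂ] V) ≠ 0) :
    IsUnit (u - Φ ∘L Ψ) := by
  obtain ⟨e, he⟩ := (LinearMap.isUnit_iff_isUnit_det _).2 (isUnit_iff_ne_zero.2 hdet)
  let N' : V →L[ℂ] V := LinearMap.toContinuousLinearMap (e⁻¹ : (V →ₗ[ℂ] V)ˣ).1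
  have h1 : ∀ v, N' v - Ψ (u' (Φ (N' v))) = v := fun v => by
    have := congrArg (fun T : V →ₗ[ℂ] V => T v) e.mul_inv
    rw [he] at this
    simpa [N'] using this
  have h2 : ∀ v, N' (v - Ψ (u' (Φ v))) = v := fun v => by
    have := congrArg (fun T : V →ₗ[ℂ] V => T v) e.inv_mul
    rw [he] at this
    simpa [N'] using this
  have hux : ∀ x, u (u' x) = x := fun x => congrArg (fun T : E →L[ℂ] E => T x) hu
  have hux' : ∀ x, u' (u x) = x := fun x => congrArg (fun T : E →L[ℂ] E => T x) hu'
  refine ⟨⟨u - Φ ∘L Ψ, (1 + u' ∘L Φ ∘L N' ∘L Ψ) ∘L u', ?_, ?_⟩, rfl⟩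
  · ext x
    have := h1 (Ψ (u' x))
    have h3 : Φ (N' (Ψ (u' x))) - Φ (Ψ (u' (Φ (N' (Ψ (u' x)))))) = Φ (Ψ (u' x)) := by
      rw [← map_sub, this]
    simp [hux]
    linear_combination (norm := module) h3
  · ext x
    have h4 := h2 (Ψ x)
    rw [map_sub] at h4
    simp [hux']
    rw [← sub_eq_zero] at h4
    have h5 : u' (Φ (N' (Ψ x) - N' (Ψ (u' (Φ (Ψ x)))) - Ψ x)) = 0 := by rw [h4]; simp
    simp only [map_sub] at h5
    linear_combination (norm := module) h5

/-- Near a point where `T` is a limit of operators of finite rank, the invertibility of `1 - T`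
is governed by the zeros of one analytic function. -/
theorem exists_analyticAt_isUnit_iff [CompleteSpace E] {T : ℂ → E →L[ℂ] E} {z : ℂ}
    (hT : AnalyticAt ℂ T z) (hz : T z ∈ approxFiniteRank E E) :
    ∃ d : ℂ → ℂ, AnalyticAt ℂ d z ∧ ∀ᶠ w in 𝓝 z, (d w ≠ 0 → IsUnit (1 - T w)) ∧
      (d w = 0 → ∃ x ≠ 0, T w x = x) := by
  obtain ⟨S, hS, hlt⟩ := mem_approxFiniteRank_iff.1 hz 1 one_pos
  have hS' : FiniteDimensional ℂ S.range := hS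
  let Φ : S.range →L[ℂ] E := S.range.subtypeL
  let Ψ : E →L[ℂ] S.range := S.codRestrict S.range fun x => ⟨x, rfl⟩
  have hΦΨ : Φ ∘L Ψ = S := by ext; rfl
  let u : ℂ → E →L[ℂ] E := fun w => 1 - (T w - S)
  have hu : AnalyticAt ℂ u z := analyticAt_const.sub (hT.sub analyticAt_const)
  have hunit : ∀ᶠ w in 𝓝 z, IsUnit (u w) := by
    have h1 : ∀ᶠ w in 𝓝 z, ‖T w - S‖ < 1 :=
      ((hT.continuousAt.sub continuousAt_const).norm).eventually_lt continuousAt_const hlt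
    exact h1.mono fun w hw => isUnit_one_sub_of_norm_lt_one hw
  let u' : ℂ → E →L[ℂ] E := fun w => Ring.inverse (u w)
  have hu' : AnalyticAt ℂ u' z := by
    obtain ⟨U, hU⟩ := hunit.self_of_nhds
    have := analyticAt_inverse (𝕜 := ℂ) U
    rw [hU] at this
    exact this.comp hu
  refine ⟨fun w => LinearMap.det ((1 - Ψ ∘L u' w ∘L Φ : S.range →L[ℂ] S.range) :
    S.range →ₗ[ℂ] S.range), analyticAt_det (analyticAt_const.sub ?_), ?_⟩
  · have h1 := ((ContinuousLinearMap.compL ℂ S.range E E).flip Φ).analyticAt (u' z) |>.comp hu'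
    exact ((ContinuousLinearMap.compL ℂ S.range E S.range Ψ).analyticAt _).comp h1
  · filter_upwards [hunit] with w hw
    have e1 : u w * u' w = 1 := Ring.mul_inverse_cancel _ hw
    have e2 : u' w * u w = 1 := Ring.inverse_mul_cancel _ hw
    refine ⟨fun hd => ?_, fun hd => ?_⟩
    · have := isUnit_of_det_ne_zero e1 e2 hd
      rw [hΦΨ] at this
      have h3 : u w - S = 1 - T w := by simp only [u]; abel
      rwa [h3] at this
    · obtain ⟨x, hx, hxx⟩ := exists_ker_of_det_eq_zero e1 hd
      refine ⟨x, hx, ?_⟩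
      have h2 : Φ (Ψ x) = S x := rfl
      rw [h2] at hxx
      simp only [u, sub_apply, one_apply_eq_self] at hxx
      have h3 : x - T w x = 0 := by linear_combination (norm := module) hxx
      exact (sub_eq_zero.1 h3).symm

/-- The Fredholm alternative for a limit of operators of finite rank. -/
theorem exists_fixed_of_not_isUnit [CompleteSpace E] {T : E →L[ℂ] E}
    (hT : T ∈ approxFiniteRank E E) (h : ¬ IsUnit (1 - T)) : ∃ x ≠ 0, T x = x := by
  obtain ⟨d, -, hd⟩ := exists_analyticAt_isUnit_iff (T := fun _ => T) (z := 0) analyticAt_const hT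
  have := hd.self_of_nhds
  exact this.2 (by by_contra hne; exact h (this.1 hne))

/-- The analytic Fredholm theorem: if `1 - T z` is invertible at one point of a connected open
set, then it is invertible outside a discrete subset. -/
theorem eventually_isUnit_one_sub [CompleteSpace E] {T : ℂ → E →L[ℂ] E} {U : Set ℂ}
    (hU : IsOpen U) (hUc : IsPreconnected U) (hT : DifferentiableOn ℂ T U)
    (hmem : ∀ z ∈ U, T z ∈ approxFiniteRank E E) {z₁ : ℂ} (hz₁ : z₁ ∈ U)
    (h₁ : IsUnit (1 - T z₁)) {z : ℂ} (hz : z ∈ U) : ∀ᶠ w in 𝓝[≠] z, IsUnit (1 - T w) := by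
  let A : Set ℂ := {z | ∀ᶠ w in 𝓝[≠] z, IsUnit (1 - T w)}
  let B : Set ℂ := {z | ∀ᶠ w in 𝓝 z, ¬ IsUnit (1 - T w)}
  have hAo : IsOpen A := by
    rw [isOpen_iff_mem_nhds]
    intro a ha
    have ha' : ∀ᶠ w in 𝓝[≠] a, IsUnit (1 - T w) := ha
    rw [eventually_nhdsWithin_iff, ← eventually_eventually_nhds] at ha'
    filter_upwards [ha'] with b hb
    by_cases hba : b = a
    · exact hba ▸ ha
    · have hne : ∀ᶠ w in 𝓝 b, w ≠ a := isOpen_ne.mem_nhds hba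
      exact eventually_nhdsWithin_of_eventually_nhds (by
        filter_upwards [hb, hne] with w hw hw' using hw hw')
  have hBo : IsOpen B := isOpen_setOfPred_eventually_nhds
  have hAB : Disjoint A B := by
    rw [Set.disjoint_left]
    intro a ha hb
    obtain ⟨w, hw1, hw2⟩ := (Eventually.and (f := 𝓝[≠] a) ha (eventually_nhdsWithin_of_eventually_nhds hb)).exists
    exact hw2 hw1
  have hsub : U ⊆ A ∪ B := by
    intro a ha
    obtain ⟨d, hd, hiff⟩ := exists_analyticAt_isUnit_iff
      (hT.analyticAt (hU.mem_nhds ha)) (hmem a ha)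
    rcases hd.eventually_eq_zero_or_eventually_ne_zero with h0 | h0
    · right
      filter_upwards [h0, hiff] with w hw hw'
      rintro ⟨e, he⟩
      obtain ⟨x, hx, hxx⟩ := hw'.2 hw
      refine hx ?_
      have h4 := congrArg (fun S : E →L[ℂ] E => S x) e.inv_mul
      rw [he] at h4
      simpa [hxx] using h4.symm
    · left
      filter_upwards [h0, eventually_nhdsWithin_of_eventually_nhds hiff] with w hw hw'
      exact hw'.1 hw
  have hne : (U ∩ A).Nonempty := by
    refine ⟨z₁, hz₁, ?_⟩
    have hc : ContinuousAt (fun w => 1 - T w) z₁ :=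
      continuousAt_const.sub (hT.continuousOn.continuousAt (hU.mem_nhds hz₁))
    exact eventually_nhdsWithin_of_eventually_nhds
      (hc.eventually (Units.isOpen.mem_nhds h₁))
  exact hUc.subset_left_of_subset_union hAo hBo hAB hsub hne hz

end Fredholm

/-! ### Resolvents and Riesz projectors of unbounded operators -/

section Resolvent

variable {E : Type*} [NormedAddCommGroup E] [NormedSpace ℂ E] {A S : E → E → Prop}

theorem isBoundedInverse_boundedInverse {z : ℂ} (hz : z ∉ spec A) :
    IsBoundedInverse A z (boundedInverse A z) := by
  have h : ∃ B : E →L[ℂ] E, IsBoundedInverse A z B := not_not.1 hz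
  rw [boundedInverse, dif_pos h]
  exact h.choose_spec

theorem IsBoundedInverse.boundedInverse_eq {z : ℂ} {B : E →L[ℂ] E} (h : IsBoundedInverse A z B) :
    boundedInverse A z = B :=
  (isBoundedInverse_boundedInverse (fun h' => h' ⟨B, h⟩)).unique h

theorem mul_apply_eq (S T : E →L[ℂ] E) (x : E) : (S * T) x = S (T x) := rfl

/-- The resolvent identity. -/
theorem IsBoundedInverse.sub_eq {z w : ℂ} {B C : E →L[ℂ] E} (hB : IsBoundedInverse A z B)
    (hC : IsBoundedInverse A w C) : B - C = (z - w) • (B * C) := by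
  ext x
  have h1 : A (C x) (x + w • C x) := (hC _ _).2 (by simp)
  have h2 := (hB _ _).1 h1
  simp only [map_sub, map_add, map_smul] at h2
  simp only [sub_apply, smul_apply, mul_apply_eq]
  linear_combination (norm := module) h2

/-- The resolvent at `z` in terms of the resolvent at a nearby point `z₀`. -/
theorem IsBoundedInverse.of_isUnit {z₀ z : ℂ} {B : E →L[ℂ] E} (hB : IsBoundedInverse A z₀ B)
    (hu : IsUnit (1 - (z - z₀) • B)) :
    IsBoundedInverse A z (Ring.inverse (1 - (z - z₀) • B) * B) := by
  intro x y
  rw [hB x y]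
  have e1 := Ring.inverse_mul_cancel _ hu
  have e2 := Ring.mul_inverse_cancel _ hu
  set u := Ring.inverse (1 - (z - z₀) • B)
  have e1' : ∀ v, u ((1 - (z - z₀) • B) v) = v := fun v => congrArg (fun T : E →L[ℂ] E => T v) e1
  have e2' : ∀ v, (1 - (z - z₀) • B) (u v) = v := fun v => congrArg (fun T : E →L[ℂ] E => T v) e2
  have key : B (y - z₀ • x) = x ↔ B (y - z • x) = (1 - (z - z₀) • B) x := by
    simp only [map_sub, map_smul, sub_apply, one_apply_eq_self, smul_apply]
    constructor <;> intro h <;> linear_combination (norm := module) h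
  rw [key]
  constructor
  · intro h
    rw [mul_apply_eq, h, e1']
  · intro h
    rw [← e2' (B (y - z • x))]
    exact congrArg _ h

/-- Fubini's theorem for circle integrals. -/
theorem circleIntegral_swap {f : ℂ → ℂ → E} {c : ℂ} {r R : ℝ} (hr : 0 ≤ r) (hR : 0 ≤ R)
    (hf : ContinuousOn (Function.uncurry f) (Metric.sphere c r ×ˢ Metric.sphere c R)) :
    (∮ z in C(c, r), ∮ w in C(c, R), f z w) = ∮ w in C(c, R), ∮ z in C(c, r), f z w := by
  have hcont : Continuous fun p : ℝ × ℝ => f (circleMap c r p.1) (circleMap c R p.2) := by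
    have : Continuous fun p : ℝ × ℝ => (circleMap c r p.1, circleMap c R p.2) := by fun_prop
    exact hf.comp_continuous this fun p =>
      ⟨circleMap_mem_sphere c hr _, circleMap_mem_sphere c hR _⟩
  have hcont' : Continuous (Function.uncurry fun s t : ℝ => deriv (circleMap c r) s •
      deriv (circleMap c R) t • f (circleMap c r s) (circleMap c R t)) := by
    simp only [deriv_circleMap]
    refine Continuous.smul (by fun_prop) (Continuous.smul (by fun_prop) hcont)
  simp only [circleIntegral, ← intervalIntegral.integral_smul]
  have h2 : (0 : ℝ) ≤ 2 * Real.pi := by positivity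
  simp only [intervalIntegral.integral_of_le h2]
  rw [integral_integral_swap]
  · simp only [smul_comm (deriv (circleMap c R) _)]
  · rw [Measure.prod_restrict]
    exact (hcont'.continuousOn.integrableOn_compact
      (isCompact_Icc.prod isCompact_Icc)).mono_set
        (Set.prod_mono Set.Ioc_subset_Icc_self Set.Ioc_subset_Icc_self)

variable [CompleteSpace E]

theorem eventually_boundedInverse_eq {z₀ : ℂ} (h₀ : z₀ ∉ spec A) :
    ∀ᶠ z in 𝓝 z₀, IsUnit (1 - (z - z₀) • boundedInverse A z₀) ∧ z ∉ spec A ∧ boundedInverse A z =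
      Ring.inverse (1 - (z - z₀) • boundedInverse A z₀) * boundedInverse A z₀ := by
  have hc : ContinuousAt (fun z : ℂ => 1 - (z - z₀) • boundedInverse A z₀) z₀ := by fun_prop
  have hu : IsUnit (1 - (z₀ - z₀) • boundedInverse A z₀) := by simp
  filter_upwards [hc.eventually (Units.isOpen.mem_nhds hu)] with z hz
  have h := (isBoundedInverse_boundedInverse h₀).of_isUnit hz
  exact ⟨hz, fun h' => h' ⟨_, h⟩, h.boundedInverse_eq⟩

theorem differentiableAt_boundedInverse {z : ℂ} (hz : z ∉ spec A) :
    DifferentiableAt ℂ (boundedInverse A) z := by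
  have h := eventually_boundedInverse_eq hz
  have hd : DifferentiableAt ℂ (fun w : ℂ => Ring.inverse (1 - (w - z) • boundedInverse A z) *
      boundedInverse A z) z := by
    refine DifferentiableAt.mul_const (DifferentiableAt.inverse (by fun_prop) ?_) _
    simp
  exact hd.congr_of_eventuallyEq (h.mono fun w hw => hw.2.2)

/-- Around an isolated point of the spectrum the Riesz projector does not depend on the radius. -/
theorem rieszProjector_eq_of_le {z : ℂ} {r R : ℝ} (hr : 0 < r) (hrR : r ≤ R)
    (hR : Metric.closedBall z R ∩ spec A = {z}) : rieszProjector A z R = rieszProjector A z r := by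
  have hres : ∀ w ∈ Metric.closedBall z R, w ≠ z → w ∉ spec A := fun w hw hne hs =>
    hne (by simpa using hR.subset ⟨hw, hs⟩)
  unfold rieszProjector
  rw [Complex.circleIntegral_eq_of_differentiable_on_annulus_off_countable hr hrR
    Set.countable_empty]
  · intro w hw
    refine (differentiableAt_boundedInverse (hres w hw.1 ?_)).continuousAt.neg.continuousWithinAt
    rintro rfl
    exact hw.2 (Metric.mem_ball_self hr)
  · intro w hw
    refine (differentiableAt_boundedInverse
      (hres w (Metric.ball_subset_closedBall hw.1.1) ?_)).neg
    rintro rfl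
    exact hw.1.2 (Metric.mem_closedBall_self hr.le)

/-- The Riesz projector around an isolated point of the spectrum is a projection. -/
theorem rieszProjector_mul_self {z : ℂ} {R : ℝ} (hR0 : 0 < R)
    (hR : Metric.closedBall z R ∩ spec A = {z}) :
    rieszProjector A z R * rieszProjector A z R = rieszProjector A z R := by
  have hres : ∀ w ∈ Metric.closedBall z R, w ≠ z → w ∉ spec A := fun w hw hne hs =>
    hne (by simpa using hR.subset ⟨hw, hs⟩)
  set r := R / 2 with hr_def
  have hr : 0 < r := by positivity
  have hrR : r < R := by rw [hr_def]; linarith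
  have hs1 : ∀ w ∈ Metric.sphere z r, w ∉ spec A := fun w hw =>
    hres w (Metric.closedBall_subset_closedBall hrR.le (Metric.sphere_subset_closedBall hw))
      (Metric.ne_of_mem_sphere hw hr.ne')
  have hs2 : ∀ w ∈ Metric.sphere z R, w ∉ spec A := fun w hw =>
    hres w (Metric.sphere_subset_closedBall hw) (Metric.ne_of_mem_sphere hw hR0.ne')
  set B := boundedInverse A with hB
  have hc1 : ContinuousOn B (Metric.sphere z r) := fun w hw =>
    (differentiableAt_boundedInverse (hs1 w hw)).continuousAt.continuousWithinAt
  have hc2 : ContinuousOn B (Metric.sphere z R) := fun w hw =>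
    (differentiableAt_boundedInverse (hs2 w hw)).continuousAt.continuousWithinAt
  have hne : ∀ v ∈ Metric.sphere z r, ∀ w ∈ Metric.sphere z R, w - v ≠ 0 := by
    intro v hv w hw h
    rw [sub_eq_zero] at h
    rw [h, mem_sphere_iff_norm] at hw
    rw [mem_sphere_iff_norm] at hv
    linarith
  let I₁ := ∮ v in C(z, r), B v
  let I₂ := ∮ w in C(z, R), B w
  let k : ℂ := 2 * (Real.pi : ℂ) * Complex.I
  have hk : k ≠ 0 := by simp [k, Real.pi_ne_zero]
  have hP1 : rieszProjector A z R = -(k⁻¹ • I₁) := by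
    rw [rieszProjector_eq_of_le hr hrR.le hR]
    simp only [rieszProjector, I₁, k, circleIntegral, smul_neg, intervalIntegral.integral_neg]
    rfl
  have hP2 : rieszProjector A z R = -(k⁻¹ • I₂) := by
    simp only [rieszProjector, I₂, k, circleIntegral, smul_neg, intervalIntegral.integral_neg]
    rfl
  -- the product of the two contour integrals, evaluated by the resolvent identity
  have hprod : I₁ * I₂ = -(k • I₁) := by
    have e1 : I₁ * I₂ = ∮ v in C(z, r), ∮ w in C(z, R), B v * B w := by
      have h2 : CircleIntegrable B z R := hc2.circleIntegrable hR0.le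
      have h1 : CircleIntegrable B z r := hc1.circleIntegrable hr.le
      have a1 : ∀ v, (∮ w in C(z, R), B v * B w) = B v * I₂ := fun v => by
        have := ContinuousLinearMap.intervalIntegral_comp_comm
          (ContinuousLinearMap.mul ℂ (E →L[ℂ] E) (B v)) h2.out
        simpa [I₂, circleIntegral] using this
      simp only [a1]
      have := ContinuousLinearMap.intervalIntegral_comp_comm
          ((ContinuousLinearMap.mul ℂ (E →L[ℂ] E)).flip I₂) h1.out
      simpa [I₁, circleIntegral] using this.symm
    have e2 : (∮ v in C(z, r), ∮ w in C(z, R), B v * B w) =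
        ∮ v in C(z, r), ((∮ w in C(z, R), (w - v)⁻¹ • B w) - k • B v) := by
      refine circleIntegral.integral_congr hr.le fun v hv => ?_
      have b1 : (∮ w in C(z, R), B v * B w) =
          ∮ w in C(z, R), ((w - v)⁻¹ • B w - (w - v)⁻¹ • B v) := by
        refine circleIntegral.integral_congr hR0.le fun w hw => ?_
        have := (isBoundedInverse_boundedInverse (hs1 v hv)).sub_eq
          (isBoundedInverse_boundedInverse (hs2 w hw))
        have hd := hne v hv w hw
        have h3 : B w - B v = (w - v) • (B v * B w) := by
          rw [← neg_sub v w, neg_smul, ← this, neg_sub]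
        simp only [← smul_sub, h3, smul_smul, inv_mul_cancel₀ hd, one_smul]
      have ci : ContinuousOn (fun w => (w - v)⁻¹) (Metric.sphere z R) :=
        (continuousOn_id.sub continuousOn_const).inv₀ fun w hw => hne v hv w hw
      have b2 : (∮ w in C(z, R), (w - v)⁻¹ • B v) = k • B v := by
        have hv' : v ∈ Metric.ball z R := by
          rw [Metric.mem_ball, Metric.mem_sphere.1 hv]; exact hrR
        rw [circleIntegral.integral_smul_const,
          circleIntegral.integral_sub_inv_of_mem_ball hv']
      rw [b1, circleIntegral.integral_sub, b2]
      · exact (ci.smul hc2).circleIntegrable hR0.le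
      · exact (ci.smul continuousOn_const).circleIntegrable hR0.le
    have hjoint : ContinuousOn (Function.uncurry fun v w : ℂ => (w - v)⁻¹ • B w)
        (Metric.sphere z r ×ˢ Metric.sphere z R) := by
      have c2 : ContinuousOn (fun p : ℂ × ℂ => B p.2) (Metric.sphere z r ×ˢ Metric.sphere z R) :=
        hc2.comp continuousOn_snd fun p hp => hp.2
      exact ((continuousOn_snd.sub continuousOn_fst).inv₀
        fun p hp => hne _ hp.1 _ hp.2).smul c2
    have e3 : (∮ v in C(z, r), ∮ w in C(z, R), (w - v)⁻¹ • B w) = 0 := by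
      rw [circleIntegral_swap hr.le hR0.le hjoint]
      refine (circleIntegral.integral_congr (g := fun _ => 0) hR0.le fun w hw => ?_).trans
        (by simp [circleIntegral])
      simp only [circleIntegral.integral_smul_const]
      have : (∮ v in C(z, r), (w - v)⁻¹) = 0 := by
        refine Complex.circleIntegral_eq_zero_of_differentiable_on_off_countable hr.le
          Set.countable_empty ?_ ?_
        all_goals
          have hw' : ∀ v ∈ Metric.closedBall z r, w - v ≠ 0 := by
            intro v hv h
            rw [sub_eq_zero] at h
            rw [h, mem_sphere_iff_norm] at hw
            rw [mem_closedBall_iff_norm] at hv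
            linarith
        · exact (continuousOn_const.sub continuousOn_id).inv₀ hw'
        · intro v hv
          exact ((differentiableAt_const w).sub differentiableAt_id).inv
            (hw' v (Metric.ball_subset_closedBall hv.1))
      rw [this, zero_smul]
    have hci : CircleIntegrable (fun v => ∮ w in C(z, R), (w - v)⁻¹ • B w) z r := by
      refine Continuous.intervalIntegrable ?_ _ _
      simp only [circleIntegral]
      refine intervalIntegral.continuous_parametric_intervalIntegral_of_continuous' ?_ _ _
      have hm : Continuous fun p : ℝ × ℝ => (circleMap z r p.1, circleMap z R p.2) := by fun_prop
      have := hjoint.comp_continuous hm fun p =>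
        ⟨circleMap_mem_sphere z hr.le _, circleMap_mem_sphere z hR0.le _⟩
      simp only [deriv_circleMap]
      exact Continuous.smul (f := fun p : ℝ × ℝ => circleMap 0 R p.2 * Complex.I) (by fun_prop) this
    rw [e1, e2, circleIntegral.integral_sub hci, e3, circleIntegral.integral_smul, zero_sub]
    exact (hc1.const_smul k).circleIntegrable hr.le
  calc rieszProjector A z R * rieszProjector A z R = (-(k⁻¹ • I₁)) * (-(k⁻¹ • I₂)) := by
        rw [← hP1, ← hP2]
    _ = k⁻¹ • k⁻¹ • (I₁ * I₂) := by simp [smul_smul]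
    _ = -(k⁻¹ • I₁) := by
        rw [hprod, smul_neg, smul_neg, smul_smul k⁻¹ k, inv_mul_cancel₀ hk, one_smul]
    _ = rieszProjector A z R := hP1.symm

/-- A perturbation `A = S + K` of an operator `S` whose spectrum lies on the imaginary axis, by a
limit `K` of operators of finite rank, has only discrete spectrum off the imaginary axis. -/
theorem mem_discreteSpec_of_perturbation {K : E →L[ℂ] E} (hK : K ∈ approxFiniteRank E E)
    {R₀ : ℂ → E →L[ℂ] E} (hR₀ : ∀ z : ℂ, z.re ≠ 0 → IsBoundedInverse S z (R₀ z))
    (hnorm : ∀ z : ℂ, z.re ≠ 0 → ‖R₀ z‖ ≤ |z.re|⁻¹)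
    (hA : ∀ x y, A x y ↔ S x (y - K x)) {z : ℂ} (hz : z ∈ spec A) (hre : z.re ≠ 0) :
    z ∈ discreteSpec A ∧ ∃ x ≠ 0, A x (z • x) := by
  have hS : ∀ w : ℂ, w.re ≠ 0 → w ∉ spec S := fun w hw h => h ⟨_, hR₀ w hw⟩
  have hT_mem : ∀ w : ℂ, -(R₀ w) * K ∈ approxFiniteRank E E := fun w =>
    comp_mem_approxFiniteRank _ hK
  have hfix : ∀ w : ℂ, w.re ≠ 0 → ∀ x, (-(R₀ w) * K) x = x → A x (w • x) := by
    intro w hw x hx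
    rw [hA, hR₀ w hw, show w • x - K x - w • x = -K x by abel, map_neg]
    simpa using hx
  have hiff : ∀ w : ℂ, w.re ≠ 0 → IsUnit (1 - -(R₀ w) * K) → w ∉ spec A := by
    intro w hw hu h
    refine h ⟨Ring.inverse (1 - -(R₀ w) * K) * R₀ w, fun x y => ?_⟩
    have e1 : ∀ v, Ring.inverse (1 - -(R₀ w) * K) ((1 - -(R₀ w) * K) v) = v := fun v =>
      congrArg (fun T : E →L[ℂ] E => T v) (Ring.inverse_mul_cancel _ hu)
    have e2 : ∀ v, (1 - -(R₀ w) * K) (Ring.inverse (1 - -(R₀ w) * K) v) = v := fun v =>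
      congrArg (fun T : E →L[ℂ] E => T v) (Ring.mul_inverse_cancel _ hu)
    have key : R₀ w (y - K x - w • x) = x ↔ R₀ w (y - w • x) = (1 - -(R₀ w) * K) x := by
      simp only [map_sub, map_smul, sub_apply, one_apply_eq_self, mul_apply_eq,
        neg_apply]
      constructor <;> intro h <;> linear_combination (norm := module) h
    rw [hA, hR₀ w hw, key]
    constructor
    · intro h
      rw [mul_apply_eq, h, e1]
    · intro h
      rw [← e2 (R₀ w (y - w • x))]
      exact congrArg _ h
  have hnu : ¬ IsUnit (1 - -(R₀ z) * K) := fun h => hiff z hre h hz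
  obtain ⟨x, hx0, hx⟩ := exists_fixed_of_not_isUnit (hT_mem z) hnu
  refine ⟨?_, x, hx0, hfix z hre x hx⟩
  -- the open half plane containing `z`
  let U : Set ℂ := {w | 0 < z.re * w.re}
  have hUre : ∀ w ∈ U, w.re ≠ 0 := by
    rintro w hw h0
    simp [U, h0] at hw
  have hUo : IsOpen U := isOpen_lt continuous_const (by fun_prop)
  have hzU : z ∈ U := mul_self_pos.2 hre
  have hUconv : Convex ℝ U := by
    intro a ha b hb s t hs ht hst
    simp only [U, Set.mem_ofPred_eq] at ha hb ⊢
    simp only [Complex.add_re, Complex.smul_re, smul_eq_mul]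
    rcases hs.eq_or_lt with h | h
    · subst h
      obtain rfl : t = 1 := by linarith
      simpa using hb
    · nlinarith [mul_pos h ha, mul_nonneg ht hb.le]
  have hR₀eq : ∀ w ∈ U, boundedInverse S w = R₀ w := fun w hw =>
    (hR₀ w (hUre w hw)).boundedInverse_eq
  have hdiff : DifferentiableOn ℂ R₀ U := by
    intro w hw
    refine (DifferentiableAt.congr_of_eventuallyEq
      (differentiableAt_boundedInverse (hS w (hUre w hw))) ?_).differentiableWithinAt
    filter_upwards [hUo.mem_nhds hw] with v hv using (hR₀eq v hv).symm
  have hTdiff : DifferentiableOn ℂ (fun w => -(R₀ w) * K) U := hdiff.neg.mul_const K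
  -- far from the imaginary axis, `‖R₀‖ ‖K‖ < 1`
  obtain ⟨z₁, hz₁, hu₁⟩ : ∃ z₁ ∈ U, IsUnit (1 - -(R₀ z₁) * K) := by
    let t : ℝ := (‖K‖ + 1) / z.re
    have ht : z.re * t = ‖K‖ + 1 := by simp only [t]; field_simp
    have hzt : (t : ℂ) ∈ U := by
      simp only [U, Set.mem_ofPred_eq, Complex.ofReal_re, ht]; positivity
    have hU' : ((t * |z.re| : ℝ) : ℂ) ∈ U := by
      simp only [U, Set.mem_ofPred_eq, Complex.ofReal_re, ← mul_assoc, ht]; positivity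
    refine ⟨_, hU', isUnit_one_sub_of_norm_lt_one ?_⟩
    have h1 := hnorm _ (hUre _ hU')
    have h2 : |((t * |z.re| : ℝ) : ℂ).re| = ‖K‖ + 1 := by
      rw [Complex.ofReal_re, abs_mul, abs_abs, ← abs_mul, mul_comm, ht, abs_of_pos (by positivity)]
    rw [h2] at h1
    calc ‖-(R₀ _) * K‖ ≤ ‖-(R₀ _)‖ * ‖K‖ := norm_mul_le _ _
      _ ≤ (‖K‖ + 1)⁻¹ * ‖K‖ := by rw [norm_neg]; gcongr
      _ < 1 := by rw [inv_mul_lt_one₀ (by positivity)]; linarith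
  have hev := eventually_isUnit_one_sub hUo hUconv.isPreconnected hTdiff
    (fun w _ => hT_mem w) hz₁ hu₁ hzU
  have hev' : ∀ᶠ w in 𝓝 z, w ∈ U ∧ (w ≠ z → w ∉ spec A) := by
    rw [eventually_nhdsWithin_iff] at hev
    filter_upwards [hev, hUo.mem_nhds hzU] with w hw hwU
    exact ⟨hwU, fun hne => hiff w (hUre w hwU) (hw hne)⟩
  obtain ⟨ε, hε, hball⟩ := Metric.nhds_basis_closedBall.eventually_iff.1 hev'
  have hiso : Metric.closedBall z ε ∩ spec A = {z} := by
    refine Set.Subset.antisymm (fun w hw => ?_) ?_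
    · by_contra hne
      exact (hball hw.1).2 hne hw.2
    · rintro _ rfl
      exact ⟨Metric.mem_closedBall_self hε.le, hz⟩
  refine ⟨hz, ⟨ε, hε, hiso⟩, fun δ hδ hδiso => ?_⟩
  refine finiteDimensional_range_of_idempotent ?_ (rieszProjector_mul_self hδ hδiso)
  -- shrink the circle into the half plane
  set r := min δ ε with hr_def
  have hr : 0 < r := lt_min hδ hε
  rw [rieszProjector_eq_of_le hr (min_le_left _ _) hδiso, rieszProjector]
  refine Submodule.smul_mem _ _ ?_
  have hsph : ∀ w ∈ Metric.sphere z r, w ∈ U ∧ w ∉ spec A := by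
    intro w hw
    have := hball (Metric.closedBall_subset_closedBall (min_le_right δ ε)
      (Metric.sphere_subset_closedBall hw))
    exact ⟨this.1, this.2 (Metric.ne_of_mem_sphere hw hr.ne')⟩
  have hcA : ContinuousOn (boundedInverse A) (Metric.sphere z r) := fun w hw =>
    (differentiableAt_boundedInverse (hsph w hw).2).continuousAt.continuousWithinAt
  have hcS : ContinuousOn R₀ (Metric.sphere z r) :=
    hdiff.continuousOn.mono fun w hw => (hsph w hw).1
  have hsplit : (∮ w in C(z, r), -(boundedInverse A w)) =
      (∮ w in C(z, r), R₀ w * K * boundedInverse A w) - ∮ w in C(z, r), R₀ w := by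
    rw [← circleIntegral.integral_sub]
    · refine circleIntegral.integral_congr hr.le fun w hw => ?_
      have hw' := hUre w (hsph w hw).1
      have hB := isBoundedInverse_boundedInverse (hsph w hw).2
      ext x
      have h1 : A (boundedInverse A w x) (x + w • boundedInverse A w x) := (hB _ _).2 (by simp)
      rw [hA, hR₀ w hw'] at h1
      simp only [map_sub, map_add, map_smul] at h1
      simp only [neg_apply, sub_apply, mul_apply_eq]
      linear_combination (norm := module) h1
    · exact ((hcS.mul continuousOn_const).mul hcA).circleIntegrable hr.le
    · exact hcS.circleIntegrable hr.le
  have hzero : (∮ w in C(z, r), R₀ w) = 0 := by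
    have hin : Metric.closedBall z r ⊆ U := fun w hw =>
      (hball (Metric.closedBall_subset_closedBall (min_le_right δ ε) hw)).1
    exact Complex.circleIntegral_eq_zero_of_differentiable_on_off_countable hr.le
      Set.countable_empty (hdiff.continuousOn.mono hin) fun w hw =>
        (hdiff.differentiableAt (hUo.mem_nhds (hin (Metric.ball_subset_closedBall hw.1))))
  rw [hsplit, hzero, sub_zero]
  refine circleIntegral_mem isClosed_approxFiniteRank hr.le ((hcS.mul continuousOn_const).mul hcA)
    fun w _ => ?_
  exact approxFiniteRank_comp (comp_mem_approxFiniteRank _ hK) _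

end Resolvent

/-! ### Rotations and circular flows of the plane -/

section Rotation

@[simp] theorem perp_apply_zero (x : Plane) : perp x 0 = -x 1 := rfl

@[simp] theorem perp_apply_one (x : Plane) : perp x 1 = x 0 := rfl

@[simp] theorem rot_apply_zero (θ : ℝ) (x : Plane) :
    rot θ x 0 = Real.cos θ * x 0 - Real.sin θ * x 1 := rfl

@[simp] theorem rot_apply_one (θ : ℝ) (x : Plane) :
    rot θ x 1 = Real.sin θ * x 0 + Real.cos θ * x 1 := rfl

theorem plane_ext {x y : Plane} (h0 : x 0 = y 0) (h1 : x 1 = y 1) : x = y := by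
  ext i
  fin_cases i
  · exact h0
  · exact h1

theorem norm_sq_plane (x : Plane) : ‖x‖ ^ 2 = x 0 ^ 2 + x 1 ^ 2 := by
  simp [EuclideanSpace.norm_sq_eq, Fin.sum_univ_two]

/-- The quarter turn as a linear map. -/
noncomputable def perpL : Plane →L[ℝ] Plane :=
  LinearMap.toContinuousLinearMap
    { toFun := perp
      map_add' := fun x y => plane_ext (by simp; ring) (by simp)
      map_smul' := fun c x => plane_ext (by simp) (by simp) }

@[simp] theorem perpL_apply (x : Plane) : perpL x = perp x := rfl

theorem contDiff_perp : ContDiff ℝ ∞ perp := perpL.contDiff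

theorem continuous_perp : Continuous perp := perpL.continuous

theorem rot_eq (θ : ℝ) (x : Plane) : rot θ x = Real.cos θ • x + Real.sin θ • perp x :=
  plane_ext (by simp; ring) (by simp; ring)

theorem norm_perp (x : Plane) : ‖perp x‖ = ‖x‖ := by
  rw [← sq_eq_sq₀ (norm_nonneg _) (norm_nonneg _), norm_sq_plane, norm_sq_plane]
  simp only [perp_apply_zero, perp_apply_one]; ring

@[simp] theorem norm_rot (θ : ℝ) (x : Plane) : ‖rot θ x‖ = ‖x‖ := by
  rw [← sq_eq_sq₀ (norm_nonneg _) (norm_nonneg _), norm_sq_plane, norm_sq_plane]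
  simp only [rot_apply_zero, rot_apply_one]
  linear_combination (x 0 ^ 2 + x 1 ^ 2) * Real.sin_sq_add_cos_sq θ

@[simp] theorem rot_zero (x : Plane) : rot 0 x = x := plane_ext (by simp) (by simp)

theorem rot_add (s t : ℝ) (x : Plane) : rot (s + t) x = rot s (rot t x) := by
  refine plane_ext ?_ ?_ <;> simp only [rot_apply_zero, rot_apply_one, Real.cos_add,
    Real.sin_add] <;> ring

theorem rot_two_pi (x : Plane) : rot (2 * Real.pi) x = x := plane_ext (by simp) (by simp)

/-- The rotation by `θ` as a linear isometry. -/
noncomputable def rotL (θ : ℝ) : Plane ≃ₗᵢ[ℝ] Plane where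
  toFun := rot θ
  invFun := rot (-θ)
  map_add' x y := plane_ext (by simp; ring) (by simp; ring)
  map_smul' c x := plane_ext (by simp; ring) (by simp; ring)
  left_inv x := by rw [← rot_add]; simp
  right_inv x := by rw [← rot_add]; simp
  norm_map' x := norm_rot θ x

@[simp] theorem rotL_apply (θ : ℝ) (x : Plane) : rotL θ x = rot θ x := rfl

theorem rot_sub (θ : ℝ) (x y : Plane) : rot θ (x - y) = rot θ x - rot θ y := map_sub (rotL θ) x y

theorem rot_smul (θ c : ℝ) (x : Plane) : rot θ (c • x) = c • rot θ x := map_smul (rotL θ) c x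

theorem rot_perp (θ : ℝ) (x : Plane) : rot θ (perp x) = perp (rot θ x) :=
  plane_ext (by simp; ring) (by simp; ring)

theorem _root_.Continuous.rot {X : Type*} [TopologicalSpace X] {f : X → ℝ} {h : X → Plane}
    (hf : Continuous f) (hh : Continuous h) : Continuous fun x => rot (f x) (h x) := by
  simp only [rot_eq]
  have := continuous_perp.comp hh
  exact ((Real.continuous_cos.comp hf).smul hh).add ((Real.continuous_sin.comp hf).smul this)

theorem _root_.Measurable.rot {X : Type*} [MeasurableSpace X] {f : X → ℝ} {h : X → Plane}
    (hf : Measurable f) (hh : Measurable h) : Measurable fun x => rot (f x) (h x) := by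
  simp only [rot_eq]
  have := continuous_perp.measurable.comp hh
  exact (hf.cos.smul hh).add (hf.sin.smul this)

theorem rot_periodic (x : Plane) (n : ℤ) (θ : ℝ) : rot (n * (2 * Real.pi) + θ) x = rot θ x := by
  refine plane_ext ?_ ?_ <;>
    simp [add_comm _ θ]

/-- The circular flow with angular velocity `a`: the point `x` is rotated by the angle `t a(x)`. -/
noncomputable def flow (a : Plane → ℝ) (t : ℝ) (x : Plane) : Plane := rot (t * a x) x

variable {a : Plane → ℝ}

theorem flow_zero (x : Plane) : flow a 0 x = x := by simp [flow]

theorem norm_flow (t : ℝ) (x : Plane) : ‖flow a t x‖ = ‖x‖ := norm_rot _ _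

theorem flow_add (ha : ∀ θ x, a (rot θ x) = a x) (s t : ℝ) (x : Plane) :
    flow a (s + t) x = flow a s (flow a t x) := by
  rw [flow, flow, flow, ha, ← rot_add, add_mul]

theorem flow_rot (ha : ∀ θ x, a (rot θ x) = a x) (t θ : ℝ) (x : Plane) :
    flow a t (rot θ x) = rot θ (flow a t x) := by
  rw [flow, flow, ha, ← rot_add, ← rot_add, add_comm]

theorem _root_.Continuous.circularFlow (ha : Continuous a) {X : Type*} [TopologicalSpace X] {f : X → ℝ}
    {h : X → Plane} (hf : Continuous f) (hh : Continuous h) :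
    Continuous fun x => flow a (f x) (h x) :=
  Continuous.rot (hf.mul (ha.comp hh)) hh

theorem continuous_flow (ha : Continuous a) (t : ℝ) : Continuous (flow a t) :=
  Continuous.circularFlow ha continuous_const continuous_id

theorem measurableEmbedding_flow (hc : Continuous a) (ha : ∀ θ x, a (rot θ x) = a x) (t : ℝ) :
    MeasurableEmbedding (flow a t) := by
  let e : Plane ≃ₜ Plane :=
    { toFun := flow a t
      invFun := flow a (-t)
      left_inv := fun x => by rw [← flow_add ha, neg_add_cancel, flow_zero]
      right_inv := fun x => by rw [← flow_add ha, add_neg_cancel, flow_zero]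
      continuous_toFun := continuous_flow hc t
      continuous_invFun := continuous_flow hc (-t) }
  exact e.measurableEmbedding

theorem contDiff_flow (ha : ContDiff ℝ ∞ a) (t : ℝ) : ContDiff ℝ ∞ (flow a t) := by
  have h : flow a t = fun x => Real.cos (t * a x) • x + Real.sin (t * a x) • perp x := by
    ext1 x; exact rot_eq _ _
  rw [h]
  have h1 : ContDiff ℝ ∞ fun x => t * a x := contDiff_const.mul ha
  exact ((Real.contDiff_cos.comp h1).smul contDiff_id).add
    ((Real.contDiff_sin.comp h1).smul contDiff_perp)

theorem hasDerivAt_flow (ha : ∀ θ x, a (rot θ x) = a x) (t : ℝ) (x : Plane) :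
    HasDerivAt (fun s => flow a s x) (a (flow a t x) • perp (flow a t x)) t := by
  have h : (fun s => flow a s x) = fun s => Real.cos (s * a x) • x + Real.sin (s * a x) • perp x := by
    ext1 x; exact rot_eq _ _
  rw [h]
  have h1 : HasDerivAt (fun s => s * a x) (a x) t := by
    simpa using (hasDerivAt_id t).mul_const (a x)
  have h2 := (h1.cos.smul_const x).add (h1.sin.smul_const (perp x))
  refine h2.congr_deriv ?_
  have h3 : a (flow a t x) = a x := ha _ _
  rw [h3]
  refine plane_ext ?_ ?_ <;> simp [flow] <;> ring

/-- Averaging over the circle removes a shift of the angle. -/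
theorem lintegral_rot_add (f : Plane → ENNReal) (τ : ℝ) (x : Plane) :
    ∫⁻ θ in Set.Ioc 0 (2 * Real.pi), f (rot (θ + τ) x) =
      ∫⁻ θ in Set.Ioc 0 (2 * Real.pi), f (rot θ x) := by
  have hT : 0 < 2 * Real.pi := by positivity
  have h1 : ∫⁻ θ in Set.Ioc 0 (2 * Real.pi), f (rot (θ + τ) x) =
      ∫⁻ θ in Set.Ioc τ (τ + 2 * Real.pi), f (rot θ x) := by
    have hmp : MeasurePreserving (fun θ : ℝ => θ + τ) volume volume :=
      measurePreserving_add_right volume τ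
    have he : MeasurableEmbedding fun θ : ℝ => θ + τ := measurableEmbedding_addRight τ
    rw [← hmp.setLIntegral_comp_preimage_emb he (fun θ => f (rot θ x))]
    congr 3
    ext θ
    simp [add_comm τ]
  rw [h1]
  have h2 := (isAddFundamentalDomain_Ioc hT τ).setLIntegral_eq (isAddFundamentalDomain_Ioc hT 0)
    (fun θ => f (rot θ x)) (by
      rintro ⟨_, n, rfl⟩ θ
      have := rot_periodic x n θ
      simp only [AddSubgroup.vadd_def, vadd_eq_add, zsmul_eq_mul]
      rw [this])
  simpa using h2

/-- A circular flow preserves the area: since its angle is constant on the circles around the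
origin, it has the same effect on angular averages as no rotation at all. -/
theorem measurePreserving_flow (hm : Measurable a) (ha : ∀ θ x, a (rot θ x) = a x) (t : ℝ) :
    MeasurePreserving (flow a t) volume volume := by
  have hmeas : Measurable (flow a t) := (hm.const_mul t).rot measurable_id
  refine ⟨hmeas, Measure.ext fun s hs => ?_⟩
  rw [Measure.map_apply hmeas hs]
  let f : Plane → ENNReal := s.indicator 1
  have hf : Measurable f := measurable_one.indicator hs
  have key : ∀ b : Plane → ℝ, Measurable b → (∀ θ x, b (rot θ x) = b x) →
      ENNReal.ofReal (2 * Real.pi) * ∫⁻ x, f (rot (b x) x) =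
        ∫⁻ x, ∫⁻ θ in Set.Ioc 0 (2 * Real.pi), f (rot θ x) := by
    intro b hbm hb
    have hjm : Measurable fun p : ℝ × Plane => f (rot (p.1 + b p.2) p.2) :=
      hf.comp (Measurable.rot (by fun_prop) measurable_snd)
    have hbm' : Measurable fun x => f (rot (b x) x) := hf.comp (hbm.rot measurable_id)
    have e1 : ∀ θ : ℝ, ∫⁻ x, f (rot (b x) x) = ∫⁻ x, f (rot (θ + b x) x) := by
      intro θ
      rw [← (measurePreserving_rot θ).lintegral_comp hbm']
      refine lintegral_congr fun x => ?_
      rw [hb, ← rot_add, add_comm]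
    calc ENNReal.ofReal (2 * Real.pi) * ∫⁻ x, f (rot (b x) x)
        = ∫⁻ _θ in Set.Ioc 0 (2 * Real.pi), ∫⁻ x, f (rot (b x) x) := by
          rw [setLIntegral_const, Real.volume_Ioc, sub_zero, mul_comm]
      _ = ∫⁻ θ in Set.Ioc 0 (2 * Real.pi), ∫⁻ x, f (rot (θ + b x) x) :=
          lintegral_congr fun θ => e1 θ
      _ = ∫⁻ x, ∫⁻ θ in Set.Ioc 0 (2 * Real.pi), f (rot (θ + b x) x) :=
          lintegral_lintegral_swap hjm.aemeasurable
      _ = _ := lintegral_congr fun x => lintegral_rot_add f (b x) x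
  have h1 := key (fun x => t * a x) (by fun_prop) (fun θ x => by rw [ha])
  have h2 := key (fun _ => 0) (by fun_prop) (fun _ _ => rfl)
  rw [← h2] at h1
  have h3 := (ENNReal.mul_right_inj (by simp [Real.pi_pos]) ENNReal.ofReal_ne_top).1 h1
  simp only [rot_zero] at h3
  rw [lintegral_indicator_one hs] at h3
  rw [← h3, ← lintegral_indicator_one (hmeas hs)]
  rfl

end Rotation

/-! ### Radial functions -/

section Radial

theorem contDiff_of_radial {a : Plane → ℝ} {f : ℝ → ℝ} (hf : ContDiffOn ℝ ∞ f (Set.Ioi 0))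
    (haf : ∀ x, x ≠ 0 → a x = f ‖x‖) {A B : ℝ} (h0 : ∀ᶠ x in 𝓝 0, a x = A + B * ‖x‖ ^ 2) :
    ContDiff ℝ ∞ a := by
  rw [contDiff_iff_contDiffAt]
  intro x
  by_cases hx : x = 0
  · subst hx
    exact (contDiff_const.add (contDiff_const.mul (contDiff_norm_sq ℝ))).contDiffAt.congr_of_eventuallyEq h0
  · have h1 : ContDiffAt ℝ ∞ f ‖x‖ := hf.contDiffAt (Ioi_mem_nhds (norm_pos_iff.2 hx))
    refine (h1.comp x (contDiffAt_norm ℝ hx)).congr_of_eventuallyEq ?_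
    filter_upwards [isOpen_ne.mem_nhds hx] with y hy using haf y hy

variable {α : ℝ} {g : ℝ → ℝ}

theorem IsProfile.contDiff_vorticity (hg : IsProfile α g) : ContDiff ℝ ∞ (vorticity g) := by
  obtain ⟨c, δ, hδ, h⟩ := hg.near_zero
  refine contDiff_of_radial (f := g) (A := g 0) (B := c)
    (hg.smooth.mono Set.Ioi_subset_Ici_self) (fun _ _ => rfl) ?_
  filter_upwards [Metric.ball_mem_nhds (0 : Plane) hδ] with x hx
  exact h _ (norm_nonneg _) (by simpa using hx)

theorem IsProfile.intervalIntegrable (hg : IsProfile α g) {r : ℝ} (hr : 0 ≤ r) :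
    IntervalIntegrable (fun ρ => ρ * g ρ) volume 0 r := by
  refine ContinuousOn.intervalIntegrable ?_
  rw [Set.uIcc_of_le hr]
  exact continuousOn_id.mul (hg.smooth.continuousOn.mono Set.Icc_subset_Ici_self)

theorem IsProfile.hasDerivAt_integral (hg : IsProfile α g) {r : ℝ} (hr : 0 < r) :
    HasDerivAt (fun r => ∫ ρ in (0 : ℝ)..r, ρ * g ρ) (r * g r) r := by
  have hc : ContinuousOn (fun ρ => ρ * g ρ) (Set.Ioi 0) :=
    continuousOn_id.mul (hg.smooth.continuousOn.mono Set.Ioi_subset_Ici_self)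
  exact intervalIntegral.integral_hasDerivAt_right (hg.intervalIntegrable hr.le)
    (hc.stronglyMeasurableAtFilter isOpen_Ioi r hr) (hc.continuousAt (Ioi_mem_nhds hr))

theorem IsProfile.contDiffOn_zeta (hg : IsProfile α g) : ContDiffOn ℝ ∞ (zeta g) (Set.Ioi 0) := by
  have h1 : ContDiffOn ℝ ∞ (fun r => ∫ ρ in (0 : ℝ)..r, ρ * g ρ) (Set.Ioi 0) := by
    refine (contDiffOn_infty_iff_deriv_of_isOpen isOpen_Ioi).2 ⟨fun r hr =>
      (hg.hasDerivAt_integral hr).differentiableAt.differentiableWithinAt, ?_⟩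
    refine (contDiffOn_id.mul (hg.smooth.mono Set.Ioi_subset_Ici_self)).congr fun r hr => ?_
    exact (hg.hasDerivAt_integral hr).deriv
  refine ContDiffOn.mul (ContDiffOn.inv (contDiffOn_id.pow 2) fun r hr => ?_) h1
  exact (pow_pos hr 2).ne'

open Classical in
/-- The angular velocity `ζ(|x|)` of the vortex, with the value `g(0)/2` at the origin, which makes
it smooth (`zeta g 0` is a junk value). -/
noncomputable def angularVelocity (g : ℝ → ℝ) (x : Plane) : ℝ :=
  if x = 0 then g 0 / 2 else zeta g ‖x‖

theorem velocity_eq (g : ℝ → ℝ) (x : Plane) : velocity g x = angularVelocity g x • perp x := by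
  by_cases hx : x = 0
  · subst hx
    have : perp 0 = 0 := perpL.map_zero
    simp [velocity, this]
  · simp [velocity, angularVelocity, hx]

theorem angularVelocity_rot (g : ℝ → ℝ) (θ : ℝ) (x : Plane) :
    angularVelocity g (rot θ x) = angularVelocity g x := by
  have : rot θ x = 0 ↔ x = 0 := (rotL θ).map_eq_zero_iff
  simp [angularVelocity, this]

theorem IsProfile.contDiff_angularVelocity (hg : IsProfile α g) :
    ContDiff ℝ ∞ (angularVelocity g) := by
  obtain ⟨c, δ, hδ, h⟩ := hg.near_zero
  refine contDiff_of_radial (f := zeta g) (A := g 0 / 2) (B := c / 4) hg.contDiffOn_zeta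
    (fun x hx => by simp [angularVelocity, hx]) ?_
  filter_upwards [Metric.ball_mem_nhds (0 : Plane) hδ] with x hx
  by_cases hx0 : x = 0
  · simp [angularVelocity, hx0]
  have hr : 0 < ‖x‖ := norm_pos_iff.2 hx0
  have hxδ : ‖x‖ < δ := by simpa using hx
  have hint : ∫ ρ in (0 : ℝ)..‖x‖, ρ * g ρ = g 0 * ‖x‖ ^ 2 / 2 + c * ‖x‖ ^ 4 / 4 := by
    have : ∫ ρ in (0 : ℝ)..‖x‖, ρ * g ρ = ∫ ρ in (0 : ℝ)..‖x‖, (g 0 * ρ + c * ρ ^ 3) := by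
      refine intervalIntegral.integral_congr fun ρ hρ => ?_
      rw [Set.uIcc_of_le hr.le] at hρ
      simp only [h ρ hρ.1 (hρ.2.trans_lt hxδ)]
      ring
    rw [this, intervalIntegral.integral_add (Continuous.intervalIntegrable (by fun_prop) _ _)
      (Continuous.intervalIntegrable (by fun_prop) _ _), intervalIntegral.integral_const_mul,
      intervalIntegral.integral_const_mul, integral_id, integral_pow]
    norm_num
    ring
  simp only [angularVelocity, hx0, if_false, zeta, hint]
  field_simp

end Radial

/-! ### The transport operator and its resolvent -/

/-- The complex Hilbert space `L²` of the plane. -/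
abbrev L2 : Type := Lp ℂ 2 (volume : Measure Plane)

section TestFunctional

/-- The functional `f ↦ ∫ φ f` on `L²` given by a real function `φ ∈ L²`. -/
noncomputable def testFunctional (φ : Plane → ℝ) (hφ : MemLp (fun x => (φ x : ℂ)) 2 volume) :
    L2 →L[ℂ] ℂ :=
  innerSL ℂ (hφ.toLp _)

theorem testFunctional_apply {φ : Plane → ℝ} (hφ : MemLp (fun x => (φ x : ℂ)) 2 volume) (f : L2) :
    testFunctional φ hφ f = ∫ x, (φ x : ℂ) * f x := by
  rw [testFunctional, innerSL_apply_apply, L2.inner_def]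
  refine integral_congr_ae ?_
  filter_upwards [hφ.coeFn_toLp] with x hx
  rw [hx]
  simp [mul_comm]

theorem memLp_ofReal {φ : Plane → ℝ} (hφ : Continuous φ) (hc : HasCompactSupport φ) :
    MemLp (fun x => (φ x : ℂ)) 2 volume :=
  (Complex.continuous_ofReal.comp hφ).memLp_of_hasCompactSupport
    (hc.comp_left (g := Complex.ofReal) Complex.ofReal_zero)

theorem integrable_test_mul {φ : Plane → ℝ} (hφ : Continuous φ) (hc : HasCompactSupport φ)
    {f : Plane → ℂ} (hf : MemLp f 2 volume) : Integrable (fun x => (φ x : ℂ) * f x) :=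
  (memLp_ofReal hφ hc).integrable_mul hf

/-- Elements of `L²` are determined by their integrals against test functions. -/
theorem eq_of_forall_test {f h : L2}
    (H : ∀ φ : Plane → ℝ, ContDiff ℝ ∞ φ → HasCompactSupport φ →
      ∫ x, (φ x : ℂ) * f x = ∫ x, (φ x : ℂ) * h x) : f = h := by
  have hf : LocallyIntegrable (fun x => f x - h x) volume :=
    ((Lp.memLp f).sub (Lp.memLp h)).locallyIntegrable (by norm_num)
  have := ae_eq_zero_of_integral_contDiff_smul_eq_zero hf fun φ hφ hc => by
    have h1 := integrable_test_mul hφ.continuous hc (Lp.memLp f)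
    have h2 := integrable_test_mul hφ.continuous hc (Lp.memLp h)
    have h3 : ∀ x, φ x • (f x - h x) = (φ x : ℂ) * f x - (φ x : ℂ) * h x := fun x => by
      rw [Complex.real_smul, mul_sub]
    simp only [h3]
    rw [integral_sub h1 h2, H φ hφ hc, sub_self]
  refine Lp.ext ?_
  filter_upwards [this] with x hx using sub_eq_zero.1 hx

end TestFunctional

section Transport

variable {a : Plane → ℝ}

/-- The derivative `(a(x) x^⊥) · ∇φ` of `φ` along the circular flow. -/
noncomputable def alongFlow (a : Plane → ℝ) (φ : Plane → ℝ) (x : Plane) : ℝ :=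
  fderiv ℝ φ x (a x • perp x)

theorem continuous_alongFlow (ha : Continuous a) {φ : Plane → ℝ} (hφ : ContDiff ℝ ∞ φ) :
    Continuous (alongFlow a φ) :=
  (hφ.continuous_fderiv (by simp)).clm_apply (ha.smul continuous_perp)

theorem hasCompactSupport_alongFlow {φ : Plane → ℝ} (hc : HasCompactSupport φ) :
    HasCompactSupport (alongFlow a φ) := by
  refine (hc.fderiv (𝕜 := ℝ)).mono fun x hx => ?_
  contrapose! hx
  simp only [Function.mem_support, ne_eq, not_not] at hx
  simp [alongFlow, hx]

theorem hasDerivAt_comp_flow (ha : ∀ θ x, a (rot θ x) = a x) {φ : Plane → ℝ}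
    (hφ : ContDiff ℝ ∞ φ) (t : ℝ) (x : Plane) :
    HasDerivAt (fun s => φ (flow a s x)) (alongFlow a φ (flow a t x)) t :=
  ((hφ.differentiable (by simp)) (flow a t x)).hasFDerivAt.comp_hasDerivAt t
    (hasDerivAt_flow ha t x)

theorem alongFlow_comp_flow (hs : ContDiff ℝ ∞ a) (ha : ∀ θ x, a (rot θ x) = a x) {φ : Plane → ℝ}
    (hφ : ContDiff ℝ ∞ φ) (t : ℝ) (x : Plane) :
    alongFlow a (fun y => φ (flow a t y)) x = alongFlow a φ (flow a t x) := by
  have h1 := hasDerivAt_comp_flow ha (hφ.comp (contDiff_flow hs t)) 0 x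
  have h2 := hasDerivAt_comp_flow ha hφ t x
  have h3 : (fun s => (φ ∘ flow a t) (flow a s x)) = fun s => φ (flow a (s + t) x) := by
    ext s; rw [Function.comp_apply, ← flow_add ha, add_comm]
  rw [h3] at h1
  have h4 : HasDerivAt (fun s => φ (flow a (s + t) x)) (alongFlow a φ (flow a t x)) 0 := by
    have h5 : HasDerivAt (fun s => φ (flow a s x)) (alongFlow a φ (flow a t x)) (0 + t) := by
      rwa [zero_add]
    exact HasDerivAt.comp_add_const 0 t h5
  have h6 := h1.unique h4
  rw [flow_zero] at h6
  exact h6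

theorem hasCompactSupport_comp_flow {φ : Plane → ℝ} (hc : HasCompactSupport φ) (t : ℝ) :
    HasCompactSupport fun x => φ (flow a t x) := by
  obtain ⟨R, hR⟩ := hc.isCompact.isBounded.subset_closedBall 0
  refine HasCompactSupport.intro (isCompact_closedBall (0 : Plane) R) fun x hx => ?_
  by_contra hne
  have h1 := hR (subset_tsupport φ (Function.mem_support.2 hne))
  rw [mem_closedBall_zero_iff, norm_flow] at h1
  exact hx (mem_closedBall_zero_iff.2 h1)

/-- The pull back `f ↦ f ∘ Φ_{-t}` along the circular flow. -/
noncomputable def pull (hm : Measurable a) (ha : ∀ θ x, a (rot θ x) = a x) (t : ℝ) : L2 →ₗᵢ[ℂ] L2 :=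
  Lp.compMeasurePreservingₗᵢ ℂ (flow a (-t)) (measurePreserving_flow hm ha (-t))

theorem coeFn_pull (hm : Measurable a) (ha : ∀ θ x, a (rot θ x) = a x) (t : ℝ) (f : L2) :
    pull hm ha t f =ᵐ[volume] fun x => f (flow a (-t) x) :=
  Lp.coeFn_compMeasurePreserving f (measurePreserving_flow hm ha (-t))

theorem continuous_pull (hc : Continuous a) (ha : ∀ θ x, a (rot θ x) = a x) (f : L2) :
    Continuous fun t => pull hc.measurable ha t f := by
  let F : C(ℝ × Plane, Plane) :=
    ⟨fun p => flow a (-p.1) p.2, Continuous.circularFlow hc (continuous_fst.neg) continuous_snd⟩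
  exact Continuous.compMeasurePreservingLp (f := fun _ : ℝ => f) (g := F.curry) continuous_const
    F.curry.continuous (fun t => measurePreserving_flow hc.measurable ha (-t)) (by norm_num)

theorem integral_mul_pull (hc : Continuous a) (ha : ∀ θ x, a (rot θ x) = a x) {φ : Plane → ℝ}
    (t : ℝ) (f : L2) :
    ∫ x, (φ x : ℂ) * pull hc.measurable ha t f x = ∫ x, (φ (flow a t x) : ℂ) * f x := by
  have hmp := measurePreserving_flow hc.measurable ha (-t)
  have h1 : ∫ x, (φ x : ℂ) * pull hc.measurable ha t f x =
      ∫ x, (φ (flow a t (flow a (-t) x)) : ℂ) * f (flow a (-t) x) := by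
    refine integral_congr_ae ?_
    filter_upwards [coeFn_pull hc.measurable ha t f] with x hx
    rw [hx, ← flow_add ha, add_neg_cancel, flow_zero]
  rw [h1]
  exact hmp.integral_comp (measurableEmbedding_flow hc ha (-t))
    (fun y => (φ (flow a t y) : ℂ) * f y)

theorem hasDerivAt_integral_mul_pull (hc : Continuous a) (ha : ∀ θ x, a (rot θ x) = a x)
    {φ : Plane → ℝ} (hφ : ContDiff ℝ ∞ φ) (hφc : HasCompactSupport φ) (f : L2) (t : ℝ) :
    HasDerivAt (fun t => ∫ x, (φ x : ℂ) * pull hc.measurable ha t f x)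
      (∫ x, (alongFlow a φ x : ℂ) * pull hc.measurable ha t f x) t := by
  have hcW := continuous_alongFlow hc hφ
  have hW := hasCompactSupport_alongFlow (a := a) hφc
  simp only [integral_mul_pull hc ha]
  obtain ⟨M, hM⟩ := hcW.bounded_above_of_compact_support hW
  obtain ⟨R, hR⟩ := hW.isCompact.isBounded.subset_closedBall 0
  have hflow := continuous_flow hc
  have hmeas : ∀ {ψ : Plane → ℝ} (_ : Continuous ψ) (s : ℝ),
      AEStronglyMeasurable (fun x => (ψ (flow a s x) : ℂ) * f x) volume := fun hψ s =>
    (Complex.continuous_ofReal.comp (hψ.comp (hflow s))).aestronglyMeasurable.mul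
      (Lp.aestronglyMeasurable f)
  have hloc : Integrable ((Metric.closedBall (0 : Plane) R).indicator fun x => M * ‖f x‖) := by
    rw [integrable_indicator_iff Metric.isClosed_closedBall.measurableSet]
    have h1 : LocallyIntegrable f volume := (Lp.memLp f).locallyIntegrable (by norm_num)
    exact ((h1.integrableOn_isCompact (isCompact_closedBall _ _)).norm).const_mul M
  refine (hasDerivAt_integral_of_dominated_loc_of_deriv_le
    (F := fun s x => (φ (flow a s x) : ℂ) * f x)
    (F' := fun s x => (alongFlow a φ (flow a s x) : ℂ) * f x)
    (bound := (Metric.closedBall (0 : Plane) R).indicator fun x => M * ‖f x‖)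
    univ_mem (Eventually.of_forall fun s => hmeas hφ.continuous s) ?_ (hmeas hcW t) ?_ hloc ?_).2
  · exact integrable_test_mul (hφ.continuous.comp (hflow t))
      (hasCompactSupport_comp_flow hφc t) (Lp.memLp f)
  · refine Eventually.of_forall fun x s _ => ?_
    by_cases hx : x ∈ Metric.closedBall (0 : Plane) R
    · rw [Set.indicator_of_mem hx, norm_mul, Complex.norm_real]
      exact mul_le_mul_of_nonneg_right (hM _) (norm_nonneg _)
    · have h0 : alongFlow a φ (flow a s x) = 0 := by
        by_contra hne
        have h1 := hR (subset_tsupport _ (Function.mem_support.2 hne))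
        rw [mem_closedBall_zero_iff, norm_flow] at h1
        exact hx (mem_closedBall_zero_iff.2 h1)
      rw [Set.indicator_of_notMem hx, h0]
      simp
  · exact Eventually.of_forall fun x s _ =>
      ((hasDerivAt_comp_flow ha hφ s x).ofReal_comp).mul_const (f x)

/-- The graph of `Ω ↦ - div (a x^⊥ Ω)`, in terms of integrals against test functions. -/
def transport (a : Plane → ℝ) (Ω G : L2) : Prop :=
  ∀ φ : Plane → ℝ, ContDiff ℝ ∞ φ → HasCompactSupport φ →
    ∫ x, (φ x : ℂ) * G x = ∫ x, (alongFlow a φ x : ℂ) * Ω x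

theorem transport_neg {Ω G : L2} : transport (fun x => -a x) Ω (-G) ↔ transport a Ω G := by
  unfold transport
  refine forall_congr' fun φ => forall_congr' fun _ => forall_congr' fun _ => ?_
  have h1 : ∫ x, (φ x : ℂ) * (-G : L2) x = -∫ x, (φ x : ℂ) * G x := by
    rw [← integral_neg]
    refine integral_congr_ae ?_
    filter_upwards [Lp.coeFn_neg G] with x hx
    rw [hx]; simp
  have h2 : ∫ x, (alongFlow (fun x => -a x) φ x : ℂ) * Ω x = -∫ x, (alongFlow a φ x : ℂ) * Ω x := by
    rw [← integral_neg]
    refine integral_congr_ae (Eventually.of_forall fun x => ?_)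
    simp [alongFlow]
  rw [h1, h2, neg_inj]

theorem integrable_exp_smul_pull (hc : Continuous a) (ha : ∀ θ x, a (rot θ x) = a x) {z : ℂ}
    (hz : 0 < z.re) (f : L2) :
    IntegrableOn (fun t : ℝ => Complex.exp (-z * t) • pull hc.measurable ha t f) (Set.Ioi 0) := by
  have h1 := (integrableOn_exp_mul_complex_Ioi (a := -z) (by simpa using hz) 0).norm.mul_const ‖f‖
  refine h1.mono' ?_ (Eventually.of_forall fun t => ?_)
  · have : Continuous fun t : ℝ => Complex.exp (-z * t) • pull hc.measurable ha t f :=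
      (by fun_prop : Continuous fun t : ℝ => Complex.exp (-z * t)).smul (continuous_pull hc ha f)
    exact this.aestronglyMeasurable
  · rw [norm_smul, LinearIsometry.norm_map]

/-- The resolvent of the transport operator on the right half plane: minus the Laplace transform
of the group of pull backs. -/
noncomputable def transportResolvent (hc : Continuous a) (ha : ∀ θ x, a (rot θ x) = a x) (z : ℂ)
    (hz : 0 < z.re) : L2 →L[ℂ] L2 :=
  LinearMap.mkContinuous
    { toFun := fun f => -∫ t in Set.Ioi (0 : ℝ), Complex.exp (-z * t) • pull hc.measurable ha t f
      map_add' := fun f h => by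
        simp only [map_add, smul_add]
        rw [integral_add (integrable_exp_smul_pull hc ha hz f)
          (integrable_exp_smul_pull hc ha hz h), neg_add]
      map_smul' := fun c f => by
        simp only [map_smul, RingHom.id_apply, smul_comm _ c]
        rw [integral_smul, smul_neg] }
    z.re⁻¹ (by
      intro f
      simp only [LinearMap.coe_mk, AddHom.coe_mk, norm_neg]
      refine (norm_integral_le_integral_norm _).trans ?_
      have h1 : ∀ t : ℝ, ‖Complex.exp (-z * t) • pull hc.measurable ha t f‖ =
          Real.exp (-z.re * t) * ‖f‖ := fun t => by
        rw [norm_smul, LinearIsometry.norm_map, Complex.norm_exp]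
        simp
      simp only [h1]
      rw [integral_mul_const, integral_exp_mul_Ioi (by simpa using hz)]
      simp)

theorem norm_transportResolvent_le (hc : Continuous a) (ha : ∀ θ x, a (rot θ x) = a x) {z : ℂ}
    (hz : 0 < z.re) : ‖transportResolvent hc ha z hz‖ ≤ z.re⁻¹ :=
  LinearMap.mkContinuous_norm_le _ (inv_nonneg.2 hz.le) _

theorem transportResolvent_apply (hc : Continuous a) (ha : ∀ θ x, a (rot θ x) = a x) {z : ℂ}
    (hz : 0 < z.re) (f : L2) : transportResolvent hc ha z hz f =
      -∫ t in Set.Ioi (0 : ℝ), Complex.exp (-z * t) • pull hc.measurable ha t f := rfl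

theorem map_transportResolvent {E : Type*} [NormedAddCommGroup E] [NormedSpace ℂ E]
    [CompleteSpace E] (hc : Continuous a)
    (ha : ∀ θ x, a (rot θ x) = a x) {z : ℂ} (hz : 0 < z.re) (L : L2 →L[ℂ] E) (f : L2) :
    L (transportResolvent hc ha z hz f) =
      -∫ t in Set.Ioi (0 : ℝ), Complex.exp (-z * t) • L (pull hc.measurable ha t f) := by
  rw [transportResolvent_apply, map_neg,
    ← ContinuousLinearMap.integral_comp_comm _ (integrable_exp_smul_pull hc ha hz f)]
  simp only [map_smul]

/-- An integration by parts in time. -/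
theorem integral_exp_smul_deriv (hc : Continuous a) (ha : ∀ θ x, a (rot θ x) = a x) {z : ℂ}
    (hz : 0 < z.re) {L L' : L2 →L[ℂ] ℂ} (f : L2)
    (hL : ∀ t, HasDerivAt (fun t => L (pull hc.measurable ha t f))
      (L' (pull hc.measurable ha t f)) t) :
    L' (transportResolvent hc ha z hz f) = L f + z * L (transportResolvent hc ha z hz f) := by
  have hI : ∀ M : L2 →L[ℂ] ℂ, IntegrableOn
      (fun t : ℝ => Complex.exp (-z * t) • M (pull hc.measurable ha t f)) (Set.Ioi 0) := fun M => by
    have := M.integrable_comp (integrable_exp_smul_pull hc ha hz f)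
    simp only [map_smul] at this
    exact this
  have hd : ∀ t : ℝ, HasDerivAt
      (fun t : ℝ => Complex.exp (-z * t) • L (pull hc.measurable ha t f))
      (Complex.exp (-z * t) • L' (pull hc.measurable ha t f) -
        z • Complex.exp (-z * t) • L (pull hc.measurable ha t f)) t := by
    intro t
    have h1 : HasDerivAt (fun t : ℝ => Complex.exp (-z * t)) (Complex.exp (-z * t) * (-z)) t := by
      have h2 : HasDerivAt (fun t : ℝ => -z * (t : ℂ)) (-z) t := by
        simpa using (Complex.ofRealCLM.hasDerivAt (x := t)).const_mul (-z)
      exact h2.cexp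
    refine (h1.smul (hL t)).congr_deriv ?_
    simp only [smul_eq_mul]
    ring
  have htend : Tendsto (fun t : ℝ => Complex.exp (-z * t) • L (pull hc.measurable ha t f)) atTop
      (𝓝 0) := by
    have h1 : Tendsto (fun t : ℝ => Real.exp (-z.re * t) * (‖L‖ * ‖f‖)) atTop (𝓝 0) := by
      have : Tendsto (fun t : ℝ => Real.exp (-z.re * t)) atTop (𝓝 0) :=
        Real.tendsto_exp_atBot.comp (tendsto_id.const_mul_atTop_of_neg (by simpa using hz))
      simpa using this.mul_const (‖L‖ * ‖f‖)
    refine squeeze_zero_norm (fun t => ?_) h1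
    rw [norm_smul, Complex.norm_exp]
    have h2 : ‖L (pull hc.measurable ha t f)‖ ≤ ‖L‖ * ‖f‖ := by
      simpa using L.le_opNorm (pull hc.measurable ha t f)
    have h3 : (-z * (t : ℂ)).re = -z.re * t := by simp
    rw [h3]
    gcongr
  have hftc := integral_Ioi_of_hasDerivAt_of_tendsto (a := 0)
    (hd 0).continuousAt.continuousWithinAt (fun t _ => hd t) ((hI L').sub ((hI L).smul z)) htend
  have hsub := integral_sub (hI L') ((hI L).smul z)
  simp only [Pi.smul_apply] at hsub
  rw [hsub, integral_smul] at hftc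
  have h0 : pull hc.measurable ha 0 f = f := by
    refine Lp.ext ?_
    filter_upwards [coeFn_pull hc.measurable ha 0 f] with x hx
    rw [hx, neg_zero, flow_zero]
  rw [map_transportResolvent, map_transportResolvent]
  simp only [h0, Complex.ofReal_zero, mul_zero, Complex.exp_zero, smul_eq_mul] at hftc ⊢
  linear_combination -hftc

/-- Only test functions are differentiated along the flow: in both directions the identity is checked
against test functions, by `integral_exp_smul_deriv`. -/
theorem isBoundedInverse_transportResolvent (hs : ContDiff ℝ ∞ a)
    (ha : ∀ θ x, a (rot θ x) = a x) {z : ℂ} (hz : 0 < z.re) :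
    IsBoundedInverse (transport a) z (transportResolvent hs.continuous ha z hz) := by
  have hc := hs.continuous
  intro Ω G
  constructor
  · intro h
    refine eq_of_forall_test fun φ hφ hφc => ?_
    have m1 := memLp_ofReal hφ.continuous hφc
    have m2 := memLp_ofReal (continuous_alongFlow hc hφ) (hasCompactSupport_alongFlow (a := a) hφc)
    have key : ∀ t, testFunctional φ m1 (pull hc.measurable ha t G) =
        testFunctional _ m2 (pull hc.measurable ha t Ω) := by
      intro t
      rw [testFunctional_apply, testFunctional_apply, integral_mul_pull hc ha,
        integral_mul_pull hc ha, h (fun x => φ (flow a t x)) (hφ.comp (contDiff_flow hs t))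
          (hasCompactSupport_comp_flow hφc t)]
      simp only [alongFlow_comp_flow hs ha hφ]
    have h1 := integral_exp_smul_deriv hc ha hz (L := testFunctional φ m1)
      (L' := testFunctional _ m2) Ω (fun t => by
        simp only [testFunctional_apply]
        exact hasDerivAt_integral_mul_pull hc ha hφ hφc Ω t)
    rw [← testFunctional_apply m1, ← testFunctional_apply m1, map_sub, map_smul, map_sub, map_smul]
    have h2 : testFunctional φ m1 (transportResolvent hc ha z hz G) =
        testFunctional _ m2 (transportResolvent hc ha z hz Ω) := by
      rw [map_transportResolvent, map_transportResolvent]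
      simp only [key]
    rw [h2, h1, smul_eq_mul]
    ring
  · intro h φ hφ hφc
    have m1 := memLp_ofReal hφ.continuous hφc
    have m2 := memLp_ofReal (continuous_alongFlow hc hφ) (hasCompactSupport_alongFlow (a := a) hφc)
    have h1 := integral_exp_smul_deriv hc ha hz (L := testFunctional φ m1)
      (L' := testFunctional _ m2) (G - z • Ω) (fun t => by
        simp only [testFunctional_apply]
        exact hasDerivAt_integral_mul_pull hc ha hφ hφc _ t)
    rw [h, map_sub, map_smul, smul_eq_mul] at h1
    rw [← testFunctional_apply m1, ← testFunctional_apply m2, h1]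
    ring

end Transport

/-! ### Integral operators on `L²` -/

section KernelOperators

open scoped ENNReal

variable {X : Type*} [MeasurableSpace X] {μ : Measure X}

theorem sq_lintegral_mul_le {u v : X → ℝ≥0∞} (hu : AEMeasurable u μ) (hv : AEMeasurable v μ) :
    (∫⁻ x, u x * v x ∂μ) ^ 2 ≤ (∫⁻ x, u x ^ 2 ∂μ) * ∫⁻ x, v x ^ 2 ∂μ := by
  have h := ENNReal.lintegral_mul_le_Lp_mul_Lq μ Real.HolderConjugate.two_two hu hv
  simp only [Pi.mul_apply] at h
  calc (∫⁻ x, u x * v x ∂μ) ^ 2 ≤ ((∫⁻ x, u x ^ (2 : ℝ) ∂μ) ^ (1 / 2 : ℝ) *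
        (∫⁻ x, v x ^ (2 : ℝ) ∂μ) ^ (1 / 2 : ℝ)) ^ 2 := by gcongr
    _ = _ := by
      rw [mul_pow, ← ENNReal.rpow_natCast, ← ENNReal.rpow_natCast, ← ENNReal.rpow_mul,
        ← ENNReal.rpow_mul]
      norm_num

theorem eLpNorm_two_sq {E : Type*} [NormedAddCommGroup E] (f : X → E) :
    eLpNorm f 2 μ ^ 2 = ∫⁻ x, ‖f x‖ₑ ^ 2 ∂μ := by
  rw [eLpNorm_eq_lintegral_rpow_enorm_toReal (by norm_num) (by norm_num), ← ENNReal.rpow_natCast,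
    ← ENNReal.rpow_mul]
  norm_num

/-- `T` is the integral operator with kernel `k` on `L²`, the integrals being absolutely
convergent at almost every point. -/
def IsKernelOp (k : X → X → ℂ) (T : Lp ℂ 2 μ →L[ℂ] Lp ℂ 2 μ) : Prop :=
  ∀ f : Lp ℂ 2 μ, (∀ᵐ x ∂μ, Integrable (fun y => k x y * f y) μ) ∧
    T f =ᵐ[μ] fun x => ∫ y, k x y * f y ∂μ

theorem IsKernelOp.add {k k' : X → X → ℂ} {T T' : Lp ℂ 2 μ →L[ℂ] Lp ℂ 2 μ} (h : IsKernelOp k T)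
    (h' : IsKernelOp k' T') : IsKernelOp (fun x y => k x y + k' x y) (T + T') := by
  intro f
  constructor
  · filter_upwards [(h f).1, (h' f).1] with x hx hx'
    simp only [add_mul]
    exact hx.add hx'
  · filter_upwards [(h f).1, (h' f).1, (h f).2, (h' f).2, Lp.coeFn_add (T f) (T' f)]
      with x hx hx' e e' e2
    rw [add_apply, e2, Pi.add_apply, e, e', ← integral_add hx hx']
    simp only [add_mul]

theorem IsKernelOp.congr {k k' : X → X → ℂ} {T : Lp ℂ 2 μ →L[ℂ] Lp ℂ 2 μ} (h : IsKernelOp k T)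
    (hk : ∀ x y, k x y = k' x y) : IsKernelOp k' T := by
  have : k = k' := by ext x y; exact hk x y
  exact this ▸ h

variable [SFinite μ]

/-- A kernel whose absolute value defines a bounded operator on `L²` defines a bounded operator. -/
theorem exists_isKernelOp {k : X → X → ℂ} (hk : Measurable (Function.uncurry k)) {C : ℝ}
    (hC : 0 ≤ C) (hb : ∀ f : X → ℝ≥0∞, AEMeasurable f μ →
      ∫⁻ x, (∫⁻ y, ‖k x y‖ₑ * f y ∂μ) ^ 2 ∂μ ≤ ENNReal.ofReal C ^ 2 * ∫⁻ x, f x ^ 2 ∂μ) :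
    ∃ T : Lp ℂ 2 μ →L[ℂ] Lp ℂ 2 μ, IsKernelOp k T ∧ ‖T‖ ≤ C := by
  have hsq : ∀ f : Lp ℂ 2 μ, ∫⁻ x, ‖f x‖ₑ ^ 2 ∂μ ≠ ⊤ := fun f => by
    rw [← eLpNorm_two_sq]
    exact ENNReal.pow_ne_top (Lp.eLpNorm_ne_top f)
  have hbf : ∀ f : Lp ℂ 2 μ, ∫⁻ x, (∫⁻ y, ‖k x y‖ₑ * ‖f y‖ₑ ∂μ) ^ 2 ∂μ ≤
      ENNReal.ofReal C ^ 2 * ∫⁻ x, ‖f x‖ₑ ^ 2 ∂μ := fun f =>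
    hb _ (Lp.aestronglyMeasurable f).enorm
  have hjm : ∀ f : Lp ℂ 2 μ, AEStronglyMeasurable (fun p : X × X => k p.1 p.2 * f p.2) (μ.prod μ) :=
    fun f => hk.aestronglyMeasurable.mul (Lp.aestronglyMeasurable f).comp_snd
  have hkx : ∀ x, Measurable (k x) := fun x => hk.comp measurable_prodMk_left
  have hint : ∀ f : Lp ℂ 2 μ, ∀ᵐ x ∂μ, Integrable (fun y => k x y * f y) μ := by
    intro f
    have hm : AEMeasurable (fun x => (∫⁻ y, ‖k x y‖ₑ * ‖f y‖ₑ ∂μ) ^ 2) μ := by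
      have := (hjm f).enorm.lintegral_prod_right'
      simp only [enorm_mul] at this
      exact this.pow_const 2
    have hfin := ae_lt_top' hm (ne_top_of_le_ne_top (ENNReal.mul_ne_top
      (ENNReal.pow_ne_top ENNReal.ofReal_ne_top) (hsq f)) (hbf f))
    filter_upwards [hfin] with x hx
    refine ⟨(hkx x).aestronglyMeasurable.mul (Lp.aestronglyMeasurable f), ?_⟩
    rw [hasFiniteIntegral_iff_enorm]
    simp only [enorm_mul]
    by_contra hne
    rw [not_lt, top_le_iff] at hne
    rw [hne] at hx
    simp at hx
  have hnorm : ∀ f : Lp ℂ 2 μ, eLpNorm (fun x => ∫ y, k x y * f y ∂μ) 2 μ ≤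
      ENNReal.ofReal C * eLpNorm f 2 μ := by
    intro f
    rw [← ENNReal.pow_le_pow_left_iff (n := 2) (by norm_num), mul_pow, eLpNorm_two_sq,
      eLpNorm_two_sq]
    refine (lintegral_mono fun x => ?_).trans (hbf f)
    gcongr
    simpa only [enorm_mul] using enorm_integral_le_lintegral_enorm (fun y => k x y * f y)
  have hmem : ∀ f : Lp ℂ 2 μ, MemLp (fun x => ∫ y, k x y * f y ∂μ) 2 μ := fun f =>
    ⟨(hjm f).integral_prod_right', (hnorm f).trans_lt
      (ENNReal.mul_lt_top ENNReal.ofReal_lt_top (Lp.eLpNorm_lt_top f))⟩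
  let T : Lp ℂ 2 μ →ₗ[ℂ] Lp ℂ 2 μ :=
    { toFun := fun f => (hmem f).toLp _
      map_add' := fun f h => by
        refine Lp.ext ?_
        filter_upwards [(hmem (f + h)).coeFn_toLp, (hmem f).coeFn_toLp, (hmem h).coeFn_toLp,
          Lp.coeFn_add ((hmem f).toLp _) ((hmem h).toLp _), hint f, hint h] with x e1 e2 e3 e4 i1 i2
        rw [e1, e4, Pi.add_apply, e2, e3, ← integral_add i1 i2]
        refine integral_congr_ae ?_
        filter_upwards [Lp.coeFn_add f h] with y hy
        rw [hy, Pi.add_apply, mul_add]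
      map_smul' := fun c f => by
        refine Lp.ext ?_
        filter_upwards [(hmem (c • f)).coeFn_toLp, (hmem f).coeFn_toLp,
          Lp.coeFn_smul c ((hmem f).toLp _)] with x e1 e2 e4
        rw [e1, RingHom.id_apply, e4, Pi.smul_apply, e2, ← integral_smul]
        refine integral_congr_ae ?_
        filter_upwards [Lp.coeFn_smul c f] with y hy
        rw [hy, Pi.smul_apply, smul_eq_mul, smul_eq_mul]
        ring }
  have hTb : ∀ f, ‖T f‖ ≤ C * ‖f‖ := by
    intro f
    change ‖(hmem f).toLp _‖ ≤ _
    have h1 : C * ‖f‖ = (ENNReal.ofReal C * eLpNorm f 2 μ).toReal := by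
      rw [ENNReal.toReal_mul, ENNReal.toReal_ofReal hC, Lp.norm_def]
    rw [Lp.norm_toLp, h1]
    exact ENNReal.toReal_mono (ENNReal.mul_ne_top ENNReal.ofReal_ne_top (Lp.eLpNorm_ne_top f))
      (hnorm f)
  exact ⟨T.mkContinuous C hTb, fun f => ⟨hint f, (hmem f).coeFn_toLp⟩,
    LinearMap.mkContinuous_norm_le _ hC _⟩

/-- Schur's test. -/
theorem exists_isKernelOp_of_schur {k : X → X → ℂ} (hk : Measurable (Function.uncurry k)) {C : ℝ}
    (hC : 0 ≤ C) (h1 : ∀ x, ∫⁻ y, ‖k x y‖ₑ ∂μ ≤ ENNReal.ofReal C)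
    (h2 : ∀ y, ∫⁻ x, ‖k x y‖ₑ ∂μ ≤ ENNReal.ofReal C) :
    ∃ T : Lp ℂ 2 μ →L[ℂ] Lp ℂ 2 μ, IsKernelOp k T ∧ ‖T‖ ≤ C := by
  refine exists_isKernelOp hk hC fun f hf => ?_
  have hkx : ∀ x, Measurable fun y => ‖k x y‖ₑ := fun x =>
    (hk.comp measurable_prodMk_left).enorm
  have hroot : ∀ t : ℝ≥0∞, t ^ (1 / 2 : ℝ) * t ^ (1 / 2 : ℝ) = t := fun t => by
    rw [← ENNReal.rpow_add_of_nonneg _ _ (by norm_num) (by norm_num)]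
    norm_num
  calc ∫⁻ x, (∫⁻ y, ‖k x y‖ₑ * f y ∂μ) ^ 2 ∂μ
      ≤ ∫⁻ x, ENNReal.ofReal C * ∫⁻ y, ‖k x y‖ₑ * f y ^ 2 ∂μ ∂μ := by
        refine lintegral_mono fun x => ?_
        have h3 := sq_lintegral_mul_le (μ := μ) (u := fun y => ‖k x y‖ₑ ^ (1 / 2 : ℝ))
          (v := fun y => ‖k x y‖ₑ ^ (1 / 2 : ℝ) * f y) ((hkx x).pow_const _).aemeasurable
          (((hkx x).pow_const _).aemeasurable.mul hf)
        have h4 : ∀ t : ℝ≥0∞, (t ^ (1 / 2 : ℝ)) ^ 2 = t := fun t => by rw [sq, hroot]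
        simp only [mul_pow, ← mul_assoc, hroot, h4] at h3
        exact h3.trans (mul_le_mul_left (h1 x) _)
    _ = ENNReal.ofReal C * ∫⁻ y, ∫⁻ x, ‖k x y‖ₑ * f y ^ 2 ∂μ ∂μ := by
        rw [lintegral_const_mul', lintegral_lintegral_swap]
        · exact hk.enorm.aemeasurable.mul (hf.pow_const 2).comp_snd
        · exact ENNReal.ofReal_ne_top
    _ ≤ ENNReal.ofReal C * ∫⁻ y, ENNReal.ofReal C * f y ^ 2 ∂μ := by
        gcongr with y
        rw [lintegral_mul_const]
        · gcongr
          exact h2 y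
        · exact (hk.comp measurable_prodMk_right).enorm
    _ = ENNReal.ofReal C ^ 2 * ∫⁻ y, f y ^ 2 ∂μ := by
        rw [lintegral_const_mul' _ _ ENNReal.ofReal_ne_top, sq, mul_assoc]

/-- Hilbert-Schmidt operators are limits of operators of finite rank: by Bessel's inequality,
`∑ ‖T bᵢ‖²` converges for every Hilbert basis `b`. -/
theorem exists_isKernelOp_of_hilbertSchmidt {k : X → X → ℂ} (hk : Measurable (Function.uncurry k))
    (hHS : ∫⁻ x, ∫⁻ y, ‖k x y‖ₑ ^ 2 ∂μ ∂μ ≠ ⊤) :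
    ∃ T ∈ approxFiniteRank (Lp ℂ 2 μ) (Lp ℂ 2 μ), IsKernelOp k T := by
  have hkx : ∀ x, Measurable (k x) := fun x => hk.comp measurable_prodMk_left
  have hHSm : Measurable fun x => ∫⁻ y, ‖k x y‖ₑ ^ 2 ∂μ :=
    (hk.enorm.pow_const 2).lintegral_prod_right'
  set H := ∫⁻ x, ∫⁻ y, ‖k x y‖ₑ ^ 2 ∂μ ∂μ with hH
  have hCH : ENNReal.ofReal (Real.sqrt H.toReal) ^ 2 = H := by
    rw [← ENNReal.ofReal_pow (Real.sqrt_nonneg _), Real.sq_sqrt ENNReal.toReal_nonneg,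
      ENNReal.ofReal_toReal hHS]
  obtain ⟨T, hT, -⟩ := exists_isKernelOp (μ := μ) hk (Real.sqrt_nonneg H.toReal) fun f hf => by
    rw [hCH, hH, ← lintegral_mul_const _ hHSm]
    exact lintegral_mono fun x => sq_lintegral_mul_le (hkx x).enorm.aemeasurable hf
  refine ⟨T, ?_, hT⟩
  classical
  obtain ⟨w, b, -⟩ := exists_hilbertBasis ℂ (Lp ℂ 2 μ)
  -- Bessel's inequality
  have hsum : ∀ F : Finset w, ∑ i ∈ F, ‖T (b i)‖ ^ 2 ≤ H.toReal := by
    intro F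
    have h1 : ∑ i ∈ F, ‖T (b i)‖ₑ ^ 2 ≤ H := by
      have h2 : ∀ i, ‖T (b i)‖ₑ ^ 2 = ∫⁻ x, ‖T (b i) x‖ₑ ^ 2 ∂μ := fun i => by
        rw [Lp.enorm_def, eLpNorm_two_sq]
      simp only [h2]
      rw [← lintegral_finsetSum' _ fun i _ => (Lp.aestronglyMeasurable _).enorm.pow_const 2]
      have hae : ∀ᵐ x ∂μ, ∀ i ∈ F, T (b i) x = ∫ y, k x y * b i y ∂μ :=
        (Finset.eventually_all F).2 fun i _ => (hT (b i)).2
      have hfin : ∀ᵐ x ∂μ, ∫⁻ y, ‖k x y‖ₑ ^ 2 ∂μ < ⊤ := ae_lt_top hHSm hHS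
      refine lintegral_mono_ae ?_
      filter_upwards [hae, hfin] with x hx hxfin
      have hmem : MemLp (fun y => (starRingEnd ℂ) (k x y)) 2 μ := by
        refine ⟨(Complex.continuous_conj.measurable.comp (hkx x)).aestronglyMeasurable, ?_⟩
        by_contra hne
        rw [not_lt, top_le_iff] at hne
        have := eLpNorm_two_sq (μ := μ) (fun y => (starRingEnd ℂ) (k x y))
        rw [hne] at this
        simp only [RCLike.enorm_conj] at this
        rw [← this] at hxfin
        simp at hxfin
      have hb := b.orthonormal.sum_inner_products_le (x := hmem.toLp _) (s := F)
      have hin : ∀ i ∈ F, ‖inner ℂ (b i) (hmem.toLp _)‖ = ‖T (b i) x‖ := by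
        intro i hi
        rw [norm_inner_symm, hx i hi, L2.inner_def]
        congr 1
        refine integral_congr_ae ?_
        filter_upwards [hmem.coeFn_toLp] with y hy
        rw [hy]
        simp [mul_comm]
      rw [Finset.sum_congr rfl fun i hi => by rw [hin i hi]] at hb
      have hnx : ‖hmem.toLp _‖ₑ ^ 2 = ∫⁻ y, ‖k x y‖ₑ ^ 2 ∂μ := by
        rw [Lp.enorm_def, eLpNorm_congr_ae hmem.coeFn_toLp, eLpNorm_two_sq]
        simp
      rw [← hnx]
      have h5 := ENNReal.ofReal_le_ofReal hb
      rw [ENNReal.ofReal_sum_of_nonneg fun i _ => sq_nonneg _] at h5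
      simpa only [ENNReal.ofReal_pow (norm_nonneg _), ofReal_norm] using h5
    have h3 := ENNReal.toReal_mono hHS h1
    rw [ENNReal.toReal_sum fun i _ => ENNReal.pow_ne_top enorm_ne_top] at h3
    simpa [ENNReal.toReal_pow] using h3
  have hsummable : Summable fun i => ‖T (b i)‖ ^ 2 :=
    summable_of_sum_le (fun i => sq_nonneg _) hsum
  refine mem_approxFiniteRank_iff.2 fun ε hε => ?_
  obtain ⟨F, hF⟩ := summable_iff_vanishing_norm.1 hsummable ((ε / 2) ^ 2) (by positivity)
  let S : Lp ℂ 2 μ →L[ℂ] Lp ℂ 2 μ := ∑ i ∈ F, (innerSL ℂ (b i)).smulRight (T (b i))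
  have hS : S ∈ finiteRank (Lp ℂ 2 μ) (Lp ℂ 2 μ) := by
    refine Submodule.sum_mem _ fun i _ => ?_
    change FiniteDimensional ℂ _
    refine Submodule.finiteDimensional_of_le (S₂ := Submodule.span ℂ {T (b i)}) ?_
    rintro _ ⟨f, rfl⟩
    exact Submodule.smul_mem _ _ (Submodule.mem_span_singleton_self _)
  refine ⟨S, hS, lt_of_le_of_lt (ContinuousLinearMap.opNorm_le_bound _ (by positivity : 0 ≤ ε / 2)
    fun f => ?_) (by linarith)⟩
  have hrep : HasSum (fun i => b.repr f i • T (b i)) (T f) := by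
    simpa using (b.hasSum_repr f).mapL T
  have hlim : Tendsto (fun G : Finset w => ‖(∑ i ∈ G, b.repr f i • T (b i)) - S f‖) atTop
      (𝓝 ‖T f - S f‖) := (hrep.sub_const (S f)).norm
  refine le_of_tendsto hlim ?_
  filter_upwards [eventually_ge_atTop F] with G hG
  have h1 : (∑ i ∈ G, b.repr f i • T (b i)) - S f = ∑ i ∈ G \ F, b.repr f i • T (b i) := by
    rw [← Finset.sum_sdiff hG]
    have : S f = ∑ i ∈ F, b.repr f i • T (b i) := by
      simp [S, HilbertBasis.repr_apply_apply]
    rw [this, add_sub_cancel_right]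
  rw [h1]
  have h2 := hF (G \ F) Finset.sdiff_disjoint
  rw [Real.norm_of_nonneg (Finset.sum_nonneg fun i _ => sq_nonneg _)] at h2
  have h3 : ∑ i ∈ G \ F, ‖b.repr f i‖ ^ 2 ≤ ‖f‖ ^ 2 := by
    simpa [HilbertBasis.repr_apply_apply] using
      b.orthonormal.sum_inner_products_le (x := f) (s := G \ F)
  calc ‖∑ i ∈ G \ F, b.repr f i • T (b i)‖ ≤ ∑ i ∈ G \ F, ‖b.repr f i‖ * ‖T (b i)‖ := by
        refine (norm_sum_le _ _).trans (Finset.sum_le_sum fun i _ => ?_)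
        rw [norm_smul]
    _ ≤ Real.sqrt (∑ i ∈ G \ F, ‖b.repr f i‖ ^ 2) * Real.sqrt (∑ i ∈ G \ F, ‖T (b i)‖ ^ 2) :=
        Real.sum_mul_le_sqrt_mul_sqrt (G \ F) (fun i => ‖b.repr f i‖) fun i => ‖T (b i)‖
    _ ≤ ‖f‖ * (ε / 2) :=
        mul_le_mul (Real.sqrt_le_iff.2 ⟨norm_nonneg _, h3⟩)
          (Real.sqrt_le_iff.2 ⟨by positivity, h2.le⟩) (Real.sqrt_nonneg _) (norm_nonneg _)
    _ = ε / 2 * ‖f‖ := mul_comm _ _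

end KernelOperators

/-! ### The Biot–Savart kernel -/

section BiotSavartKernel

open scoped ENNReal

theorem biotSavartKernel_neg (x : Plane) : biotSavartKernel (-x) = -biotSavartKernel x := by
  have : perp (-x) = -perp x := perpL.map_neg x
  simp [biotSavartKernel, this]

theorem biotSavartKernel_rot (θ : ℝ) (x : Plane) :
    biotSavartKernel (rot θ x) = rot θ (biotSavartKernel x) := by
  rw [biotSavartKernel, biotSavartKernel, norm_rot, ← rot_perp, rot_smul]

theorem norm_biotSavartKernel (x : Plane) : ‖biotSavartKernel x‖ = (2 * Real.pi)⁻¹ * ‖x‖⁻¹ := by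
  rw [biotSavartKernel, norm_smul, norm_perp, norm_inv, Real.norm_of_nonneg (by positivity)]
  by_cases hx : ‖x‖ = 0
  · simp [hx]
  · field_simp

theorem norm_biotSavartKernel_le (x : Plane) : ‖biotSavartKernel x‖ ≤ (1 / 6) * ‖x‖⁻¹ := by
  rw [norm_biotSavartKernel]
  have h : (2 * Real.pi)⁻¹ ≤ 1 / 6 := by
    rw [inv_le_comm₀ (by positivity) (by norm_num)]
    linarith [Real.pi_gt_three]
  gcongr

theorem norm_biotSavartKernel_sub_le {x y : Plane} (hx : x ≠ 0) (hy : y ≠ 0) :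
    ‖biotSavartKernel x - biotSavartKernel y‖ ≤ (1 / 6) * (‖x - y‖ / (‖x‖ * ‖y‖)) := by
  have h1 : biotSavartKernel x - biotSavartKernel y =
      (2 * Real.pi)⁻¹ • perp ((1 / ‖x‖) ^ 2 • x - (1 / ‖y‖) ^ 2 • y) := by
    have : ∀ v : Plane, biotSavartKernel v = (2 * Real.pi)⁻¹ • perpL ((1 / ‖v‖) ^ 2 • v) := by
      intro v
      rw [map_smul, smul_smul, biotSavartKernel, perpL_apply]
      congr 1
      simp only [mul_inv, one_div]
      ring
    rw [this, this, ← smul_sub, ← map_sub, perpL_apply]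
  rw [h1, norm_smul, norm_perp, ← dist_eq_norm, dist_div_norm_sq_smul hx hy, dist_eq_norm,
    Real.norm_of_nonneg (by positivity)]
  have h : (2 * Real.pi)⁻¹ ≤ 1 / 6 := by
    rw [inv_le_comm₀ (by positivity) (by norm_num)]
    linarith [Real.pi_gt_three]
  have h2 : (1 : ℝ) ^ 2 / (‖x‖ * ‖y‖) * ‖x - y‖ = ‖x - y‖ / (‖x‖ * ‖y‖) := by ring
  rw [h2]
  gcongr

theorem measurable_biotSavartKernel : Measurable biotSavartKernel := by
  unfold biotSavartKernel
  have := continuous_perp.measurable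
  exact ((measurable_norm.pow_const 2).const_mul _).inv.smul this

open Classical in
/-- The Biot–Savart kernel `K₂(x - y)`, corrected by `K₂(y)` for `|y| ≥ 2|x|`.  The correction does
not change the convolution with a symmetric function, and makes the kernel decay like `|x||y|⁻²`. -/
noncomputable def symKernel (x y : Plane) : Plane :=
  biotSavartKernel (x - y) + if 2 * ‖x‖ ≤ ‖y‖ then biotSavartKernel y else 0

theorem symKernel_rot (θ : ℝ) (x y : Plane) :
    symKernel (rot θ x) (rot θ y) = rot θ (symKernel x y) := by
  have h1 : rot θ (0 : Plane) = 0 := (rotL θ).map_zero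
  have h2 : ∀ u v : Plane, rot θ (u + v) = rot θ u + rot θ v := (rotL θ).map_add
  unfold symKernel
  rw [norm_rot, norm_rot, ← rot_sub, biotSavartKernel_rot, biotSavartKernel_rot, h2]
  split_ifs <;> simp [h1]

theorem measurable_symKernel : Measurable (Function.uncurry symKernel) := by
  unfold symKernel Function.uncurry
  refine (measurable_biotSavartKernel.comp (measurable_fst.sub measurable_snd)).add
    (Measurable.ite ?_ (measurable_biotSavartKernel.comp measurable_snd) measurable_const)
  exact measurableSet_le (by fun_prop) (by fun_prop)

theorem norm_symKernel_le_inv (x y : Plane) : ‖symKernel x y‖ ≤ ‖x - y‖⁻¹ := by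
  have h0 := norm_biotSavartKernel_le (x - y)
  have hn : 0 ≤ ‖x - y‖⁻¹ := by positivity
  unfold symKernel
  split_ifs with h
  · by_cases hy : y = 0
    · subst hy
      have hx : x = 0 := by
        rw [norm_zero] at h
        exact norm_le_zero_iff.1 (by linarith)
      subst hx
      simp [biotSavartKernel]
    have hy' : 0 < ‖y‖ := norm_pos_iff.2 hy
    have h1 : ‖x - y‖ ≤ 2 * ‖y‖ := (norm_sub_le _ _).trans (by linarith [norm_nonneg x])
    have h2 : 0 < ‖x - y‖ := by
      have := norm_sub_norm_le y x
      rw [norm_sub_rev] at this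
      linarith
    have h3 : ‖y‖⁻¹ ≤ 2 * ‖x - y‖⁻¹ := by
      rw [inv_eq_one_div, inv_eq_one_div, mul_one_div, div_le_div_iff₀ hy' h2]
      linarith
    refine (norm_add_le _ _).trans ?_
    linarith [norm_biotSavartKernel_le y]
  · simp only [add_zero]
    linarith

/-- The correction of the kernel by `K₂(y)` gains one power of decay far from the origin. -/
theorem norm_symKernel_le_of_le {x y : Plane} (h : 2 * ‖x‖ ≤ ‖y‖) :
    ‖symKernel x y‖ ≤ ‖x‖ * (‖x - y‖⁻¹) ^ 2 := by
  by_cases hy : y = 0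
  · subst hy
    have hx : x = 0 := by
      rw [norm_zero] at h
      exact norm_le_zero_iff.1 (by linarith)
    subst hx
    simp [symKernel, biotSavartKernel]
  have hy' : 0 < ‖y‖ := norm_pos_iff.2 hy
  have h1 : ‖x - y‖ ≤ 2 * ‖y‖ := (norm_sub_le _ _).trans (by linarith [norm_nonneg x])
  have h2 : 0 < ‖x - y‖ := by
    have := norm_sub_norm_le y x
    rw [norm_sub_rev] at this
    linarith
  have h3 : symKernel x y = biotSavartKernel y - biotSavartKernel (y - x) := by
    rw [symKernel, if_pos h, ← neg_sub y x, biotSavartKernel_neg]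
    abel
  have h4 : y - x ≠ 0 := by
    rw [← norm_pos_iff, norm_sub_rev]; exact h2
  rw [h3]
  refine (norm_biotSavartKernel_sub_le hy h4).trans ?_
  rw [sub_sub_cancel, norm_sub_rev y x]
  have h5 : ‖x‖ / (‖y‖ * ‖x - y‖) ≤ 2 * (‖x‖ * (‖x - y‖⁻¹) ^ 2) := by
    rw [div_le_iff₀ (by positivity)]
    have h6 : 2 * (‖x‖ * (‖x - y‖⁻¹) ^ 2) * (‖y‖ * ‖x - y‖) = ‖x‖ * (2 * ‖y‖ * ‖x - y‖⁻¹) := by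
      field_simp
    rw [h6]
    refine le_mul_of_one_le_right (norm_nonneg _) ?_
    rw [← div_eq_mul_inv, one_le_div h2]
    exact h1
  have h7 : 0 ≤ ‖x‖ * (‖x - y‖⁻¹) ^ 2 := by positivity
  linarith

/-- Far from the diagonal the square of the kernel is bounded by an integrable function of `x - y`,
at the price of a small power of `|x|`. -/
theorem sq_norm_symKernel_le {ε β : ℝ} (hε : 0 < ε) (hε1 : ε ≤ 1) (hβ : 0 < β) (hβ1 : β ≤ 1)
    {x y : Plane} (hxy : ε ≤ ‖x - y‖) :
    ‖symKernel x y‖ ^ 2 ≤ 16 / ε ^ 4 * ((1 + ‖x‖) ^ β * (1 + ‖x - y‖) ^ (-(2 + β))) := by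
  set u := ‖x - y‖ with hu
  have hu0 : 0 < u := hε.trans_le hxy
  set P := 1 + ‖x‖ with hP
  set Q := 1 + u with hQ
  have hP1 : 1 ≤ P := by linarith [norm_nonneg x]
  have hQ1 : 0 < Q := by linarith
  have hQu : u⁻¹ ≤ 2 / ε * Q⁻¹ := by
    rw [inv_eq_one_div, div_mul_eq_mul_div, ← div_eq_mul_inv, div_div, div_le_div_iff₀ hu0 (by positivity)]
    nlinarith
  have hε4 : ε ^ 4 ≤ ε ^ 2 := pow_le_pow_of_le_one hε.le hε1 (by norm_num)
  have hrpow : Q ^ (-(2 + β)) = (Q⁻¹) ^ 2 * Q ^ (-β) := by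
    rw [neg_add, Real.rpow_add hQ1, Real.rpow_neg hQ1.le, inv_pow]
    norm_num
  have hQβ : 0 < Q ^ (-β) := Real.rpow_pos_of_pos hQ1 _
  have hPβ : 0 < P ^ β := Real.rpow_pos_of_pos (by linarith) _
  rw [hrpow]
  rcases le_or_gt Q (3 * P) with hc | hc
  · have h1 : ‖symKernel x y‖ ^ 2 ≤ (2 / ε * Q⁻¹) ^ 2 := by
      gcongr
      exact (norm_symKernel_le_inv x y).trans hQu
    have h2 : (1 : ℝ) ≤ 3 * (P ^ β * Q ^ (-β)) := by
      have h3 : Q ^ β ≤ 3 * P ^ β := by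
        calc Q ^ β ≤ (3 * P) ^ β := Real.rpow_le_rpow hQ1.le hc hβ.le
          _ = 3 ^ β * P ^ β := Real.mul_rpow (by norm_num) (by linarith)
          _ ≤ 3 * P ^ β := by
            gcongr
            calc (3 : ℝ) ^ β ≤ 3 ^ (1 : ℝ) := Real.rpow_le_rpow_of_exponent_le (by norm_num) hβ1
              _ = 3 := Real.rpow_one 3
      rw [Real.rpow_neg hQ1.le, ← mul_assoc, ← div_eq_mul_inv, one_le_div (Real.rpow_pos_of_pos hQ1 _)]
      exact h3
    calc ‖symKernel x y‖ ^ 2 ≤ (2 / ε * Q⁻¹) ^ 2 * 1 := by rw [mul_one]; exact h1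
      _ ≤ (2 / ε * Q⁻¹) ^ 2 * (3 * (P ^ β * Q ^ (-β))) := by gcongr
      _ = 12 / ε ^ 2 * (P ^ β * (Q⁻¹ ^ 2 * Q ^ (-β))) := by ring
      _ ≤ 16 / ε ^ 4 * (P ^ β * (Q⁻¹ ^ 2 * Q ^ (-β))) := by
        gcongr
        norm_num
  · have h2x : 2 * ‖x‖ ≤ ‖y‖ := by
      by_contra hlt
      push Not at hlt
      have : u ≤ ‖x‖ + ‖y‖ := norm_sub_le _ _
      linarith
    have h1 : ‖symKernel x y‖ ^ 2 ≤ (P * (2 / ε * Q⁻¹) ^ 2) ^ 2 := by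
      gcongr
      refine (norm_symKernel_le_of_le h2x).trans ?_
      gcongr
      linarith
    have h3 : P ^ 2 * Q⁻¹ ^ 2 ≤ P ^ β * Q ^ (-β) := by
      have h4 : P * Q⁻¹ ≤ 1 := by
        rw [← div_eq_mul_inv, div_le_one hQ1]; linarith
      have h5 : (P * Q⁻¹) ^ (2 : ℝ) ≤ (P * Q⁻¹) ^ β :=
        Real.rpow_le_rpow_of_exponent_ge (by positivity) h4 (by linarith)
      rw [Real.rpow_two, Real.mul_rpow (by linarith) (by positivity), Real.inv_rpow hQ1.le,
        ← Real.rpow_neg hQ1.le, mul_pow] at h5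
      exact h5
    calc ‖symKernel x y‖ ^ 2 ≤ (P * (2 / ε * Q⁻¹) ^ 2) ^ 2 := h1
      _ = 16 / ε ^ 4 * (Q⁻¹ ^ 2 * (P ^ 2 * Q⁻¹ ^ 2)) := by ring
      _ ≤ 16 / ε ^ 4 * (Q⁻¹ ^ 2 * (P ^ β * Q ^ (-β))) := by gcongr
      _ = _ := by ring

theorem lintegral_one_add_norm_lt_top {β : ℝ} (hβ : 0 < β) :
    ∫⁻ x : Plane, ENNReal.ofReal ((1 + ‖x‖) ^ (-(2 + β))) < ⊤ := by
  have h := integrable_one_add_norm (E := Plane) (μ := volume) (r := 2 + β) (by simp [hβ])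
  have h1 := h.2
  rw [hasFiniteIntegral_iff_ofReal] at h1
  · exact h1
  · exact Eventually.of_forall fun x => Real.rpow_nonneg (by positivity) _

/-- The singularity `|u|⁻¹` is integrable over discs. -/
theorem lintegral_inv_norm_ball : ∫⁻ u in Metric.ball (0 : Plane) 1, ENNReal.ofReal ‖u‖⁻¹ ≠ ⊤ := by
  have h : IntegrableOn (fun u : Plane => ‖u‖⁻¹) (Metric.ball 0 1) volume := by
    refine (integrableOn_fun_norm_addHaar volume (f := fun r : ℝ => r⁻¹)).2 ?_
    refine (integrableOn_const (C := (1 : ℝ)) (by simp)).congr_fun (fun y hy => ?_) measurableSet_Ioo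
    simp [hy.1.ne']
  have h1 := h.2
  rw [hasFiniteIntegral_iff_ofReal] at h1
  · exact h1.ne
  · exact Eventually.of_forall fun x => by positivity

/-- The integral of the singularity `|u|⁻¹` over small discs is small. -/
theorem exists_lintegral_inv_norm_le {δ : ℝ} (hδ : 0 < δ) :
    ∃ ε, 0 < ε ∧ ε ≤ 1 ∧
      ∫⁻ u in Metric.ball (0 : Plane) ε, ENNReal.ofReal ‖u‖⁻¹ ≤ ENNReal.ofReal δ := by
  have h1 : Tendsto (volume ∘ fun ε : ℝ => Metric.ball (0 : Plane) ε) (𝓝[>] 0) (𝓝 0) := by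
    have h2 : (volume ∘ fun ε : ℝ => Metric.ball (0 : Plane) ε) =
        fun ε => ENNReal.ofReal ε ^ 2 * ENNReal.ofReal Real.pi := by
      ext ε
      simp only [Function.comp_apply, EuclideanSpace.volume_ball_fin_two]
    rw [h2]
    have h3 : Tendsto (fun ε : ℝ => ENNReal.ofReal ε ^ 2 * ENNReal.ofReal Real.pi) (𝓝 0)
        (𝓝 (ENNReal.ofReal 0 ^ 2 * ENNReal.ofReal Real.pi)) := by
      refine ENNReal.Tendsto.mul_const ?_ (Or.inr ENNReal.ofReal_ne_top)
      exact (ENNReal.continuous_pow 2).continuousAt.tendsto.comp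
        (ENNReal.continuous_ofReal.tendsto 0)
    simp only [ENNReal.ofReal_zero, ne_eq, OfNat.ofNat_ne_zero, not_false_eq_true, zero_pow,
      zero_mul] at h3
    exact h3.mono_left nhdsWithin_le_nhds
  have h1' : Tendsto ((volume.restrict (Metric.ball (0 : Plane) 1)) ∘
      fun ε : ℝ => Metric.ball (0 : Plane) ε) (𝓝[>] 0) (𝓝 0) :=
    tendsto_of_tendsto_of_tendsto_of_le_of_le tendsto_const_nhds h1 (fun _ => zero_le)
      fun ε => Measure.restrict_apply_le _ _
  have h4 := tendsto_setLIntegral_zero lintegral_inv_norm_ball h1'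
  have h5 : ∀ᶠ ε : ℝ in 𝓝[>] 0, 0 < ε ∧ ε ≤ 1 := by
    filter_upwards [Ioc_mem_nhdsGT (zero_lt_one' ℝ)] with ε hε using hε
  obtain ⟨ε, hε, hε0, hε1⟩ := ((h4.eventually_le_const
    (ENNReal.ofReal_pos.2 hδ)).and h5).exists
  refine ⟨ε, hε0, hε1, ?_⟩
  rwa [Measure.restrict_restrict Metric.isOpen_ball.measurableSet,
    Set.inter_eq_left.2 (Metric.ball_subset_ball hε1)] at hε

end BiotSavartKernel

/-! ### The Biot–Savart law on symmetric functions -/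

section WeightedBiotSavart

open scoped ENNReal

theorem IsKernelOp.unique {X : Type*} [MeasurableSpace X] {μ : Measure X} {k : X → X → ℂ}
    {T T' : Lp ℂ 2 μ →L[ℂ] Lp ℂ 2 μ} (h : IsKernelOp k T) (h' : IsKernelOp k T') : T = T' := by
  ext1 f
  refine Lp.ext ?_
  filter_upwards [(h f).2, (h' f).2] with x e e'
  rw [e, e']

theorem one_add_rpow_le_one {β r : ℝ} (hβ : 0 < β) (hr : 0 ≤ r) : (1 + r) ^ (-(1 + β)) ≤ 1 :=
  Real.rpow_le_one_of_one_le_of_nonpos (by linarith) (by linarith)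

/-- With a decaying weight `w`, the operator `f ↦ w (K₂ * f)` is a limit of operators of finite
rank: the part of the kernel near the diagonal has small norm by Schur's test, the other part is
Hilbert–Schmidt. -/
theorem exists_isKernelOp_symKernel {w : Plane → ℝ} (hw : Measurable w) {C β : ℝ} (hβ : 0 < β)
    (hβ1 : β ≤ 1) (hC : ∀ x, |w x| ≤ C * (1 + ‖x‖) ^ (-(1 + β))) (i : Fin 2) :
    ∃ T ∈ approxFiniteRank L2 L2,
      IsKernelOp (fun x y => (w x : ℂ) * (symKernel x y i : ℂ)) T := by
  have hC0 : 0 ≤ C := by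
    have := (abs_nonneg _).trans (hC 0)
    simpa using this
  have hcomp : ∀ x y, |symKernel x y i| ≤ ‖symKernel x y‖ := fun x y => by
    simpa using PiLp.norm_apply_le (symKernel x y) i
  have hkm : Measurable fun p : Plane × Plane => (w p.1 : ℂ) * (symKernel p.1 p.2 i : ℂ) := by
    have h1 : Measurable fun p : Plane × Plane => symKernel p.1 p.2 i :=
      (measurable_pi_apply i).comp ((WithLp.measurable_ofLp 2 _).comp measurable_symKernel)
    exact (Complex.measurable_ofReal.comp (hw.comp measurable_fst)).mul
      (Complex.measurable_ofReal.comp h1)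
  have hset : ∀ ε : ℝ, MeasurableSet {p : Plane × Plane | ‖p.1 - p.2‖ < ε} := fun ε =>
    measurableSet_lt (by fun_prop) measurable_const
  have key : ∀ δ > 0, ∃ N F : L2 →L[ℂ] L2, ‖N‖ ≤ δ ∧ F ∈ approxFiniteRank L2 L2 ∧
      IsKernelOp (fun x y => (w x : ℂ) * (symKernel x y i : ℂ)) (N + F) := by
    intro δ hδ
    obtain ⟨ε, hε, hε1, hsmall⟩ := exists_lintegral_inv_norm_le
      (show 0 < δ / (C + 1) by positivity)
    classical
    let kN : Plane → Plane → ℂ := fun x y =>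
      if ‖x - y‖ < ε then (w x : ℂ) * (symKernel x y i : ℂ) else 0
    let kF : Plane → Plane → ℂ := fun x y =>
      if ‖x - y‖ < ε then 0 else (w x : ℂ) * (symKernel x y i : ℂ)
    have hkN : Measurable (Function.uncurry kN) := Measurable.ite (hset ε) hkm measurable_const
    have hkF : Measurable (Function.uncurry kF) := Measurable.ite (hset ε) measurable_const hkm
    have hNle : ∀ x y, ‖kN x y‖ₑ ≤ ENNReal.ofReal C *
        (Metric.ball (0 : Plane) ε).indicator (fun u => ENNReal.ofReal ‖u‖⁻¹) (x - y) := by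
      intro x y
      by_cases h : ‖x - y‖ < ε
      · rw [Set.indicator_of_mem (by simpa using h), ← ENNReal.ofReal_mul hC0, ← ofReal_norm]
        refine ENNReal.ofReal_le_ofReal ?_
        simp only [kN, h, if_true, norm_mul, Complex.norm_real, Real.norm_eq_abs]
        gcongr
        · refine (hC x).trans ?_
          exact mul_le_of_le_one_right hC0 (one_add_rpow_le_one hβ (norm_nonneg _))
        · exact (hcomp x y).trans (norm_symKernel_le_inv x y)
      · simp [kN, h]
    have hNint : ENNReal.ofReal C * ∫⁻ u, (Metric.ball (0 : Plane) ε).indicator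
        (fun u => ENNReal.ofReal ‖u‖⁻¹) u ≤ ENNReal.ofReal δ := by
      rw [lintegral_indicator Metric.isOpen_ball.measurableSet]
      calc _ ≤ ENNReal.ofReal C * ENNReal.ofReal (δ / (C + 1)) := by gcongr
        _ = ENNReal.ofReal (C * (δ / (C + 1))) := (ENNReal.ofReal_mul hC0).symm
        _ ≤ ENNReal.ofReal δ := by
          refine ENNReal.ofReal_le_ofReal ?_
          rw [← mul_div_assoc, div_le_iff₀ (by positivity)]
          nlinarith
    have hNx : ∀ x, ∫⁻ y, ‖kN x y‖ₑ ≤ ENNReal.ofReal δ := fun x => by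
      refine (lintegral_mono (hNle x)).trans ?_
      rw [lintegral_const_mul' _ _ ENNReal.ofReal_ne_top, lintegral_sub_left_eq_self
        ((Metric.ball (0 : Plane) ε).indicator fun u => ENNReal.ofReal ‖u‖⁻¹) x]
      exact hNint
    have hNy : ∀ y, ∫⁻ x, ‖kN x y‖ₑ ≤ ENNReal.ofReal δ := fun y => by
      refine (lintegral_mono fun x => hNle x y).trans ?_
      rw [lintegral_const_mul' _ _ ENNReal.ofReal_ne_top, lintegral_sub_right_eq_self
        ((Metric.ball (0 : Plane) ε).indicator fun u => ENNReal.ofReal ‖u‖⁻¹) y]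
      exact hNint
    obtain ⟨N, hN, hNn⟩ := exists_isKernelOp_of_schur hkN hδ.le hNx hNy
    have hFle : ∀ x y, ‖kF x y‖ₑ ^ 2 ≤ ENNReal.ofReal (C ^ 2 * (16 / ε ^ 4) *
        (1 + ‖x‖) ^ (-(2 + β))) * ENNReal.ofReal ((1 + ‖x - y‖) ^ (-(2 + β))) := by
      intro x y
      by_cases h : ‖x - y‖ < ε
      · simp [kF, h]
      · rw [← ENNReal.ofReal_mul (by positivity), ← ofReal_norm,
          ← ENNReal.ofReal_pow (norm_nonneg _)]
        refine ENNReal.ofReal_le_ofReal ?_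
        simp only [kF, h, if_false, norm_mul, Complex.norm_real, Real.norm_eq_abs, mul_pow]
        have hP : 0 < 1 + ‖x‖ := by positivity
        have e1 : (1 + ‖x‖) ^ (-(2 + β)) = ((1 + ‖x‖) ^ (-(1 + β))) ^ 2 * (1 + ‖x‖) ^ β := by
          rw [← Real.rpow_natCast, ← Real.rpow_mul hP.le, ← Real.rpow_add hP]
          congr 1
          push_cast
          ring
        have e2 := sq_norm_symKernel_le hε hε1 hβ hβ1 (not_lt.1 h)
        calc |w x| ^ 2 * |symKernel x y i| ^ 2
            ≤ (C * (1 + ‖x‖) ^ (-(1 + β))) ^ 2 * (16 / ε ^ 4 *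
              ((1 + ‖x‖) ^ β * (1 + ‖x - y‖) ^ (-(2 + β)))) := by
              gcongr
              · exact hC x
              · exact le_trans (by gcongr; exact hcomp x y) e2
          _ = C ^ 2 * (16 / ε ^ 4) * (1 + ‖x‖) ^ (-(2 + β)) * (1 + ‖x - y‖) ^ (-(2 + β)) := by
              rw [e1]; ring
    have hHS : ∫⁻ x, ∫⁻ y, ‖kF x y‖ₑ ^ 2 ≠ ⊤ := by
      have hJ := lintegral_one_add_norm_lt_top hβ
      have h1 : ∀ x, ∫⁻ y, ‖kF x y‖ₑ ^ 2 ≤ ENNReal.ofReal (C ^ 2 * (16 / ε ^ 4) *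
          (1 + ‖x‖) ^ (-(2 + β))) * ∫⁻ u : Plane, ENNReal.ofReal ((1 + ‖u‖) ^ (-(2 + β))) := by
        intro x
        refine (lintegral_mono (hFle x)).trans ?_
        rw [lintegral_const_mul' _ _ ENNReal.ofReal_ne_top, lintegral_sub_left_eq_self
          (fun u : Plane => ENNReal.ofReal ((1 + ‖u‖) ^ (-(2 + β)))) x]
      refine ne_top_of_le_ne_top ?_ (lintegral_mono h1)
      rw [lintegral_mul_const' _ _ hJ.ne]
      refine ENNReal.mul_ne_top ?_ hJ.ne
      have h2 : ∀ x : Plane, ENNReal.ofReal (C ^ 2 * (16 / ε ^ 4) * (1 + ‖x‖) ^ (-(2 + β))) =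
          ENNReal.ofReal (C ^ 2 * (16 / ε ^ 4)) * ENNReal.ofReal ((1 + ‖x‖) ^ (-(2 + β))) :=
        fun x => ENNReal.ofReal_mul (by positivity)
      simp only [h2]
      rw [lintegral_const_mul' _ _ ENNReal.ofReal_ne_top]
      exact ENNReal.mul_ne_top ENNReal.ofReal_ne_top hJ.ne
    obtain ⟨F, hF, hFk⟩ := exists_isKernelOp_of_hilbertSchmidt hkF hHS
    refine ⟨N, F, hNn, hF, (hN.add hFk).congr fun x y => ?_⟩
    by_cases h : ‖x - y‖ < ε <;> simp [kN, kF, h]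
  obtain ⟨N, F, -, -, hT⟩ := key 1 one_pos
  refine ⟨N + F, mem_approxFiniteRank_of_forall fun δ hδ => ?_, hT⟩
  obtain ⟨N', F', hN', hF', hT'⟩ := key (δ / 2) (by positivity)
  refine ⟨F', hF', ?_⟩
  rw [hT.unique hT', add_sub_cancel_right]
  linarith

/-- The velocity field of `f ∈ L²`, computed with the corrected kernel. -/
noncomputable def symVelocity (f : Plane → ℂ) (i : Fin 2) (x : Plane) : ℂ :=
  ∫ y, (symKernel x y i : ℂ) * f y

theorem symVelocity_congr {f h : Plane → ℂ} (e : f =ᵐ[volume] h) : symVelocity f = symVelocity h := by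
  ext i x
  refine integral_congr_ae ?_
  filter_upwards [e] with y hy
  rw [hy]

/-- The restriction of the velocity to a disc depends continuously on the vorticity. -/
theorem exists_localVelocity (R : ℝ) (i : Fin 2) : ∃ T : L2 →L[ℂ] L2, ∀ f : L2,
    (∀ᵐ x, x ∈ Metric.ball (0 : Plane) R →
      Integrable (fun y => (symKernel x y i : ℂ) * f y) volume) ∧
    T f =ᵐ[volume] (Metric.ball (0 : Plane) R).indicator (symVelocity f i) := by
  obtain ⟨T, -, hT⟩ := exists_isKernelOp_symKernel
    (w := (Metric.ball (0 : Plane) R).indicator fun _ => 1) (C := (1 + |R|) ^ 2) (β := 1)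
    (measurable_const.indicator Metric.isOpen_ball.measurableSet) one_pos le_rfl (fun x => by
      by_cases h : x ∈ Metric.ball (0 : Plane) R
      · rw [Set.indicator_of_mem h, abs_one]
        have h1 : ‖x‖ < R := by simpa using h
        have h2 : (1 + ‖x‖) ^ (-(1 + 1) : ℝ) = ((1 + ‖x‖) ^ 2)⁻¹ := by
          rw [Real.rpow_neg (by positivity)]
          norm_num
        rw [h2, ← div_eq_mul_inv, one_le_div (by positivity)]
        gcongr
        exact h1.le.trans (le_abs_self R)
      · rw [Set.indicator_of_notMem h, abs_zero]
        positivity) i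
  refine ⟨T, fun f => ⟨?_, ?_⟩⟩
  · filter_upwards [(hT f).1] with x hx hxR
    simpa [Set.indicator_of_mem hxR] using hx
  · filter_upwards [(hT f).2] with x hx
    rw [hx]
    by_cases h : x ∈ Metric.ball (0 : Plane) R
    · simp [h, symVelocity]
    · simp [h]

theorem integrable_symKernel_mul (f : L2) (i : Fin 2) :
    ∀ᵐ x, Integrable (fun y => (symKernel x y i : ℂ) * f y) volume := by
  have h : ∀ n : ℕ, ∀ᵐ x, x ∈ Metric.ball (0 : Plane) n →
      Integrable (fun y => (symKernel x y i : ℂ) * f y) volume := fun n =>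
    ((exists_localVelocity n i).choose_spec f).1
  filter_upwards [ae_all_iff.2 h] with x hx
  obtain ⟨n, hn⟩ := exists_nat_gt ‖x‖
  exact hx n (by simpa using hn)

theorem memLp_symVelocity (f : L2) (i : Fin 2) (R : ℝ) :
    MemLp (symVelocity f i) 2 (volume.restrict (Metric.ball 0 R)) := by
  obtain ⟨T, hT⟩ := exists_localVelocity R i
  have h := (Lp.memLp (T f)).ae_eq (hT f).2
  rwa [memLp_indicator_iff_restrict Metric.isOpen_ball.measurableSet] at h

/-- The velocity depends continuously on the vorticity, in the sense of distributions. -/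
theorem tendsto_integral_symVelocity {f : L2} {s : ℕ → L2} (hs : Tendsto s atTop (𝓝 f))
    {φ : Plane → ℝ} (hφ : Continuous φ) (hc : HasCompactSupport φ) (i : Fin 2) :
    Tendsto (fun n => ∫ x, (φ x : ℂ) * symVelocity (s n) i x) atTop
      (𝓝 (∫ x, (φ x : ℂ) * symVelocity f i x)) := by
  obtain ⟨R, hR⟩ := hc.isCompact.isBounded.subset_ball 0
  obtain ⟨T, hT⟩ := exists_localVelocity R i
  have h : ∀ h : L2, ∫ x, (φ x : ℂ) * symVelocity h i x =
      testFunctional φ (memLp_ofReal hφ hc) (T h) := by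
    intro h
    rw [testFunctional_apply]
    refine integral_congr_ae ?_
    filter_upwards [(hT h).2] with x hx
    rw [hx]
    by_cases hxR : x ∈ Metric.ball (0 : Plane) R
    · rw [Set.indicator_of_mem hxR]
    · have : φ x = 0 := by
        by_contra hne
        exact hxR (hR (subset_tsupport φ hne))
      simp [this]
  simp only [h]
  exact (((testFunctional φ (memLp_ofReal hφ hc)).continuous.comp T.continuous).tendsto f).comp hs

end WeightedBiotSavart

section SymmetricSchwartz

variable {m : ℕ}

theorem cos_two_pi_div_lt_one (hm : 2 ≤ m) : Real.cos (2 * Real.pi / m) < 1 := by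
  have hm' : (2 : ℝ) ≤ m := by exact_mod_cast hm
  rw [← Real.cos_zero]
  refine Real.cos_lt_cos_of_nonneg_of_le_pi le_rfl ?_ (by positivity)
  rw [div_le_iff₀ (by positivity)]
  nlinarith [Real.pi_pos]

theorem integrable_biotSavartKernel_mul (s : 𝓢(Plane, ℂ)) (x : Plane) (i : Fin 2) :
    Integrable (fun y => (biotSavartKernel (x - y) i : ℂ) * s y) := by
  obtain ⟨M, hM⟩ : ∃ M, ∀ y, ‖s y‖ ≤ M := ⟨_, fun y => s.norm_le_seminorm ℂ y⟩
  have hM0 : 0 ≤ M := (norm_nonneg _).trans (hM 0)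
  have hball : Integrable ((Metric.ball (0 : Plane) 1).indicator fun u : Plane => ‖u‖⁻¹ * M) := by
    rw [integrable_indicator_iff Metric.isOpen_ball.measurableSet]
    refine Integrable.mul_const ⟨by fun_prop, ?_⟩ M
    rw [hasFiniteIntegral_iff_ofReal (Eventually.of_forall fun x => by positivity)]
    exact lintegral_inv_norm_ball.lt_top
  have h1 := (hball.comp_sub_left x).add s.integrable.norm
  refine h1.mono' ?_ (Eventually.of_forall fun y => ?_)
  · have hmk : Measurable fun y => biotSavartKernel (x - y) i :=
      (measurable_pi_apply i).comp ((WithLp.measurable_ofLp 2 _).comp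
        (measurable_biotSavartKernel.comp (measurable_const.sub measurable_id)))
    exact (Complex.measurable_ofReal.comp hmk).aestronglyMeasurable.mul
      s.continuous.aestronglyMeasurable
  · rw [norm_mul, Complex.norm_real]
    have h2 : ‖biotSavartKernel (x - y) i‖ ≤ ‖x - y‖⁻¹ := by
      refine (PiLp.norm_apply_le (biotSavartKernel (x - y)) i).trans ?_
      have h3 : 0 ≤ ‖x - y‖⁻¹ := by positivity
      linarith [norm_biotSavartKernel_le (x - y)]
    simp only [Pi.add_apply]
    by_cases h : x - y ∈ Metric.ball (0 : Plane) 1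
    · rw [Set.indicator_of_mem h]
      have := mul_le_mul h2 (hM y) (norm_nonneg _) (by positivity)
      linarith [norm_nonneg (s y)]
    · rw [Set.indicator_of_notMem h, zero_add]
      rw [mem_ball_zero_iff, not_lt] at h
      have h4 : ‖x - y‖⁻¹ ≤ 1 := inv_le_one_of_one_le₀ h
      exact mul_le_of_le_one_left (norm_nonneg _) (h2.trans h4)

/-- The correction of the kernel integrates to zero against symmetric functions, since its integral
is a vector fixed by a nontrivial rotation. -/
theorem integral_correction_eq_zero (hm : 2 ≤ m) {s : Plane → ℂ}
    (hs : ∀ x, s (rot (2 * Real.pi / m) x) = s x) {ρ : ℝ}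
    (hint : ∀ i, Integrable fun y => (({y : Plane | ρ ≤ ‖y‖}.indicator
      (fun y => biotSavartKernel y i) y : ℝ) : ℂ) * s y) (i : Fin 2) :
    ∫ y, (({y : Plane | ρ ≤ ‖y‖}.indicator (fun y => biotSavartKernel y i) y : ℝ) : ℂ) * s y
      = 0 := by
  set θ := 2 * Real.pi / m with hθ
  let I : Fin 2 → ℂ := fun i =>
    ∫ y, (({y : Plane | ρ ≤ ‖y‖}.indicator (fun y => biotSavartKernel y i) y : ℝ) : ℂ) * s y
  have hmp := measurePreserving_rot θ
  have hemb : MeasurableEmbedding (rot θ) := (rotL θ).toHomeomorph.measurableEmbedding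
  have hI : ∀ i, I i = ∫ y, (({y : Plane | ρ ≤ ‖y‖}.indicator
      (fun y => rot θ (biotSavartKernel y) i) y : ℝ) : ℂ) * s y := by
    intro i
    simp only [I]
    rw [← hmp.integral_comp hemb]
    refine integral_congr_ae (Eventually.of_forall fun y => ?_)
    by_cases hy : ρ ≤ ‖y‖ <;> simp only [Set.indicator, Set.mem_ofPred_eq, norm_rot, hy, hs,
      biotSavartKernel_rot, if_true, if_false]
  have h0 : I 0 = Real.cos θ * I 0 - Real.sin θ * I 1 := by
    conv_lhs => rw [hI]
    simp only [I]
    rw [← integral_const_mul, ← integral_const_mul, ← integral_sub ((hint 0).const_mul _)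
      ((hint 1).const_mul _)]
    refine integral_congr_ae (Eventually.of_forall fun y => ?_)
    by_cases hy : ρ ≤ ‖y‖ <;> simp [Set.indicator, hy]
    ring
  have h1 : I 1 = Real.sin θ * I 0 + Real.cos θ * I 1 := by
    conv_lhs => rw [hI]
    simp only [I]
    rw [← integral_const_mul, ← integral_const_mul, ← integral_add ((hint 0).const_mul _)
      ((hint 1).const_mul _)]
    refine integral_congr_ae (Eventually.of_forall fun y => ?_)
    by_cases hy : ρ ≤ ‖y‖ <;> simp [Set.indicator, hy]
    ring
  have hdet : (2 - 2 * (Real.cos θ : ℂ)) ≠ 0 := by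
    have := cos_two_pi_div_lt_one hm
    have h2 : (2 - 2 * Real.cos θ : ℝ) ≠ 0 := by rw [← hθ] at this; linarith
    exact_mod_cast h2
  have hcs : (Real.cos θ : ℂ) ^ 2 + (Real.sin θ : ℂ) ^ 2 = 1 := by
    exact_mod_cast Real.cos_sq_add_sin_sq θ
  have e0 : (2 - 2 * (Real.cos θ : ℂ)) * I 0 = 0 := by
    linear_combination (1 - (Real.cos θ : ℂ)) * h0 - (Real.sin θ : ℂ) * h1 - I 0 * hcs
  have e1 : (2 - 2 * (Real.cos θ : ℂ)) * I 1 = 0 := by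
    linear_combination (1 - (Real.cos θ : ℂ)) * h1 + (Real.sin θ : ℂ) * h0 - I 1 * hcs
  have e : ∀ i, I i = 0 := Fin.forall_fin_two.2
    ⟨(mul_eq_zero.1 e0).resolve_left hdet, (mul_eq_zero.1 e1).resolve_left hdet⟩
  exact e i

/-- For symmetric functions the corrected kernel induces the velocity of the Biot–Savart law. -/
theorem biotSavart_eq_symVelocity (hm : 2 ≤ m) (s : 𝓢(Plane, ℂ))
    (hs : ∀ x, s (rot (2 * Real.pi / m) x) = s x) (i : Fin 2) {x : Plane} (hx : x ≠ 0) :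
    biotSavart s i x = symVelocity s i x := by
  have hx' : 0 < ‖x‖ := norm_pos_iff.2 hx
  have hint : ∀ i, Integrable fun y => (({y : Plane | 2 * ‖x‖ ≤ ‖y‖}.indicator
      (fun y => biotSavartKernel y i) y : ℝ) : ℂ) * s y := by
    intro i
    refine (s.integrable.norm.const_mul ‖x‖⁻¹).mono' ?_ (Eventually.of_forall fun y => ?_)
    · have hmk : Measurable fun y => biotSavartKernel y i :=
        (measurable_pi_apply i).comp ((WithLp.measurable_ofLp 2 _).comp measurable_biotSavartKernel)
      have hset : MeasurableSet {y : Plane | 2 * ‖x‖ ≤ ‖y‖} :=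
        measurableSet_le measurable_const measurable_norm
      exact (Complex.measurable_ofReal.comp (hmk.indicator hset)).aestronglyMeasurable.mul
        s.continuous.aestronglyMeasurable
    · rw [norm_mul, Complex.norm_real]
      gcongr
      by_cases hy : 2 * ‖x‖ ≤ ‖y‖
      · rw [Set.indicator_of_mem (show y ∈ {y : Plane | 2 * ‖x‖ ≤ ‖y‖} from hy)]
        refine (PiLp.norm_apply_le (biotSavartKernel y) i).trans ?_
        have h1 : ‖y‖⁻¹ ≤ ‖x‖⁻¹ := inv_anti₀ hx' (by linarith)
        have h2 : 0 ≤ ‖y‖⁻¹ := by positivity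
        linarith [norm_biotSavartKernel_le y]
      · rw [Set.indicator_of_notMem (show y ∉ {y : Plane | 2 * ‖x‖ ≤ ‖y‖} from hy), norm_zero]
        positivity
  have h0 := integral_correction_eq_zero hm hs hint i
  rw [biotSavart, symVelocity, ← add_zero (∫ y, (biotSavartKernel (x - y) i : ℂ) * s y), ← h0,
    ← integral_add (integrable_biotSavartKernel_mul s x i) (hint i)]
  refine integral_congr_ae (Eventually.of_forall fun y => ?_)
  by_cases hy : 2 * ‖x‖ ≤ ‖y‖ <;> simp [symKernel, hy, add_mul]

end SymmetricSchwartz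

/-! ### The space of symmetric functions -/

section Symmetric

variable {m : ℕ}

/-- Composition with the rotation by `θ` on `L²`. -/
noncomputable def rotOp (θ : ℝ) : L2 →ₗᵢ[ℂ] L2 :=
  Lp.compMeasurePreservingₗᵢ ℂ (rot θ) (measurePreserving_rot θ)

theorem coeFn_rotOp (θ : ℝ) (f : L2) : rotOp θ f =ᵐ[volume] fun x => f (rot θ x) :=
  Lp.coeFn_compMeasurePreserving f (measurePreserving_rot θ)

theorem mem_L2m_iff {f : L2} : f ∈ L2m m ↔ rotOp (2 * Real.pi / m) f = f := by
  constructor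
  · intro h
    refine Lp.ext ?_
    filter_upwards [coeFn_rotOp (2 * Real.pi / m) f, h] with x hx hx'
    rw [hx, hx']
  · intro h
    have h1 := coeFn_rotOp (2 * Real.pi / m) f
    rw [h] at h1
    change ∀ᵐ x, f (rot (2 * Real.pi / m) x) = f x
    filter_upwards [h1] with x hx using hx.symm

theorem isClosed_L2m (m : ℕ) : IsClosed (L2m m : Set L2) := by
  have h : (L2m m : Set L2) = {f | rotOp (2 * Real.pi / m) f = f} := by
    ext f; exact mem_L2m_iff
  rw [h]
  exact isClosed_eq (rotOp _).continuous continuous_id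

noncomputable instance (m : ℕ) : CompleteSpace (L2m m) := (isClosed_L2m m).completeSpace_coe

theorem rotOp_add (s t : ℝ) (f : L2) : rotOp (s + t) f = rotOp t (rotOp s f) := by
  refine Lp.ext ?_
  have h := (measurePreserving_rot t).quasiMeasurePreserving.ae (coeFn_rotOp s f)
  filter_upwards [coeFn_rotOp (s + t) f, coeFn_rotOp t (rotOp s f), h] with x h1 h2 h3
  rw [h1, h2, h3, rot_add]

theorem rotOp_nat_mul {f : L2} (hf : f ∈ L2m m) (j : ℕ) : rotOp (j * (2 * Real.pi / m)) f = f := by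
  induction j with
  | zero =>
    refine Lp.ext ?_
    filter_upwards [coeFn_rotOp ((0 : ℕ) * (2 * Real.pi / m)) f] with x hx
    rw [hx]; simp
  | succ j ih =>
    rw [Nat.cast_succ, add_mul, one_mul, rotOp_add, ih, mem_L2m_iff.1 hf]

/-- The average of a Schwartz function over the rotations by the multiples of `2π/m`. -/
noncomputable def rotAverage (m : ℕ) (s : 𝓢(Plane, ℂ)) : 𝓢(Plane, ℂ) :=
  (m : ℂ)⁻¹ • ∑ j ∈ Finset.range m, SchwartzMap.compCLMOfContinuousLinearEquiv ℂ
    (rotL (j * (2 * Real.pi / m))).toContinuousLinearEquiv s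

theorem rotAverage_apply (m : ℕ) (s : 𝓢(Plane, ℂ)) (x : Plane) : rotAverage m s x =
    (m : ℂ)⁻¹ * ∑ j ∈ Finset.range m, s (rot (j * (2 * Real.pi / m)) x) := by
  simp [rotAverage]

theorem rotAverage_rot (hm : m ≠ 0) (s : 𝓢(Plane, ℂ)) (x : Plane) :
    rotAverage m s (rot (2 * Real.pi / m) x) = rotAverage m s x := by
  rw [rotAverage_apply, rotAverage_apply]
  congr 1
  have h : ∀ j : ℕ, s (rot (j * (2 * Real.pi / m)) (rot (2 * Real.pi / m) x)) =
      s (rot ((j + 1 : ℕ) * (2 * Real.pi / m)) x) := fun j => by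
    rw [← rot_add, Nat.cast_succ, add_mul, one_mul]
  simp only [h]
  have h1 := Finset.sum_range_succ (fun j : ℕ => s (rot (j * (2 * Real.pi / m)) x)) m
  have h2 := Finset.sum_range_succ' (fun j : ℕ => s (rot (j * (2 * Real.pi / m)) x)) m
  rw [h1] at h2
  have hm' : (m : ℝ) ≠ 0 := by exact_mod_cast hm
  have h3 : (m : ℝ) * (2 * Real.pi / m) = 2 * Real.pi := by field_simp
  simp only [h3, rot_two_pi, Nat.cast_zero, zero_mul, rot_zero] at h2
  exact (add_right_cancel h2).symm

/-- Averaging over the rotations does not increase the distance to a symmetric function. -/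
theorem norm_rotAverage_sub_le (hm : m ≠ 0) (s : 𝓢(Plane, ℂ)) {f : L2} (hf : f ∈ L2m m) :
    ‖(rotAverage m s).toLp 2 volume - f‖ ≤ ‖s.toLp 2 volume - f‖ := by
  have hm' : (m : ℂ) ≠ 0 := by exact_mod_cast hm
  have h1 : ∀ j : ℕ, (SchwartzMap.compCLMOfContinuousLinearEquiv ℂ
      (rotL (j * (2 * Real.pi / m))).toContinuousLinearEquiv s).toLp 2 volume =
      rotOp (j * (2 * Real.pi / m)) (s.toLp 2 volume) := by
    intro j
    refine Lp.ext ?_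
    have h := (measurePreserving_rot (j * (2 * Real.pi / m))).quasiMeasurePreserving.ae
      (s.coeFn_toLp 2 volume)
    filter_upwards [SchwartzMap.coeFn_toLp (SchwartzMap.compCLMOfContinuousLinearEquiv ℂ
      (rotL (j * (2 * Real.pi / m))).toContinuousLinearEquiv s) 2 volume,
      coeFn_rotOp (j * (2 * Real.pi / m)) (s.toLp 2 volume), h] with x e1 e2 e3
    rw [e1, e2, e3]
    rfl
  have h2 : (rotAverage m s).toLp 2 volume - f =
      (m : ℂ)⁻¹ • ∑ j ∈ Finset.range m, rotOp (j * (2 * Real.pi / m)) (s.toLp 2 volume - f) := by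
    have h3 : (rotAverage m s).toLp 2 volume = (m : ℂ)⁻¹ • ∑ j ∈ Finset.range m,
        rotOp (j * (2 * Real.pi / m)) (s.toLp 2 volume) := by
      rw [rotAverage, ← SchwartzMap.toLpCLM_apply (𝕜 := ℂ), map_smul, map_sum]
      simp only [SchwartzMap.toLpCLM_apply, h1]
    simp only [map_sub, rotOp_nat_mul hf, Finset.sum_sub_distrib, smul_sub, Finset.sum_const,
      Finset.card_range, h3]
    rw [← Nat.cast_smul_eq_nsmul ℂ, smul_smul, inv_mul_cancel₀ hm', one_smul]
  rw [h2, norm_smul]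
  calc ‖(m : ℂ)⁻¹‖ * ‖∑ j ∈ Finset.range m, rotOp (j * (2 * Real.pi / m)) (s.toLp 2 volume - f)‖
      ≤ ‖(m : ℂ)⁻¹‖ * ∑ j ∈ Finset.range m, ‖s.toLp 2 volume - f‖ := by
        gcongr
        refine (norm_sum_le _ _).trans (le_of_eq (Finset.sum_congr rfl fun j _ => ?_))
        exact LinearIsometry.norm_map _ _
    _ = ‖s.toLp 2 volume - f‖ := by
        have : (m : ℝ) ≠ 0 := by exact_mod_cast hm
        simp only [Finset.sum_const, Finset.card_range, nsmul_eq_mul, norm_inv,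
          Complex.norm_natCast]
        field_simp

/-- The symmetric Schwartz functions are dense in `L²_m`. -/
theorem exists_symmetric_schwartz_tendsto (hm : m ≠ 0) {f : L2} (hf : f ∈ L2m m) :
    ∃ s : ℕ → 𝓢(Plane, ℂ), (∀ n x, s n (rot (2 * Real.pi / m) x) = s n x) ∧
      Tendsto (fun n => (s n).toLp 2 volume) atTop (𝓝 f) := by
  have hd : DenseRange (SchwartzMap.toLpCLM ℝ ℂ 2 (volume : Measure Plane)) :=
    SchwartzMap.denseRange_toLpCLM (by norm_num)
  have h : ∀ n : ℕ, ∃ s : 𝓢(Plane, ℂ), ‖s.toLp 2 volume - f‖ < 1 / ((n : ℝ) + 1) := fun n => by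
    obtain ⟨s, hs⟩ := Metric.denseRange_iff.1 hd f (1 / ((n : ℝ) + 1)) (by positivity)
    refine ⟨s, ?_⟩
    rwa [dist_comm, dist_eq_norm, SchwartzMap.toLpCLM_apply] at hs
  choose s hs using h
  refine ⟨fun n => rotAverage m (s n), fun n x => rotAverage_rot hm (s n) x, ?_⟩
  rw [tendsto_iff_norm_sub_tendsto_zero]
  exact squeeze_zero (fun _ => norm_nonneg _)
    (fun n => (norm_rotAverage_sub_le hm (s n) hf).trans (hs n).le)
    tendsto_one_div_add_atTop_nhds_zero_nat

theorem tendsto_integral_biotSavart (hm : 2 ≤ m) {f : L2} {s : ℕ → 𝓢(Plane, ℂ)}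
    (hs : ∀ n x, s n (rot (2 * Real.pi / m) x) = s n x)
    (hlim : Tendsto (fun n => (s n).toLp 2 volume) atTop (𝓝 f)) {φ : Plane → ℝ} (hφ : Continuous φ)
    (hc : HasCompactSupport φ) (i : Fin 2) :
    Tendsto (fun n => ∫ x, (φ x : ℂ) * biotSavart (s n) i x) atTop
      (𝓝 (∫ x, (φ x : ℂ) * symVelocity f i x)) := by
  refine (tendsto_integral_symVelocity hlim hφ hc i).congr fun n => ?_
  refine integral_congr_ae ?_
  have h0 : ∀ᵐ x : Plane, x ≠ 0 := by
    rw [ae_iff]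
    simp
  filter_upwards [h0] with x hx
  rw [biotSavart_eq_symVelocity hm (s n) (hs n) i hx,
    symVelocity_congr ((s n).coeFn_toLp 2 volume)]

/-- The corrected kernel computes the extension of the Biot–Savart law to `L²_m`. -/
theorem isBiotSavart_symVelocity (hm : 2 ≤ m) (Ω : L2m m) :
    IsBiotSavart m Ω (symVelocity (Ω : L2)) := by
  obtain ⟨s, hs, hlim⟩ := exists_symmetric_schwartz_tendsto (by omega) Ω.2
  refine ⟨fun i R => memLp_symVelocity Ω i R, s, hs, ?_, fun φ hφ hc i =>
    tendsto_integral_biotSavart hm hs hlim hφ.continuous hc i⟩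
  rw [Lp.tendsto_Lp_iff_tendsto_eLpNorm'] at hlim
  refine hlim.congr fun n => eLpNorm_congr_ae ?_
  filter_upwards [(s n).coeFn_toLp 2] with x hx
  rw [Pi.sub_apply, hx]

/-- The extension of the Biot–Savart law to `L²_m` is single valued. -/
theorem IsBiotSavart.ae_eq_symVelocity (hm : 2 ≤ m) {Ω : L2m m} {v : Fin 2 → Plane → ℂ}
    (h : IsBiotSavart m Ω v) (i : Fin 2) : v i =ᵐ[volume] symVelocity (Ω : L2) i := by
  obtain ⟨hv, s, hs, hlim, hconv⟩ := h
  have hlim' : Tendsto (fun n => (s n).toLp 2 volume) atTop (𝓝 (Ω : L2)) := by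
    rw [Lp.tendsto_Lp_iff_tendsto_eLpNorm']
    refine hlim.congr fun n => eLpNorm_congr_ae ?_
    filter_upwards [(s n).coeFn_toLp 2] with x hx
    rw [Pi.sub_apply, hx]
  have hloc : ∀ {u : Plane → ℂ}, (∀ R : ℝ, MemLp u 2 (volume.restrict (Metric.ball 0 R))) →
      LocallyIntegrable u volume := by
    intro u hu x
    refine ⟨Metric.ball 0 (‖x‖ + 1), Metric.isOpen_ball.mem_nhds (by simp), ?_⟩
    have : IsFiniteMeasure (volume.restrict (Metric.ball (0 : Plane) (‖x‖ + 1))) :=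
      ⟨by rw [Measure.restrict_apply_univ]; exact measure_ball_lt_top⟩
    exact (hu _).integrable (by norm_num)
  have l1 := hloc (hv i)
  have l2 := hloc (memLp_symVelocity Ω i)
  have := ae_eq_zero_of_integral_contDiff_smul_eq_zero (l1.sub l2) fun φ hφ hc => by
    have i1 := l1.integrable_smul_left_of_hasCompactSupport hφ.continuous hc
    have i2 := l2.integrable_smul_left_of_hasCompactSupport hφ.continuous hc
    simp only [Pi.sub_apply, smul_sub]
    rw [integral_sub i1 i2, sub_eq_zero]
    have e := tendsto_nhds_unique (hconv φ hφ hc i)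
      (tendsto_integral_biotSavart hm hs hlim' hφ.continuous hc i)
    simpa only [Complex.real_smul] using e
  filter_upwards [this] with x hx using sub_eq_zero.1 hx

end Symmetric

/-! ### The linearized operator as a perturbation of the transport operator -/

section Linearized

variable {m : ℕ} {α : ℝ} {g : ℝ → ℝ}

theorem fderiv_vorticity_rot (hg : IsProfile α g) (θ : ℝ) (x v : Plane) :
    fderiv ℝ (vorticity g) (rot θ x) (rot θ v) = fderiv ℝ (vorticity g) x v := by
  have hd := hg.contDiff_vorticity.differentiable (by simp)
  have h1 := (hd (rotL θ x)).hasFDerivAt.comp x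
    (rotL θ).toContinuousLinearEquiv.hasFDerivAt
  have h2 : vorticity g ∘ rotL θ = vorticity g := by
    ext y; simp [vorticity]
  rw [h2] at h1
  exact (congrArg (fun L : Plane →L[ℝ] ℝ => L v) h1.fderiv).symm

theorem exists_norm_fderiv_vorticity_le (hα : 0 < α) (hα1 : α < 1) (hg : IsProfile α g) :
    ∃ C, ∀ x, ‖fderiv ℝ (vorticity g) x‖ ≤ C * (1 + ‖x‖) ^ (-(1 + α)) := by
  have hcont : Continuous (fderiv ℝ (vorticity g)) :=
    hg.contDiff_vorticity.continuous_fderiv (by simp)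
  obtain ⟨M, hM⟩ := (isCompact_closedBall (0 : Plane) 2).exists_bound_of_continuousOn
    hcont.continuousOn
  have hM0 : 0 ≤ M := (norm_nonneg _).trans (hM 0 (by simp))
  refine ⟨9 * M + 4, fun x => ?_⟩
  have hp : 0 < 1 + ‖x‖ := by positivity
  have hpos : 0 < (1 + ‖x‖) ^ (-(1 + α)) := Real.rpow_pos_of_pos hp _
  rcases le_or_gt ‖x‖ 2 with hx | hx
  · have h1 : 1 ≤ 9 * (1 + ‖x‖) ^ (-(1 + α)) := by
      have h2 : (1 + ‖x‖) ^ (1 + α) ≤ 9 := by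
        calc (1 + ‖x‖) ^ (1 + α) ≤ 3 ^ (1 + α) :=
              Real.rpow_le_rpow hp.le (by linarith) (by linarith)
          _ ≤ 3 ^ (2 : ℝ) := Real.rpow_le_rpow_of_exponent_le (by norm_num) (by linarith)
          _ = 9 := by norm_num
      rw [Real.rpow_neg hp.le, ← div_eq_mul_inv, one_le_div (Real.rpow_pos_of_pos hp _)]
      exact h2
    have h3 := hM x (by simpa using hx)
    nlinarith
  · have hx0 : x ≠ 0 := by
      rw [← norm_pos_iff]; linarith
    have hev : vorticity g =ᶠ[𝓝 x] (fun r : ℝ => r ^ (-α)) ∘ norm := by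
      have : ∀ᶠ y in 𝓝 x, 2 < ‖y‖ := continuous_norm.continuousAt.eventually_const_lt hx
      filter_upwards [this] with y hy using hg.decay _ hy.le
    have hn : DifferentiableAt ℝ (norm : Plane → ℝ) x :=
      (contDiffAt_norm ℝ hx0 (n := 1)).differentiableAt (by simp)
    have hr : HasDerivAt (fun r : ℝ => r ^ (-α)) (-α * ‖x‖ ^ (-α - 1)) ‖x‖ :=
      Real.hasDerivAt_rpow_const (Or.inl (by linarith))
    have hf := hr.comp_hasFDerivAt x hn.hasFDerivAt
    rw [hev.fderiv_eq, hf.fderiv, norm_smul]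
    have h1 : ‖fderiv ℝ (norm : Plane → ℝ) x‖ ≤ 1 := by
      have := norm_fderiv_le_of_lipschitz ℝ (x₀ := x) (lipschitzWith_one_norm (E := Plane))
      simpa using this
    have h2 : ‖-α * ‖x‖ ^ (-α - 1)‖ ≤ ‖x‖ ^ (-(1 + α)) := by
      rw [norm_mul, norm_neg, Real.norm_of_nonneg hα.le, Real.norm_of_nonneg (by positivity),
        show -α - 1 = -(1 + α) by ring]
      exact mul_le_of_le_one_left (by positivity) hα1.le
    have h3 : ‖x‖ ^ (-(1 + α)) ≤ 4 * (1 + ‖x‖) ^ (-(1 + α)) := by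
      calc ‖x‖ ^ (-(1 + α)) ≤ ((1 + ‖x‖) / 2) ^ (-(1 + α)) :=
            Real.rpow_le_rpow_of_nonpos (by positivity) (by linarith) (by linarith)
        _ = 2 ^ (1 + α) * (1 + ‖x‖) ^ (-(1 + α)) := by
            rw [Real.div_rpow hp.le (by norm_num), Real.rpow_neg (by norm_num : (0 : ℝ) ≤ 2),
              div_inv_eq_mul, mul_comm]
        _ ≤ 4 * (1 + ‖x‖) ^ (-(1 + α)) := by
            gcongr
            calc (2 : ℝ) ^ (1 + α) ≤ 2 ^ (2 : ℝ) :=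
                  Real.rpow_le_rpow_of_exponent_le (by norm_num) (by linarith)
              _ = 4 := by norm_num
    calc _ ≤ ‖x‖ ^ (-(1 + α)) * 1 := mul_le_mul h2 h1 (norm_nonneg _) (by positivity)
      _ ≤ _ := by nlinarith

theorem plane_decomp (x : Plane) :
    x = x 0 • EuclideanSpace.single 0 1 + x 1 • EuclideanSpace.single 1 1 :=
  plane_ext (by simp) (by simp)

theorem clm_apply_eq (L : Plane →L[ℝ] ℝ) (x : Plane) :
    L x = x 0 * L (EuclideanSpace.single 0 1) + x 1 * L (EuclideanSpace.single 1 1) := by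
  conv_lhs => rw [plane_decomp x]
  simp only [map_add, map_smul, smul_eq_mul]

theorem advect_symVelocity {f : L2} {x : Plane}
    (h : ∀ i, Integrable fun y => (symKernel x y i : ℂ) * f y) :
    advect (symVelocity f) (vorticity g) x =
      ∫ y, ((fderiv ℝ (vorticity g) x (symKernel x y) : ℝ) : ℂ) * f y := by
  unfold advect symVelocity
  simp only [Fin.sum_univ_two, ← integral_mul_const]
  rw [← integral_add ((h 0).mul_const _) ((h 1).mul_const _)]
  refine integral_congr_ae (Eventually.of_forall fun y => ?_)
  simp only [clm_apply_eq (fderiv ℝ (vorticity g) x) (symKernel x y)]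
  push_cast
  ring

/-- The operator `f ↦ -((K₂ * f) · ∇) Ω̄` is a limit of operators of finite rank. -/
theorem exists_advectOp (hα : 0 < α) (hα1 : α < 1) (hg : IsProfile α g) :
    ∃ T ∈ approxFiniteRank L2 L2,
      ∀ f : L2, T f =ᵐ[volume] fun x => -advect (symVelocity f) (vorticity g) x := by
  obtain ⟨C, hC⟩ := exists_norm_fderiv_vorticity_le hα hα1 hg
  have h : ∀ i : Fin 2, ∃ T ∈ approxFiniteRank L2 L2, IsKernelOp (fun x y =>
      ((fderiv ℝ (vorticity g) x (EuclideanSpace.single i 1) : ℝ) : ℂ) * (symKernel x y i : ℂ)) T := by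
    intro i
    refine exists_isKernelOp_symKernel ?_ hα hα1.le (C := C) (fun x => ?_) i
    · exact ((hg.contDiff_vorticity.continuous_fderiv (by simp)).clm_apply
        continuous_const).measurable
    · refine le_trans ?_ (hC x)
      have := (fderiv ℝ (vorticity g) x).le_opNorm (EuclideanSpace.single i 1)
      simpa using this
  obtain ⟨T₀, hT₀, hk₀⟩ := h 0
  obtain ⟨T₁, hT₁, hk₁⟩ := h 1
  refine ⟨-(T₀ + T₁), Submodule.neg_mem _ (Submodule.add_mem _ hT₀ hT₁), fun f => ?_⟩
  filter_upwards [Lp.coeFn_neg ((T₀ + T₁) f), ((hk₀.add hk₁) f).2,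
    integrable_symKernel_mul f 0, integrable_symKernel_mul f 1] with x e1 e2 i0 i1
  rw [neg_apply, e1, Pi.neg_apply, e2, advect_symVelocity (Fin.forall_fin_two.2 ⟨i0, i1⟩)]
  congr 1
  refine integral_congr_ae (Eventually.of_forall fun y => ?_)
  simp only [clm_apply_eq (fderiv ℝ (vorticity g) x) (symKernel x y)]
  push_cast
  ring

/-- The operator `f ↦ ((K₂ * f) · ∇) Ω̄` preserves the symmetry. -/
theorem advect_symVelocity_rot (hg : IsProfile α g) {f : L2} (hf : f ∈ L2m m) :
    ∀ᵐ x, advect (symVelocity f) (vorticity g) (rot (2 * Real.pi / m) x) =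
      advect (symVelocity f) (vorticity g) x := by
  set θ := 2 * Real.pi / m with hθ
  have hmp := measurePreserving_rot θ
  have hint : ∀ᵐ x, ∀ i, Integrable fun y => (symKernel x y i : ℂ) * f y := by
    rw [ae_all_iff]
    exact fun i => integrable_symKernel_mul f i
  filter_upwards [hint, hmp.quasiMeasurePreserving.ae hint] with x hx hx'
  rw [advect_symVelocity hx, advect_symVelocity hx',
    ← hmp.integral_comp (rotL θ).toHomeomorph.measurableEmbedding]
  refine integral_congr_ae ?_
  have hf' : ∀ᵐ x, f (rot θ x) = f x := hf
  filter_upwards [hf'] with y hy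
  rw [hy, symKernel_rot, fderiv_vorticity_rot hg]

theorem isWeakDiv_iff_transport {Ω D : L2} :
    IsWeakDiv (velocity g) Ω D ↔ transport (angularVelocity g) Ω (-D) := by
  unfold IsWeakDiv transport
  refine forall_congr' fun φ => forall_congr' fun _ => forall_congr' fun _ => ?_
  have h1 : ∫ x, (φ x : ℂ) * (-D : L2) x = -∫ x, (φ x : ℂ) * D x := by
    rw [← integral_neg]
    refine integral_congr_ae ?_
    filter_upwards [Lp.coeFn_neg D] with x hx
    rw [hx]; simp
  have h2 : ∀ x, fderiv ℝ φ x (velocity g x) = alongFlow (angularVelocity g) φ x := fun x => by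
    rw [velocity_eq]; rfl
  simp only [h1, h2]
  rw [neg_eq_iff_eq_neg]

/-- The linearized operator is the transport operator plus `T`, if `T` is the operator
`f ↦ -((K₂ * f) · ∇) Ω̄`. -/
theorem Lst_iff (hm : 2 ≤ m) {T : L2 →L[ℂ] L2}
    (hT : ∀ f : L2, T f =ᵐ[volume] fun x => -advect (symVelocity f) (vorticity g) x)
    (Ω F : L2m m) : Lst m g Ω F ↔ transport (angularVelocity g) Ω (F - T Ω) := by
  constructor
  · rintro ⟨D, v, hD, hv, hF⟩
    have h : (F - T Ω : L2) = -D := by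
      refine Lp.ext ?_
      filter_upwards [hF, hT Ω, Lp.coeFn_sub (F : L2) (T Ω), Lp.coeFn_neg D,
        hv.ae_eq_symVelocity hm 0, hv.ae_eq_symVelocity hm 1] with x e1 e2 e3 e4 e5 e6
      rw [e3, Pi.sub_apply, e1, e2, e4, Pi.neg_apply]
      simp only [advect, Fin.sum_univ_two, e5, e6]
      ring
    rw [h]
    exact isWeakDiv_iff_transport.1 hD
  · intro h
    refine ⟨-(F - T Ω), symVelocity (Ω : L2), ?_, isBiotSavart_symVelocity hm Ω, ?_⟩
    · rw [isWeakDiv_iff_transport, neg_neg]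
      exact h
    · filter_upwards [hT Ω, Lp.coeFn_sub (F : L2) (T Ω), Lp.coeFn_neg (F - T Ω : L2)] with x e2 e3 e4
      rw [e4, Pi.neg_apply, e3, Pi.sub_apply, e2]
      ring

theorem rotOp_pull {a : Plane → ℝ} (hc : Continuous a) (ha : ∀ θ x, a (rot θ x) = a x) (t : ℝ)
    {f : L2} (hf : f ∈ L2m m) :
    rotOp (2 * Real.pi / m) (pull hc.measurable ha t f) = pull hc.measurable ha t f := by
  refine Lp.ext ?_
  have hmp := (measurePreserving_rot (2 * Real.pi / m)).quasiMeasurePreserving.ae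
    (coeFn_pull hc.measurable ha t f)
  have hf' : ∀ᵐ x, f (rot (2 * Real.pi / m) x) = f x := hf
  have hfl := (measurePreserving_flow hc.measurable ha (-t)).quasiMeasurePreserving.ae hf'
  filter_upwards [coeFn_rotOp (2 * Real.pi / m) (pull hc.measurable ha t f), hmp, hfl,
    coeFn_pull hc.measurable ha t f] with x e1 e2 e3 e4
  rw [e1, e2, e4, flow_rot ha, e3]

theorem transportResolvent_mem_L2m {a : Plane → ℝ} (hc : Continuous a)
    (ha : ∀ θ x, a (rot θ x) = a x) {w : ℂ} (hw : 0 < w.re) {f : L2} (hf : f ∈ L2m m) :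
    transportResolvent hc ha w hw f ∈ L2m m := by
  have h1 := map_transportResolvent hc ha hw (rotOp (2 * Real.pi / m)).toContinuousLinearMap f
  simp only [LinearIsometry.coe_toContinuousLinearMap, rotOp_pull hc ha _ hf] at h1
  rw [mem_L2m_iff, h1, transportResolvent_apply]
  rfl

/-- The resolvent of the transport operator at every point off the imaginary axis; on the left half
plane it comes from the flow with the opposite angular velocity. -/
theorem exists_transportResolvent (hg : IsProfile α g) {z : ℂ} (hz : z.re ≠ 0) :
    ∃ R : L2 →L[ℂ] L2, IsBoundedInverse (transport (angularVelocity g)) z R ∧ ‖R‖ ≤ |z.re|⁻¹ ∧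
      ∀ f ∈ L2m m, R f ∈ L2m m := by
  have hs := hg.contDiff_angularVelocity
  rcases lt_or_gt_of_ne hz with hneg | hpos
  · have hw : 0 < (-z).re := by simpa using hneg
    have ha : ∀ θ x, (fun x => -angularVelocity g x) (rot θ x) = (fun x => -angularVelocity g x) x :=
      fun θ x => by simp only [angularVelocity_rot]
    have hs' : ContDiff ℝ ∞ fun x => -angularVelocity g x := hs.neg
    have hinv := isBoundedInverse_transportResolvent hs' ha hw
    have hle := norm_transportResolvent_le hs'.continuous ha hw
    have hmem := fun f (hf : f ∈ L2m m) => transportResolvent_mem_L2m hs'.continuous ha hw hf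
    generalize transportResolvent hs'.continuous ha (-z) hw = R at hinv hle hmem
    refine ⟨-R, fun x y => ?_, ?_, fun f hf => ?_⟩
    · rw [← transport_neg, hinv x (-y), neg_apply, ← map_neg]
      have : -y - -z • x = -(y - z • x) := by rw [neg_smul]; abel
      rw [this]
    · rw [norm_neg, abs_of_neg hneg]
      simpa using hle
    · exact Submodule.neg_mem _ (hmem f hf)
  · have hinv := isBoundedInverse_transportResolvent hs (angularVelocity_rot g) hpos
    have hle := norm_transportResolvent_le hs.continuous (angularVelocity_rot g) hpos
    have hmem := fun f (hf : f ∈ L2m m) =>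
      transportResolvent_mem_L2m hs.continuous (angularVelocity_rot g) hpos hf
    refine ⟨_, hinv, ?_, hmem⟩
    rwa [abs_of_pos hpos]

/-- The restriction of an operator on `L²` to `L²_m`. -/
noncomputable def restrictL2m (m : ℕ) (T : L2 →L[ℂ] L2) (hT : ∀ f ∈ L2m m, T f ∈ L2m m) :
    L2m m →L[ℂ] L2m m :=
  (T ∘L (L2m m).subtypeL).codRestrict (L2m m) fun f => hT f f.2

theorem coe_restrictL2m {T : L2 →L[ℂ] L2} (hT : ∀ f ∈ L2m m, T f ∈ L2m m) (f : L2m m) :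
    (restrictL2m m T hT f : L2) = T f := rfl

/-- Being a limit of operators of finite rank is inherited by the restriction to an invariant closed
subspace, because of the orthogonal projection onto it. -/
theorem restrict_mem_approxFiniteRank {H : Type*} [NormedAddCommGroup H] [InnerProductSpace ℂ H]
    (K : Submodule ℂ H) [K.HasOrthogonalProjection] {T : H →L[ℂ] H} (h : T ∈ approxFiniteRank H H)
    {T' : K →L[ℂ] K} (hT : ∀ f : K, (T' f : H) = T f) : T' ∈ approxFiniteRank K K := by
  have h1 : K.orthogonalProjectionOnto ∘L (T ∘L K.subtypeL) = T' := by
    ext1 f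
    have h2 := Submodule.orthogonalProjectionOnto_mem_subspace_eq_self (T' f)
    rw [hT f] at h2
    exact h2
  rw [← h1]
  exact comp_mem_approxFiniteRank _ (approxFiniteRank_comp h _)

/-- Off the imaginary axis the spectrum of the linearized operator is discrete and consists of
eigenvalues. -/
theorem mem_discreteSpec_Lst (hα : 0 < α) (hα1 : α < 1) (hm : 2 ≤ m) (hg : IsProfile α g) {z : ℂ}
    (hz : z ∈ spec (Lst m g)) (hre : z.re ≠ 0) :
    z ∈ discreteSpec (Lst m g) ∧ ∃ Ω : L2m m, Ω ≠ 0 ∧ Lst m g Ω (z • Ω) := by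
  obtain ⟨T, hTJ, hT⟩ := exists_advectOp hα hα1 hg
  have hTm : ∀ f ∈ L2m m, T f ∈ L2m m := by
    intro f hf
    change ∀ᵐ x, T f (rot (2 * Real.pi / m) x) = T f x
    filter_upwards [hT f, (measurePreserving_rot (2 * Real.pi / m)).quasiMeasurePreserving.ae (hT f),
      advect_symVelocity_rot hg hf] with x e1 e2 e3
    rw [e2, e1, e3]
  have hR : ∀ z : ℂ, ∃ R : L2m m →L[ℂ] L2m m, z.re ≠ 0 →
      IsBoundedInverse (fun x y : L2m m => transport (angularVelocity g) x y) z R ∧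
        ‖R‖ ≤ |z.re|⁻¹ := by
    intro z
    by_cases hz : z.re = 0
    · exact ⟨0, fun h => absurd hz h⟩
    obtain ⟨R, h1, h2, h3⟩ := exists_transportResolvent (m := m) hg hz
    refine ⟨restrictL2m m R h3, fun _ => ⟨fun x y => ?_, ?_⟩⟩
    · change transport (angularVelocity g) (x : L2) (y : L2) ↔ _
      exact (h1 x y).trans ⟨fun h => Subtype.ext h,
        fun h => congrArg (fun u : L2m m => (u : L2)) h⟩
    · refine ContinuousLinearMap.opNorm_le_bound _ (by positivity) fun f => ?_
      exact (R.le_opNorm f).trans (mul_le_mul_of_nonneg_right h2 (norm_nonneg _))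
  choose R hR using hR
  obtain ⟨h1, Ω, h2, h3⟩ := mem_discreteSpec_of_perturbation
    (restrict_mem_approxFiniteRank (L2m m) hTJ (coe_restrictL2m hTm)) (fun z hz => (hR z hz).1)
    (fun z hz => (hR z hz).2)
    (fun x y => Lst_iff hm hT x y) hz hre
  exact ⟨h1, Ω, h2, h3⟩

end Linearized

/-! ### Real eigenfunctions -/

section Conjugation

variable {m : ℕ} {g : ℝ → ℝ}

/-- The complex conjugate of an element of `L²`. -/
noncomputable def conjL2 (f : L2) : L2 := (Lp.memLp f).star.toLp _

theorem coeFn_conjL2 (f : L2) : conjL2 f =ᵐ[volume] fun x => (starRingEnd ℂ) (f x) :=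
  MemLp.coeFn_toLp _

theorem conjL2_mem {f : L2} (hf : f ∈ L2m m) : conjL2 f ∈ L2m m := by
  change ∀ᵐ x, conjL2 f (rot (2 * Real.pi / m) x) = conjL2 f x
  have hf' : ∀ᵐ x, f (rot (2 * Real.pi / m) x) = f x := hf
  filter_upwards [coeFn_conjL2 f, hf',
    (measurePreserving_rot (2 * Real.pi / m)).quasiMeasurePreserving.ae (coeFn_conjL2 f)]
    with x e1 e2 e3
  rw [e3, e1, e2]

theorem transport_conj {a : Plane → ℝ} {Ω G : L2} (h : transport a Ω G) :
    transport a (conjL2 Ω) (conjL2 G) := by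
  intro φ hφ hc
  have key : ∀ (ψ : Plane → ℝ) (f : L2), ∫ x, (ψ x : ℂ) * conjL2 f x =
      (starRingEnd ℂ) (∫ x, (ψ x : ℂ) * f x) := by
    intro ψ f
    rw [← integral_conj]
    refine integral_congr_ae ?_
    filter_upwards [coeFn_conjL2 f] with x hx
    rw [hx, map_mul, Complex.conj_ofReal]
  rw [key, key, h φ hφ hc]

theorem advect_symVelocity_conj (f : L2) (x : Plane) :
    advect (symVelocity (conjL2 f)) (vorticity g) x =
      (starRingEnd ℂ) (advect (symVelocity f) (vorticity g) x) := by
  have key : ∀ i, symVelocity (conjL2 f) i x = (starRingEnd ℂ) (symVelocity f i x) := by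
    intro i
    rw [symVelocity, symVelocity, ← integral_conj]
    refine integral_congr_ae ?_
    filter_upwards [coeFn_conjL2 f] with y hy
    rw [hy, map_mul, Complex.conj_ofReal]
  simp only [advect, key, map_sum, map_mul, Complex.conj_ofReal]

theorem transport_smul_add {a : Plane → ℝ} (ha : Continuous a) {f f' h h' : L2}
    (h1 : transport a f h) (h2 : transport a f' h') (c d : ℂ) :
    transport a (c • f + d • f') (c • h + d • h') := by
  intro φ hφ hφc
  have m1 := memLp_ofReal hφ.continuous hφc
  have m2 := memLp_ofReal (continuous_alongFlow ha hφ) (hasCompactSupport_alongFlow (a := a) hφc)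
  have a1 := h1 φ hφ hφc
  have a2 := h2 φ hφ hφc
  rw [← testFunctional_apply m1, ← testFunctional_apply m2] at a1 a2 ⊢
  rw [map_add, map_add, map_smul, map_smul, map_smul, map_smul, a1, a2]

/-- The right-hand side of the eigenvalue equation commutes with the conjugation when the eigenvalue
is real. -/
theorem conjL2_eigen {T : L2 →L[ℂ] L2}
    (hT : ∀ f : L2, T f =ᵐ[volume] fun x => -advect (symVelocity f) (vorticity g) x) {z : ℂ}
    (hz : (starRingEnd ℂ) z = z) (f : L2) :
    conjL2 (z • f - T f) = z • conjL2 f - T (conjL2 f) := by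
  refine Lp.ext ?_
  filter_upwards [coeFn_conjL2 (z • f - T f), Lp.coeFn_sub (z • f) (T f),
    Lp.coeFn_sub (z • conjL2 f) (T (conjL2 f)), hT f, hT (conjL2 f), Lp.coeFn_smul z f,
    Lp.coeFn_smul z (conjL2 f), coeFn_conjL2 f] with x e1 e2 e3 e4 e5 e6 e7 e8
  rw [e1, e2, e3, Pi.sub_apply, Pi.sub_apply, e4, e5, e6, e7, Pi.smul_apply, Pi.smul_apply, e8,
    advect_symVelocity_conj, map_sub, smul_eq_mul, smul_eq_mul, map_mul, hz, map_neg]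

theorem im_add_conjL2 (f : L2) : ∀ᵐ x, ((f + conjL2 f : L2) x).im = 0 := by
  filter_upwards [Lp.coeFn_add f (conjL2 f), coeFn_conjL2 f] with x e1 e2
  rw [e1, Pi.add_apply, e2]
  simp

theorem conjL2_smul (c : ℂ) (f : L2) : conjL2 (c • f) = (starRingEnd ℂ) c • conjL2 f := by
  refine Lp.ext ?_
  filter_upwards [coeFn_conjL2 (c • f), Lp.coeFn_smul c f, coeFn_conjL2 f,
    Lp.coeFn_smul ((starRingEnd ℂ) c) (conjL2 f)] with x e1 e2 e3 e4
  rw [e1, e2, e4, Pi.smul_apply, Pi.smul_apply, e3, smul_eq_mul, smul_eq_mul, map_mul]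

/-- A real eigenvalue has a real eigenfunction: twice the real part of an eigenfunction `Ω`, or
twice the real part of `iΩ`. -/
theorem exists_real_eigenfunction {α : ℝ} (hα : 0 < α) (hα1 : α < 1) (hm : 2 ≤ m)
    (hg : IsProfile α g) {z : ℂ} (hz : z.im = 0) {Ω : L2m m} (h0 : Ω ≠ 0)
    (h : Lst m g Ω (z • Ω)) :
    ∃ Ω' : L2m m, Ω' ≠ 0 ∧ Lst m g Ω' (z • Ω') ∧ ∀ᵐ x, ((Ω' : L2) x).im = 0 := by
  obtain ⟨T, -, hT⟩ := exists_advectOp hα hα1 hg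
  have hzc : (starRingEnd ℂ) z = z := Complex.conj_eq_iff_im.2 hz
  have ha := hg.contDiff_angularVelocity.continuous
  obtain ⟨f, hf⟩ := Ω
  have h1 : transport (angularVelocity g) f (z • f - T f) := (Lst_iff hm hT _ _).1 h
  have hf0 : f ≠ 0 := fun h2 => h0 (Subtype.ext h2)
  have key : ∀ c : ℂ, c • f + conjL2 (c • f) ≠ 0 → ∃ Ω' : L2m m, Ω' ≠ 0 ∧
      Lst m g Ω' (z • Ω') ∧ ∀ᵐ x, ((Ω' : L2) x).im = 0 := by
    intro c hc
    have hmem : c • f + conjL2 (c • f) ∈ L2m m :=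
      Submodule.add_mem _ (Submodule.smul_mem _ c hf) (conjL2_mem (Submodule.smul_mem _ c hf))
    refine ⟨⟨_, hmem⟩, fun h2 => hc (congrArg Subtype.val h2), ?_, im_add_conjL2 _⟩
    rw [Lst_iff hm hT]
    have h2 := transport_conj h1
    rw [conjL2_eigen hT hzc] at h2
    have h3 := transport_smul_add ha h1 h2 c ((starRingEnd ℂ) c)
    rw [← conjL2_smul] at h3
    refine Eq.subst (motive := transport (angularVelocity g) _) ?_ h3
    change _ = z • (c • f + conjL2 (c • f)) - T (c • f + conjL2 (c • f))
    rw [conjL2_smul, map_add, map_smul, map_smul]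
    module
  by_cases hne : (1 : ℂ) • f + conjL2 ((1 : ℂ) • f) = 0
  · refine key Complex.I fun h5 => hf0 ?_
    rw [one_smul] at hne
    rw [conjL2_smul, Complex.conj_I] at h5
    have h6 : (2 * Complex.I) • f = 0 := by
      linear_combination (norm := module) h5 + Complex.I • hne
    exact (smul_eq_zero.1 h6).resolve_left (by simp)
  · exact key 1 hne

end Conjugation

/-! ### Angular integrals of the Biot–Savart kernel -/

section Angular

/-- The complex coordinate `x₁ + i x₂` on the plane. -/
noncomputable def toC (x : Plane) : ℂ := ⟨x 0, x 1⟩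

theorem norm_toC (x : Plane) : ‖toC x‖ = ‖x‖ := by
  rw [← sq_eq_sq₀ (norm_nonneg _) (norm_nonneg _), norm_sq_plane, ← Complex.normSq_eq_norm_sq,
    Complex.normSq_apply, toC]
  ring

theorem toC_sub (x y : Plane) : toC (x - y) = toC x - toC y := by
  apply Complex.ext <;> simp [toC]

theorem toC_ne_zero {x : Plane} (hx : x ≠ 0) : toC x ≠ 0 := by
  rw [← norm_ne_zero_iff, norm_toC]
  exact norm_ne_zero_iff.2 hx

theorem toC_rot (θ : ℝ) (x : Plane) : toC (rot θ x) = Complex.exp (θ * Complex.I) * toC x := by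
  rw [Complex.exp_mul_I, ← Complex.ofReal_cos, ← Complex.ofReal_sin]
  apply Complex.ext <;> simp [toC, -Complex.ofReal_cos, -Complex.ofReal_sin] <;> ring

theorem continuous_toC : Continuous toC := by
  have h : toC = fun x : Plane => ((x 0 : ℝ) : ℂ) + ((x 1 : ℝ) : ℂ) * Complex.I := by
    ext x; apply Complex.ext <;> simp [toC]
  rw [h]
  fun_prop

/-- In complex notation `x · K₂(w) = Im (x / w) / 2π`. -/
theorem dot_biotSavartKernel (x w : Plane) :
    x 0 * biotSavartKernel w 0 + x 1 * biotSavartKernel w 1 =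
      (2 * Real.pi)⁻¹ * (toC x / toC w).im := by
  have hn : Complex.normSq (toC w) = ‖w‖ ^ 2 := by
    rw [Complex.normSq_eq_norm_sq, norm_toC]
  rw [Complex.div_im, hn]
  simp only [biotSavartKernel, PiLp.smul_apply, perp_apply_zero, perp_apply_one, smul_eq_mul, toC,
    mul_inv]
  ring

/-- The point `e^{iφ}` of the unit circle. -/
noncomputable def unit (φ : ℝ) : ℂ := Complex.exp (φ * Complex.I)

theorem norm_unit (φ : ℝ) : ‖unit φ‖ = 1 := Complex.norm_exp_ofReal_mul_I φ

theorem unit_ne_zero (φ : ℝ) : unit φ ≠ 0 := Complex.exp_ne_zero _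

theorem conj_unit (φ : ℝ) : (starRingEnd ℂ) (unit φ) = (unit φ)⁻¹ := by
  rw [Complex.inv_def, Complex.normSq_eq_norm_sq, norm_unit]
  simp

theorem continuous_unit : Continuous unit := by unfold unit; fun_prop

theorem integral_unit_mul (f : ℂ → ℂ) :
    ∫ φ in (0 : ℝ)..2 * Real.pi, unit φ * f (unit φ) = -Complex.I * ∮ z in C(0, 1), f z := by
  have h : ∀ φ : ℝ, deriv (circleMap 0 1) φ • f (circleMap 0 1 φ) =
      Complex.I * (unit φ * f (unit φ)) := fun φ => by
    have : circleMap 0 1 φ = unit φ := by simp [circleMap, unit]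
    rw [deriv_circleMap, this, smul_eq_mul]
    ring
  rw [circleIntegral]
  simp only [h]
  rw [intervalIntegral.integral_const_mul, ← mul_assoc]
  simp

theorem integral_unit_pow (n : ℕ) : ∫ φ in (0 : ℝ)..2 * Real.pi, unit φ ^ (n + 1) = 0 := by
  have h := integral_unit_mul fun z => z ^ n
  simp only [← pow_succ'] at h
  rw [h]
  have h2 : DiffContOnCl ℂ (fun z : ℂ => z ^ n) (Metric.ball 0 1) :=
    (differentiable_id.pow n).diffContOnCl
  rw [h2.circleIntegral_eq_zero zero_le_one, mul_zero]

theorem integral_unit_pow_div_of_lt {a : ℂ} (ha : ‖a‖ < 1) (n : ℕ) :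
    ∫ φ in (0 : ℝ)..2 * Real.pi, unit φ ^ (n + 1) / (unit φ - a) = 2 * Real.pi * a ^ n := by
  have h := integral_unit_mul fun z => (z - a)⁻¹ • z ^ n
  have h2 : DiffContOnCl ℂ (fun z : ℂ => z ^ n) (Metric.ball 0 1) :=
    (differentiable_id.pow n).diffContOnCl
  rw [h2.circleIntegral_sub_inv_smul (by simpa using ha)] at h
  have h3 : ∀ φ : ℝ, unit φ ^ (n + 1) / (unit φ - a) =
      unit φ * ((unit φ - a)⁻¹ • unit φ ^ n) := fun φ => by
    rw [smul_eq_mul, pow_succ, div_eq_mul_inv]; ring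
  simp only [h3]
  rw [h, smul_eq_mul]
  linear_combination (-2 * Real.pi * a ^ n) * Complex.I_mul_I

theorem integral_unit_pow_div_of_gt {a : ℂ} (ha : 1 < ‖a‖) (n : ℕ) :
    ∫ φ in (0 : ℝ)..2 * Real.pi, unit φ ^ (n + 1) / (unit φ - a) = 0 := by
  have h := integral_unit_mul fun z => z ^ n / (z - a)
  have hne : ∀ z ∈ Metric.closedBall (0 : ℂ) 1, z - a ≠ 0 := fun z hz h0 => by
    rw [sub_eq_zero.1 h0] at hz
    rw [mem_closedBall_zero_iff] at hz
    linarith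
  have h2 : DiffContOnCl ℂ (fun z : ℂ => z ^ n / (z - a)) (Metric.ball 0 1) := by
    refine DifferentiableOn.diffContOnCl ?_
    rw [closure_ball _ one_ne_zero]
    exact ((differentiable_id.pow n).differentiableOn).div
      ((differentiable_id.sub_const a).differentiableOn) hne
  rw [h2.circleIntegral_eq_zero zero_le_one, mul_zero] at h
  rw [← h]
  refine intervalIntegral.integral_congr fun φ _ => ?_
  simp only [pow_succ]
  ring

/-- The kernel `(min(r, s) / max(r, s))^m` of the Green function of the Laplacian on the `m`-th
angular mode. -/
noncomputable def radialKernel (m : ℕ) (r s : ℝ) : ℝ := (min r s / max r s) ^ m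

theorem integrable_unit_div {a : ℂ} (ha : ‖a‖ ≠ 1) (n : ℕ) : IntervalIntegrable
    (fun φ : ℝ => unit φ ^ n / (unit φ - a)) volume 0 (2 * Real.pi) := by
  refine Continuous.intervalIntegrable ?_ _ _
  refine (continuous_unit.pow n).div (continuous_unit.sub continuous_const) fun φ h0 => ha ?_
  rw [← sub_eq_zero.1 h0, norm_unit]

/-- The `m`-th Fourier coefficient of the conjugate Poisson kernel. -/
theorem integral_im_div_mul_unit_pow {X Y : ℂ} (hX : X ≠ 0) (hY : Y ≠ 0) (hXY : ‖X‖ ≠ ‖Y‖) {m : ℕ}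
    (hm : m ≠ 0) :
    ∫ φ in (0 : ℝ)..2 * Real.pi, ((X / (X - unit φ * Y)).im : ℂ) * (unit φ * (Y / ‖Y‖)) ^ m =
      Real.pi * Complex.I * radialKernel m ‖X‖ ‖Y‖ * (X / ‖X‖) ^ m := by
  obtain ⟨n, rfl⟩ : ∃ n, m = n + 1 := ⟨m - 1, by omega⟩
  have hX' : 0 < ‖X‖ := norm_pos_iff.2 hX
  have hY' : 0 < ‖Y‖ := norm_pos_iff.2 hY
  have hXc : (‖X‖ : ℂ) ≠ 0 := by exact_mod_cast hX'.ne'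
  have hYc : (‖Y‖ : ℂ) ≠ 0 := by exact_mod_cast hY'.ne'
  set p : ℂ := X / Y with hp
  set q : ℂ := (starRingEnd ℂ) Y / (starRingEnd ℂ) X with hq
  have hcX : (starRingEnd ℂ) X ≠ 0 := (map_ne_zero _).2 hX
  have hcY : (starRingEnd ℂ) Y ≠ 0 := (map_ne_zero _).2 hY
  have hpn : ‖p‖ = ‖X‖ / ‖Y‖ := by rw [hp, norm_div]
  have hqn : ‖q‖ = ‖Y‖ / ‖X‖ := by rw [hq, norm_div, RCLike.norm_conj, RCLike.norm_conj]
  have hp1 : ‖p‖ ≠ 1 := by rwa [hpn, Ne, div_eq_one_iff_eq hY'.ne']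
  have hq1 : ‖q‖ ≠ 1 := by
    rw [hqn, Ne, div_eq_one_iff_eq hX'.ne']
    exact fun h => hXY h.symm
  have key : ∀ φ : ℝ, ((X / (X - unit φ * Y)).im : ℂ) * (unit φ * (Y / ‖Y‖)) ^ (n + 1) =
      (Y / ‖Y‖) ^ (n + 1) * (2 * Complex.I)⁻¹ * (-p) * (unit φ ^ (n + 1) / (unit φ - p)) +
      (Y / ‖Y‖) ^ (n + 1) * (2 * Complex.I)⁻¹ * (-1) * (unit φ ^ (n + 1 + 1) / (unit φ - q)) := by
    intro φ
    have hu := unit_ne_zero φ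
    have hup : unit φ - p ≠ 0 := fun h0 => hp1 (by rw [← sub_eq_zero.1 h0, norm_unit])
    have huq : unit φ - q ≠ 0 := fun h0 => hq1 (by rw [← sub_eq_zero.1 h0, norm_unit])
    have e1 : X / (X - unit φ * Y) = -p / (unit φ - p) := by
      have h1 : X - unit φ * Y ≠ 0 := by
        intro h0
        apply hup
        rw [hp, sub_eq_zero, eq_div_iff hY]
        exact (sub_eq_zero.1 h0).symm
      rw [div_eq_div_iff h1 hup, hp]
      field_simp
      ring
    have e2 : (starRingEnd ℂ) (X / (X - unit φ * Y)) = unit φ / (unit φ - q) := by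
      rw [map_div₀, map_sub, map_mul, conj_unit]
      have h1 : (starRingEnd ℂ) X - (unit φ)⁻¹ * (starRingEnd ℂ) Y ≠ 0 := by
        intro h0
        apply huq
        rw [hq, sub_eq_zero, eq_div_iff hcX]
        have := sub_eq_zero.1 h0
        rw [this]
        field_simp
      rw [div_eq_div_iff h1 huq, hq]
      field_simp
    have e3 : ((X / (X - unit φ * Y)).im : ℂ) = (2 * Complex.I)⁻¹ *
        (X / (X - unit φ * Y) - (starRingEnd ℂ) (X / (X - unit φ * Y))) := by
      rw [Complex.im_eq_sub_conj, div_eq_inv_mul]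
    rw [e3, e2, e1]
    field_simp
    ring
  simp only [key]
  rw [intervalIntegral.integral_add ((integrable_unit_div hp1 _).const_mul _)
      ((integrable_unit_div hq1 _).const_mul _), intervalIntegral.integral_const_mul,
    intervalIntegral.integral_const_mul]
  have hI : (2 * Complex.I)⁻¹ * (-(2 * Real.pi)) = Real.pi * Complex.I := by
    rw [mul_inv, Complex.inv_I]
    ring
  rcases lt_or_gt_of_ne hXY with h | h
  · have h1 : ‖p‖ < 1 := by rwa [hpn, div_lt_one hY']
    have h2 : 1 < ‖q‖ := by rwa [hqn, one_lt_div hX']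
    rw [integral_unit_pow_div_of_lt h1, integral_unit_pow_div_of_gt h2, mul_zero, add_zero, radialKernel,
      min_eq_left h.le, max_eq_right h.le, ← hI]
    push_cast
    rw [hp]
    simp only [div_pow, pow_succ]
    field_simp
  · have h1 : 1 < ‖p‖ := by rwa [hpn, one_lt_div hY']
    have h2 : ‖q‖ < 1 := by rwa [hqn, div_lt_one hX']
    rw [integral_unit_pow_div_of_gt h1, integral_unit_pow_div_of_lt h2, mul_zero, zero_add, radialKernel,
      min_eq_right h.le, max_eq_left h.le, ← hI]
    -- here `q = Ȳ / X̄` is rewritten by means of `X X̄ = |X|²` and `Y Ȳ = |Y|²`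
    have h3 : q * (Y / ‖Y‖) = (‖Y‖ / ‖X‖ : ℝ) * (X / ‖X‖) := by
      have a1 := Complex.mul_conj' X
      have a2 := Complex.mul_conj' Y
      rw [hq]
      push_cast
      field_simp
      linear_combination (‖X‖ : ℂ) ^ 2 * a2 - (‖Y‖ : ℂ) ^ 2 * a1
    have h4 := congrArg (fun w : ℂ => w ^ (n + 1)) h3
    simp only [mul_pow] at h4
    push_cast at h4 ⊢
    linear_combination (2 * Complex.I)⁻¹ * (-(2 * Real.pi)) * h4

/-- The correction of the kernel does not contribute to the angular modes `m ≥ 2`. -/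
theorem integral_im_div_mul_unit_pow' {X Y : ℂ} {m : ℕ} (hm : 2 ≤ m) :
    ∫ φ in (0 : ℝ)..2 * Real.pi, ((X / (unit φ * Y)).im : ℂ) * (unit φ * (Y / ‖Y‖)) ^ m = 0 := by
  obtain ⟨n, rfl⟩ : ∃ n, m = n + 2 := ⟨m - 2, by omega⟩
  have key : ∀ φ : ℝ, ((X / (unit φ * Y)).im : ℂ) * (unit φ * (Y / ‖Y‖)) ^ (n + 2) =
      (Y / ‖Y‖) ^ (n + 2) * (2 * Complex.I)⁻¹ * (X / Y) * unit φ ^ (n + 1) +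
      (Y / ‖Y‖) ^ (n + 2) * (2 * Complex.I)⁻¹ * (-(starRingEnd ℂ) (X / Y)) *
        unit φ ^ (n + 2 + 1) := by
    intro φ
    have hu := unit_ne_zero φ
    have e2 : (starRingEnd ℂ) (X / (unit φ * Y)) = unit φ * (starRingEnd ℂ) (X / Y) := by
      simp only [map_div₀, map_mul, conj_unit]
      rw [mul_comm, div_mul_eq_div_div_swap, div_inv_eq_mul]
      ring
    have e1 : X / (unit φ * Y) = X / Y * (unit φ)⁻¹ := by
      rw [mul_comm, div_mul_eq_div_div, div_eq_mul_inv _ (unit φ)]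
    rw [Complex.im_eq_sub_conj, e2, e1, mul_pow]
    field_simp
    ring
  simp only [key]
  rw [intervalIntegral.integral_add, intervalIntegral.integral_const_mul,
    intervalIntegral.integral_const_mul, integral_unit_pow, integral_unit_pow]
  · simp
  · exact (continuous_const.mul (continuous_unit.pow _)).intervalIntegrable _ _
  · exact (continuous_const.mul (continuous_unit.pow _)).intervalIntegrable _ _

/-- Integration over the plane by averaging over rotations. -/
theorem integral_eq_integral_rot {F : Plane → ℂ} (hF : Integrable F) :
    ∫ y, F y = (2 * Real.pi)⁻¹ * ∫ y, ∫ φ in (0 : ℝ)..2 * Real.pi, F (rot φ y) := by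
  have hpi : (0 : ℝ) ≤ 2 * Real.pi := by positivity
  let ν : Measure ℝ := volume.restrict (Set.Ioc 0 (2 * Real.pi))
  have hmp : MeasurePreserving (fun p : ℝ × Plane => (p.1, rot p.1 p.2)) (ν.prod volume)
      (ν.prod volume) :=
    (MeasurePreserving.id ν).skew_product (g := fun φ y => rot φ y)
      (Measurable.rot measurable_fst measurable_snd)
      (Eventually.of_forall fun φ => (measurePreserving_rot φ).map_eq)
  have hint : Integrable (fun p : ℝ × Plane => F (rot p.1 p.2)) (ν.prod volume) :=
    hmp.integrable_comp_of_integrable (g := fun p : ℝ × Plane => F p.2) (hF.comp_snd ν)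
  have h1 : ∫ y, ∫ φ in (0 : ℝ)..2 * Real.pi, F (rot φ y) = ∫ φ, (∫ y, F (rot φ y)) ∂ν := by
    rw [integral_integral_swap (f := fun (φ : ℝ) y => F (rot φ y)) hint]
    simp only [intervalIntegral.integral_of_le hpi]
    rfl
  have h2 : ∀ φ : ℝ, ∫ y, F (rot φ y) = ∫ y, F y := fun φ =>
    (measurePreserving_rot φ).integral_comp (rotL φ).toHomeomorph.measurableEmbedding F
  rw [h1]
  simp only [h2, ν]
  rw [setIntegral_const, Real.volume_real_Ioc_of_le hpi, sub_zero, Complex.real_smul, ← mul_assoc]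
  push_cast
  have : (Real.pi : ℂ) ≠ 0 := by exact_mod_cast Real.pi_ne_zero
  field_simp

/-- Integration of radial functions in polar coordinates. -/
theorem integral_radial (h : ℝ → ℂ) :
    ∫ y : Plane, h ‖y‖ = 2 * Real.pi * ∫ s in Set.Ioi (0 : ℝ), s * h s := by
  rw [integral_fun_norm_addHaar (volume : Measure Plane) h]
  have h1 : (volume : Measure Plane).real (Metric.ball 0 1) = Real.pi := by
    rw [Measure.real, EuclideanSpace.volume_ball_fin_two]
    simp [Real.pi_pos.le]
  rw [h1]
  simp [Complex.real_smul, mul_assoc]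

/-- The function `e^{imθ}` on the plane. -/
noncomputable def angularMode (m : ℕ) (x : Plane) : ℂ := (toC x / ‖x‖) ^ m

theorem angularMode_rot (m : ℕ) (φ : ℝ) (x : Plane) :
    angularMode m (rot φ x) = unit φ ^ m * angularMode m x := by
  rw [angularMode, angularMode, toC_rot, norm_rot, ← mul_pow, unit, mul_div_assoc]

/-- The radial velocity induced by a vorticity on the `m`-th angular mode. -/
theorem integral_dot_symKernel {m : ℕ} (hm : 2 ≤ m) {w : ℝ → ℂ} {x : Plane} (hx : x ≠ 0)
    (hint : Integrable fun y => ((x 0 * symKernel x y 0 + x 1 * symKernel x y 1 : ℝ) : ℂ) *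
      (angularMode m y * w ‖y‖)) :
    ∫ y, ((x 0 * symKernel x y 0 + x 1 * symKernel x y 1 : ℝ) : ℂ) * (angularMode m y * w ‖y‖) =
      Complex.I / 2 * angularMode m x *
        ∫ s in Set.Ioi (0 : ℝ), s * (radialKernel m ‖x‖ s * w s) := by
  have hpi : (Real.pi : ℂ) ≠ 0 := by exact_mod_cast Real.pi_ne_zero
  have hX := toC_ne_zero hx
  have hdot : ∀ y, (x 0 * symKernel x y 0 + x 1 * symKernel x y 1 : ℝ) = (2 * Real.pi)⁻¹ *
      ((toC x / (toC x - toC y)).im + if 2 * ‖x‖ ≤ ‖y‖ then (toC x / toC y).im else 0) := by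
    intro y
    have h1 := dot_biotSavartKernel x (x - y)
    have h2 := dot_biotSavartKernel x y
    rw [toC_sub] at h1
    unfold symKernel
    split_ifs
    · simp only [PiLp.add_apply]
      linear_combination h1 + h2
    · simp only [add_zero]
      exact h1
  have hmain : ∀ᵐ y : Plane, ∫ φ in (0 : ℝ)..2 * Real.pi,
      ((x 0 * symKernel x (rot φ y) 0 + x 1 * symKernel x (rot φ y) 1 : ℝ) : ℂ) *
        (angularMode m (rot φ y) * w ‖rot φ y‖) =
      Complex.I / 2 * angularMode m x * (radialKernel m ‖x‖ ‖y‖ * w ‖y‖) := by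
    have hs : ∀ᵐ y : Plane, ‖y‖ ≠ ‖x‖ := by
      rw [ae_iff]
      have := Measure.addHaar_sphere (volume : Measure Plane) 0 ‖x‖
      convert this using 2
      ext y
      simp
    have h0 : ∀ᵐ y : Plane, y ≠ 0 := by
      rw [ae_iff]
      simp
    filter_upwards [hs, h0] with y hy hy0
    have hY := toC_ne_zero hy0
    have hXY : ‖toC x‖ ≠ ‖toC y‖ := by
      rw [norm_toC, norm_toC]
      exact hy.symm
    have e1 := integral_im_div_mul_unit_pow hX hY hXY (m := m) (by omega)
    have e2 := integral_im_div_mul_unit_pow' (X := toC x) (Y := toC y) hm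
    have c1 : IntervalIntegrable (fun φ : ℝ => ((toC x / (toC x - unit φ * toC y)).im : ℂ) *
        (unit φ * (toC y / ‖toC y‖)) ^ m) volume 0 (2 * Real.pi) := by
      refine Continuous.intervalIntegrable ?_ _ _
      refine (Complex.continuous_ofReal.comp (Complex.continuous_im.comp (continuous_const.div
        (continuous_const.sub (continuous_unit.mul continuous_const)) fun φ h => hXY ?_))).mul
        ((continuous_unit.mul continuous_const).pow m)
      have h' : toC x - unit φ * toC y = 0 := h
      rw [sub_eq_zero.1 h', norm_mul, norm_unit, one_mul]
    have c2 : IntervalIntegrable (fun φ : ℝ => ((toC x / (unit φ * toC y)).im : ℂ) *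
        (unit φ * (toC y / ‖toC y‖)) ^ m) volume 0 (2 * Real.pi) := by
      refine Continuous.intervalIntegrable ?_ _ _
      exact (Complex.continuous_ofReal.comp (Complex.continuous_im.comp (continuous_const.div
        (continuous_unit.mul continuous_const) fun φ => mul_ne_zero (unit_ne_zero φ) hY))).mul
        ((continuous_unit.mul continuous_const).pow m)
    let χ : ℂ := if 2 * ‖x‖ ≤ ‖y‖ then 1 else 0
    have e3 : ∀ φ : ℝ, ((x 0 * symKernel x (rot φ y) 0 + x 1 * symKernel x (rot φ y) 1 : ℝ) : ℂ) *
        (angularMode m (rot φ y) * w ‖rot φ y‖) =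
        (2 * Real.pi)⁻¹ * w ‖y‖ * (((toC x / (toC x - unit φ * toC y)).im : ℂ) *
          (unit φ * (toC y / ‖toC y‖)) ^ m) +
        (2 * Real.pi)⁻¹ * w ‖y‖ * χ * (((toC x / (unit φ * toC y)).im : ℂ) *
          (unit φ * (toC y / ‖toC y‖)) ^ m) := by
      intro φ
      have h1 : angularMode m (rot φ y) = (unit φ * (toC y / ‖toC y‖)) ^ m := by
        rw [angularMode_rot, angularMode, norm_toC, mul_pow]
      have h2 : toC (rot φ y) = unit φ * toC y := toC_rot φ y
      rw [hdot, h1, norm_rot, h2]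
      simp only [χ]
      split_ifs <;> push_cast <;> ring
    simp only [e3]
    rw [intervalIntegral.integral_add (c1.const_mul _) (c2.const_mul _),
      intervalIntegral.integral_const_mul, intervalIntegral.integral_const_mul, e1, e2, norm_toC,
      norm_toC, angularMode]
    push_cast
    field_simp
    ring
  rw [integral_eq_integral_rot hint, integral_congr_ae hmain, integral_const_mul,
    integral_radial (fun s => radialKernel m ‖x‖ s * w s)]
  push_cast
  field_simp

end Angular

/-! ### Eigenfunctions on one angular mode -/

section Eigenfunction

variable {m : ℕ} {α : ℝ} {g : ℝ → ℝ}

/-- On the `m`-th angular mode the transport operator is the multiplication by `-i m a`. -/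
theorem transport_of_mode {a : Plane → ℝ} (hc : Continuous a) (ha : ∀ θ x, a (rot θ x) = a x)
    {w : Plane → ℂ} (hw : ∀ φ x, w (rot φ x) = unit φ ^ m * w x) {f h : L2}
    (hf : f =ᵐ[volume] w) (hh : h =ᵐ[volume] fun x => -(Complex.I * m * a x) * w x) :
    transport a f h := by
  intro φ hφ hφc
  have h1 := hasDerivAt_integral_mul_pull hc ha hφ hφc f 0
  have h0 : pull hc.measurable ha 0 f = f := by
    refine Lp.ext ?_
    filter_upwards [coeFn_pull hc.measurable ha 0 f] with x hx
    rw [hx, neg_zero, flow_zero]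
  rw [h0] at h1
  have hpull : ∀ t : ℝ, ∫ x, (φ x : ℂ) * pull hc.measurable ha t f x =
      ∫ x, Complex.exp (-(Complex.I * m * a x) * t) * ((φ x : ℂ) * f x) := by
    intro t
    refine integral_congr_ae ?_
    have hfl := (measurePreserving_flow hc.measurable ha (-t)).quasiMeasurePreserving.ae hf
    filter_upwards [coeFn_pull hc.measurable ha t f, hfl, hf] with x e1 e2 e3
    have e4 : unit (-t * a x) ^ m = Complex.exp (-(Complex.I * m * a x) * t) := by
      rw [unit, ← Complex.exp_nat_mul]
      congr 1
      push_cast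
      ring
    rw [e1, e2, e3, flow, hw, e4]
    ring
  simp only [hpull] at h1
  have hint := integrable_test_mul hφ.continuous hφc (Lp.memLp f)
  have hφa : Continuous fun x => φ x * a x := hφ.continuous.mul hc
  have hφac : HasCompactSupport fun x => φ x * a x := hφc.mul_right
  have hint' := (integrable_test_mul hφa hφac (Lp.memLp f)).norm.const_mul (m : ℝ)
  have hE : ∀ t : ℝ, Continuous fun x => Complex.exp (-(Complex.I * m * a x) * t) := fun t => by
    fun_prop
  have hE1 : ∀ (t : ℝ) x, ‖Complex.exp (-(Complex.I * m * a x) * t)‖ = 1 := fun t x => by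
    rw [Complex.norm_exp]
    simp
  have hmeas : ∀ t : ℝ, AEStronglyMeasurable
      (fun x => Complex.exp (-(Complex.I * m * a x) * t) * ((φ x : ℂ) * f x)) volume := fun t =>
    (hE t).aestronglyMeasurable.mul hint.aestronglyMeasurable
  have h2 := (hasDerivAt_integral_of_dominated_loc_of_deriv_le (x₀ := (0 : ℝ)) (μ := volume)
    (F := fun (t : ℝ) x => Complex.exp (-(Complex.I * m * a x) * t) * ((φ x : ℂ) * f x))
    (F' := fun (t : ℝ) x => Complex.exp (-(Complex.I * m * a x) * t) * (-(Complex.I * m * a x)) *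
      ((φ x : ℂ) * f x))
    (bound := fun x => m * ‖((φ x * a x : ℝ) : ℂ) * f x‖)
    univ_mem (Eventually.of_forall hmeas) (by simpa using hint) ?_ ?_ hint' ?_).2
  · have h3 := h1.unique h2
    rw [h3]
    refine integral_congr_ae ?_
    filter_upwards [hf, hh] with x e1 e2
    rw [e2, e1]
    simp
    ring
  · exact ((hE 0).aestronglyMeasurable.mul
      (by fun_prop : Continuous fun x => -(Complex.I * m * a x)).aestronglyMeasurable).mul
      hint.aestronglyMeasurable
  · refine Eventually.of_forall fun x t _ => le_of_eq ?_
    rw [norm_mul, norm_mul, hE1]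
    simp
    ring
  · refine Eventually.of_forall fun x t _ => ?_
    have h3 : HasDerivAt (fun t : ℝ => -(Complex.I * m * a x) * (t : ℂ)) (-(Complex.I * m * a x)) t := by
      simpa using (Complex.ofRealCLM.hasDerivAt (x := t)).const_mul (-(Complex.I * m * a x))
    exact h3.cexp.mul_const _

theorem fderiv_vorticity_apply (hg : IsProfile α g) {x : Plane} (hx : x ≠ 0) (v : Plane) :
    fderiv ℝ (vorticity g) x v = deriv g ‖x‖ / ‖x‖ * (x 0 * v 0 + x 1 * v 1) := by
  have hr : 0 < ‖x‖ := norm_pos_iff.2 hx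
  have hn : DifferentiableAt ℝ (norm : Plane → ℝ) x :=
    (contDiffAt_norm ℝ hx (n := 1)).differentiableAt (by simp)
  have h1 : HasDerivAt g (deriv g ‖x‖) ‖x‖ :=
    ((hg.smooth.contDiffAt (Ici_mem_nhds hr)).differentiableAt (by simp)).hasDerivAt
  have h2 := (h1.comp_hasFDerivAt x hn.hasFDerivAt).fderiv
  have h3 : fderiv ℝ (vorticity g) x = deriv g ‖x‖ • fderiv ℝ (norm : Plane → ℝ) x := h2
  have h4 : HasFDerivAt (fun y : Plane => ‖y‖ ^ 2) _ x := hn.hasFDerivAt.pow 2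
  have h5 := h4.unique (HasStrictFDerivAt.hasFDerivAt (hasStrictFDerivAt_norm_sq x))
  have h6 := congrArg (fun L : Plane →L[ℝ] ℝ => L v) h5
  have h7 : ‖x‖ * fderiv ℝ (norm : Plane → ℝ) x v = x 0 * v 0 + x 1 * v 1 := by
    simp [PiLp.inner_apply, Fin.sum_univ_two] at h6
    linarith
  rw [h3, ← h7, smul_apply, smul_eq_mul]
  field_simp

theorem exists_abs_deriv_le (hα : 0 < α) (hα1 : α < 1) (hg : IsProfile α g) :
    ∃ C, ∀ x : Plane, x ≠ 0 → |deriv g ‖x‖| ≤ C * (1 + ‖x‖) ^ (-(1 + α)) := by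
  obtain ⟨C, hC⟩ := exists_norm_fderiv_vorticity_le hα hα1 hg
  refine ⟨C, fun x hx => ?_⟩
  have hr : 0 < ‖x‖ := norm_pos_iff.2 hx
  have h1 := (fderiv ℝ (vorticity g) x).le_opNorm x
  have h2 : fderiv ℝ (vorticity g) x x = deriv g ‖x‖ * ‖x‖ := by
    rw [fderiv_vorticity_apply hg hx, ← pow_two, ← pow_two, ← norm_sq_plane]
    field_simp
  rw [h2, norm_mul, norm_norm, Real.norm_eq_abs] at h1
  exact (le_of_mul_le_mul_right h1 hr).trans (hC x)

/-- The radial factor `g' ψ / (r (ζ - c))` of the vorticity with the stream function `ψ(r) e^{imθ}`. -/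
noncomputable def modeAmplitude (g : ℝ → ℝ) (c : ℂ) (ψ : ℝ → ℂ) (r : ℝ) : ℂ :=
  deriv g r * ψ r / (r * (zeta g r - c))

theorem le_norm_ofReal_sub (t : ℝ) (c : ℂ) : |c.im| ≤ ‖(t : ℂ) - c‖ := by
  have := Complex.abs_im_le_norm ((t : ℂ) - c)
  simpa using this

/-- The vorticity of an unstable mode is in `L²`. Near the origin it vanishes with `g'`, and at infinity
`g'` decays like `r^{-1-α}`. -/
theorem memLp_mode (hα : 0 < α) (hα1 : α < 1) (hg : IsProfile α g) {δ : ℝ} (hδ : 0 < δ)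
    (hgδ : ∀ r, 0 < r → r < δ → deriv g r = 0) {c : ℂ} (hc : c.im ≠ 0) {ψ : ℝ → ℂ}
    (hψ : Continuous ψ) {M : ℝ} (hM : ∀ r, ‖ψ r‖ ≤ M) :
    MemLp (fun x : Plane => angularMode m x * modeAmplitude g c ψ ‖x‖) 2 volume := by
  obtain ⟨C, hC⟩ := exists_abs_deriv_le hα hα1 hg
  have hM0 : 0 ≤ M := (norm_nonneg _).trans (hM 0)
  have hmeas : Measurable fun x : Plane => angularMode m x * modeAmplitude g c ψ ‖x‖ := by
    have h1 : (fun x : Plane => angularMode m x * modeAmplitude g c ψ ‖x‖) = fun x : Plane =>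
        (toC x / ‖x‖) ^ m * (deriv g ‖x‖ * ψ ‖x‖ / (‖x‖ * (angularVelocity g x - c))) := by
      ext x
      by_cases hx : x = 0
      · simp [hx, modeAmplitude]
      · simp [angularMode, modeAmplitude, angularVelocity, hx]
    rw [h1]
    have m1 := continuous_toC.measurable
    have m2 := hg.contDiff_angularVelocity.continuous.measurable
    have m3 : Measurable fun x : Plane => deriv g ‖x‖ := (measurable_deriv g).comp measurable_norm
    have m4 : Measurable fun x : Plane => ψ ‖x‖ := hψ.measurable.comp measurable_norm
    fun_prop
  have hbound : ∀ x : Plane, ‖angularMode m x * modeAmplitude g c ψ ‖x‖‖ ≤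
      |C| * M / (δ * |c.im|) * (1 + ‖x‖) ^ (-(1 + α)) := by
    intro x
    have hpos : 0 < |c.im| := abs_pos.2 hc
    have hR : 0 ≤ |C| * M / (δ * |c.im|) * (1 + ‖x‖) ^ (-(1 + α)) := by positivity
    by_cases hx : x = 0
    · simpa [hx, modeAmplitude] using hR
    have hr : 0 < ‖x‖ := norm_pos_iff.2 hx
    rcases lt_or_ge ‖x‖ δ with h | h
    · simpa [modeAmplitude, hgδ _ hr h] using hR
    have h1 : ‖angularMode m x‖ ≤ 1 := by
      rw [angularMode, norm_pow, norm_div, norm_toC, Complex.norm_real, norm_norm, div_self hr.ne',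
        one_pow]
    have h2 : ‖modeAmplitude g c ψ ‖x‖‖ ≤ (|C| * (1 + ‖x‖) ^ (-(1 + α))) * M / (δ * |c.im|) := by
      rw [modeAmplitude, norm_div, norm_mul, norm_mul, Complex.norm_real, Complex.norm_real,
        norm_norm, Real.norm_eq_abs]
      have h3 : |deriv g ‖x‖| ≤ |C| * (1 + ‖x‖) ^ (-(1 + α)) :=
        (hC x hx).trans (mul_le_mul_of_nonneg_right (le_abs_self C) (by positivity))
      have h4 := le_norm_ofReal_sub (zeta g ‖x‖) c
      have h5 := hM ‖x‖
      gcongr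
    calc _ ≤ 1 * ((|C| * (1 + ‖x‖) ^ (-(1 + α))) * M / (δ * |c.im|)) := by
          rw [norm_mul]
          exact mul_le_mul h1 h2 (norm_nonneg _) zero_le_one
      _ = _ := by ring
  refine (memLp_two_iff_integrable_sq_norm hmeas.aestronglyMeasurable).2 ?_
  have h1 : Integrable fun x : Plane => (1 + ‖x‖) ^ (-(2 * (1 + α))) :=
    integrable_one_add_norm (by simp; linarith)
  refine (h1.const_mul ((|C| * M / (δ * |c.im|)) ^ 2)).mono' (hmeas.norm.pow_const 2).aestronglyMeasurable
    (Eventually.of_forall fun x => ?_)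
  rw [Real.norm_of_nonneg (by positivity)]
  calc _ ≤ (|C| * M / (δ * |c.im|) * (1 + ‖x‖) ^ (-(1 + α))) ^ 2 := by
        gcongr
        exact hbound x
    _ = _ := by
      rw [mul_pow, ← Real.rpow_natCast ((1 + ‖x‖) ^ (-(1 + α))), ← Real.rpow_mul (by positivity)]
      congr 2
      push_cast
      ring

/-- A solution `ψ` of the integral form of Rayleigh's equation on the `m`-th angular mode yields the
point `-i m c` of the spectrum of the linearized operator. -/
theorem mem_spec_of_rayleigh (hα : 0 < α) (hα1 : α < 1) (hm : 2 ≤ m) (hg : IsProfile α g) {δ : ℝ}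
    (hδ : 0 < δ) (hgδ : ∀ r, 0 < r → r < δ → deriv g r = 0) {c : ℂ} (hc : c.im ≠ 0) {ψ : ℝ → ℂ}
    (hψ : Continuous ψ) {M : ℝ} (hM : ∀ r, ‖ψ r‖ ≤ M) {r₀ : ℝ} (hr₀ : 0 < r₀) (hψ0 : ψ r₀ ≠ 0)
    (heq : ∀ r, 0 < r → ψ r = -(1 / (2 * m)) * ∫ s in Set.Ioi (0 : ℝ),
      (radialKernel m r s : ℂ) * (deriv g s * (ψ s / (zeta g s - c)))) :
    -(Complex.I * m * c) ∈ spec (Lst m g) := by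
  have hm0 : (m : ℂ) ≠ 0 := by
    have : m ≠ 0 := by omega
    exact_mod_cast this
  have hζ : ∀ r, (zeta g r : ℂ) - c ≠ 0 := fun r h0 => hc (by
    have := congrArg Complex.im h0
    simpa using this)
  set w : Plane → ℂ := fun x => angularMode m x * modeAmplitude g c ψ ‖x‖ with hw
  have hwL : MemLp w 2 volume := memLp_mode hα hα1 hg hδ hgδ hc hψ hM
  have hwrot : ∀ φ x, w (rot φ x) = unit φ ^ m * w x := fun φ x => by
    simp only [hw, angularMode_rot, norm_rot]
    ring
  set f : L2 := hwL.toLp w with hf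
  have hfw : f =ᵐ[volume] w := hwL.coeFn_toLp
  have hfm : f ∈ L2m m := by
    change ∀ᵐ x, f (rot (2 * Real.pi / m) x) = f x
    filter_upwards [hfw, (measurePreserving_rot (2 * Real.pi / m)).quasiMeasurePreserving.ae hfw]
      with x e1 e2
    rw [e2, e1, hwrot]
    have : unit (2 * Real.pi / m) ^ m = 1 := by
      rw [unit, ← Complex.exp_nat_mul]
      push_cast
      rw [show (m : ℂ) * (2 * Real.pi / m * Complex.I) = 2 * Real.pi * Complex.I by field_simp,
        Complex.exp_two_pi_mul_I]
    rw [this, one_mul]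
  -- the stream function is recovered from the vorticity
  have hrec : ∀ r, 0 < r → ∫ s in Set.Ioi (0 : ℝ), s * (radialKernel m r s * modeAmplitude g c ψ s) =
      -(2 * m) * ψ r := by
    intro r hr
    rw [heq r hr, ← mul_assoc]
    have h1 : -(2 * (m : ℂ)) * -(1 / (2 * m)) = 1 := by field_simp
    rw [h1, one_mul]
    refine setIntegral_congr_fun measurableSet_Ioi fun s hs => ?_
    have hs0 : (s : ℂ) ≠ 0 := by
      have : (0 : ℝ) < s := hs
      exact_mod_cast this.ne'
    have := hζ s
    simp only [modeAmplitude]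
    field_simp
  have hf0 : f ≠ 0 := by
    intro h0
    rw [h0] at hfw
    have hae : ∀ᵐ y : Plane, radialKernel m r₀ ‖y‖ * modeAmplitude g c ψ ‖y‖ = 0 := by
      have hy0 : ∀ᵐ y : Plane, y ≠ 0 := by
        rw [ae_iff]
        simp
      filter_upwards [hfw, Lp.coeFn_zero ℂ 2 (volume : Measure Plane), hy0] with y e1 e2 e3
      have e4 : w y = 0 := by
        rw [← e1, e2]
        rfl
      have e5 : angularMode m y ≠ 0 := by
        rw [angularMode]
        refine pow_ne_zero _ (div_ne_zero (toC_ne_zero e3) ?_)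
        exact_mod_cast (norm_ne_zero_iff.2 e3)
      rw [(mul_eq_zero.1 e4).resolve_left e5, mul_zero]
    have h1 := integral_radial fun s => radialKernel m r₀ s * modeAmplitude g c ψ s
    rw [integral_congr_ae hae, integral_zero, hrec r₀ hr₀] at h1
    have hpi : (Real.pi : ℂ) ≠ 0 := by exact_mod_cast Real.pi_ne_zero
    have h2 : (2 * Real.pi * (-(2 * m)) : ℂ) * ψ r₀ = 0 := by rw [h1]; ring
    exact (mul_ne_zero (by simp [hpi, hm0]) hψ0) h2
  obtain ⟨T, -, hT⟩ := exists_advectOp hα hα1 hg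
  have hTf : T f =ᵐ[volume] fun x =>
      Complex.I * m * (angularVelocity g x - c) * w x := by
    have hint : ∀ᵐ x, ∀ i, Integrable fun y => (symKernel x y i : ℂ) * f y := by
      rw [ae_all_iff]
      exact fun i => integrable_symKernel_mul f i
    have hx0 : ∀ᵐ x : Plane, x ≠ 0 := by
      rw [ae_iff]
      simp
    filter_upwards [hT f, hint, hx0] with x e1 e2 e3
    have hr : 0 < ‖x‖ := norm_pos_iff.2 e3
    have hi : Integrable fun y => ((x 0 * symKernel x y 0 + x 1 * symKernel x y 1 : ℝ) : ℂ) *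
        (angularMode m y * modeAmplitude g c ψ ‖y‖) := by
      refine (((e2 0).const_mul (x 0 : ℂ)).add ((e2 1).const_mul (x 1 : ℂ))).congr ?_
      filter_upwards [hfw] with y hy
      simp only [Pi.add_apply, hy, hw]
      push_cast
      ring
    have h1 : ∫ y, ((fderiv ℝ (vorticity g) x (symKernel x y) : ℝ) : ℂ) * f y =
        (deriv g ‖x‖ / ‖x‖ : ℝ) * ∫ y, ((x 0 * symKernel x y 0 + x 1 * symKernel x y 1 : ℝ) : ℂ) *
        (angularMode m y * modeAmplitude g c ψ ‖y‖) := by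
      rw [← integral_const_mul]
      refine integral_congr_ae ?_
      filter_upwards [hfw] with y hy
      rw [hy, fderiv_vorticity_apply hg e3]
      push_cast
      ring
    rw [e1, advect_symVelocity e2, h1, integral_dot_symKernel hm e3 hi, hrec _ hr]
    have h2 : angularVelocity g x = zeta g ‖x‖ := by simp [angularVelocity, e3]
    have h3 := hζ ‖x‖
    have h4 : (‖x‖ : ℂ) ≠ 0 := by exact_mod_cast hr.ne'
    simp only [hw, modeAmplitude, h2]
    push_cast
    field_simp
  have htr : transport (angularVelocity g) f ((-(Complex.I * m * c)) • f - T f) := by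
    refine transport_of_mode hg.contDiff_angularVelocity.continuous (angularVelocity_rot g) hwrot
      hfw ?_
    filter_upwards [Lp.coeFn_sub ((-(Complex.I * m * c)) • f) (T f), hTf,
      Lp.coeFn_smul (-(Complex.I * m * c)) f, hfw] with x e1 e2 e3 e4
    rw [e1, Pi.sub_apply, e2, e3, Pi.smul_apply, e4, smul_eq_mul]
    ring
  rintro ⟨B, hB⟩
  have h1 : Lst m g ⟨f, hfm⟩ ((-(Complex.I * m * c)) • (⟨f, hfm⟩ : L2m m)) :=
    (Lst_iff hm hT _ _).2 htr
  have h2 := (hB _ _).1 h1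
  rw [sub_self, map_zero] at h2
  exact hf0 (congrArg Subtype.val h2.symm)

end Eigenfunction

/-! ### A vortex with two thin rings of vorticity gradient -/

section Step

/-- A smooth step of height `1` on the interval `[b, b + ε]`. -/
noncomputable def smoothStep (ε b r : ℝ) : ℝ := Real.smoothTransition ((r - b) / ε)

variable {ε b : ℝ}

theorem contDiff_smoothStep (ε b : ℝ) {n : ℕ∞} : ContDiff ℝ n (smoothStep ε b) :=
  Real.smoothTransition.contDiff.comp ((contDiff_id.sub contDiff_const).div_const ε)

theorem smoothStep_eq_zero (hε : 0 < ε) {r : ℝ} (hr : r ≤ b) : smoothStep ε b r = 0 :=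
  Real.smoothTransition.zero_of_nonpos (div_nonpos_of_nonpos_of_nonneg (by linarith) hε.le)

theorem smoothStep_eq_one (hε : 0 < ε) {r : ℝ} (hr : b + ε ≤ r) : smoothStep ε b r = 1 :=
  Real.smoothTransition.one_of_one_le (by rw [le_div_iff₀ hε]; linarith)

theorem smoothStep_nonneg (ε b r : ℝ) : 0 ≤ smoothStep ε b r := Real.smoothTransition.nonneg _

theorem smoothStep_le_one (ε b r : ℝ) : smoothStep ε b r ≤ 1 := Real.smoothTransition.le_one _

theorem monotone_smoothStep (hε : 0 < ε) (b : ℝ) : Monotone (smoothStep ε b) := fun r s h =>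
  Real.smoothTransition.monotone (by gcongr)

theorem deriv_smoothStep_nonneg (hε : 0 < ε) (r : ℝ) : 0 ≤ deriv (smoothStep ε b) r :=
  (monotone_smoothStep hε b).deriv_nonneg

theorem deriv_smoothStep_of_le (hε : 0 < ε) {r : ℝ} (hr : r ≤ b) : deriv (smoothStep ε b) r = 0 := by
  refine IsLocalMin.deriv_eq_zero (Eventually.of_forall fun s => ?_)
  rw [smoothStep_eq_zero hε hr]
  exact smoothStep_nonneg ε b s

theorem deriv_smoothStep_of_ge (hε : 0 < ε) {r : ℝ} (hr : b + ε ≤ r) :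
    deriv (smoothStep ε b) r = 0 := by
  refine IsLocalMax.deriv_eq_zero (Eventually.of_forall fun s => ?_)
  rw [smoothStep_eq_one hε hr]
  exact smoothStep_le_one ε b s

theorem continuous_deriv_smoothStep (ε b : ℝ) : Continuous (deriv (smoothStep ε b)) :=
  (contDiff_smoothStep ε b (n := 1)).continuous_deriv (by simp)

theorem integral_deriv_smoothStep (hε : 0 < ε) :
    ∫ r in Set.Ioc b (b + ε), deriv (smoothStep ε b) r = 1 := by
  rw [← intervalIntegral.integral_of_le (by linarith), intervalIntegral.integral_deriv_eq_sub
    (fun r _ => (contDiff_smoothStep ε b (n := 1)).differentiable (by simp) r)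
    ((continuous_deriv_smoothStep ε b).intervalIntegrable _ _), smoothStep_eq_one hε le_rfl,
    smoothStep_eq_zero hε le_rfl, sub_zero]

/-- The first moment of a smooth step differs little from the one of a sharp step. -/
theorem abs_integral_smoothStep_sub_le (hε : 0 < ε) (hb : 0 < b) {r : ℝ} (hr0 : 0 ≤ r)
    (hr : r ≤ 2) :
    |(∫ ρ in (0 : ℝ)..r, ρ * smoothStep ε b ρ) - max (r ^ 2 - b ^ 2) 0 / 2| ≤ 2 * ε := by
  have hc : Continuous fun ρ => ρ * smoothStep ε b ρ :=
    continuous_id.mul (contDiff_smoothStep ε b (n := 0)).continuous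
  have hc' : Continuous fun ρ => ρ * (1 - smoothStep ε b ρ) :=
    continuous_id.mul (continuous_const.sub (contDiff_smoothStep ε b (n := 0)).continuous)
  have hzero : ∀ t, 0 ≤ t → t ≤ b → ∫ ρ in (0 : ℝ)..t, ρ * smoothStep ε b ρ = 0 := by
    intro t ht htb
    refine intervalIntegral.integral_zero_ae (Eventually.of_forall fun ρ hρ => ?_)
    rw [Set.uIoc_of_le ht] at hρ
    rw [smoothStep_eq_zero hε (hρ.2.trans htb), mul_zero]
  rcases le_or_gt r b with h | h
  · rw [hzero r hr0 h, max_eq_right (by nlinarith)]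
    simpa using hε.le
  have h1 : ∫ ρ in (0 : ℝ)..r, ρ * smoothStep ε b ρ =
      (r ^ 2 - b ^ 2) / 2 - ∫ ρ in b..r, ρ * (1 - smoothStep ε b ρ) := by
    rw [← intervalIntegral.integral_add_adjacent_intervals (hc.intervalIntegrable 0 b)
      (hc.intervalIntegrable b r), hzero b hb.le le_rfl, ← integral_id (a := b) (b := r), zero_add,
      eq_sub_iff_add_eq, ← intervalIntegral.integral_add (hc.intervalIntegrable b r)
      (hc'.intervalIntegrable b r)]
    exact intervalIntegral.integral_congr fun ρ _ => by ring
  have hbd : ∀ ρ ∈ Set.uIoc b (min r (b + ε)), ‖ρ * (1 - smoothStep ε b ρ)‖ ≤ 2 := by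
    intro ρ hρ
    rw [Set.uIoc_of_le (le_min h.le (by linarith))] at hρ
    have h2 : ρ ≤ 2 := hρ.2.trans ((min_le_left _ _).trans hr)
    have h3 := smoothStep_nonneg ε b ρ
    have h4 := smoothStep_le_one ε b ρ
    rw [Real.norm_of_nonneg (mul_nonneg (hb.le.trans hρ.1.le) (by linarith))]
    nlinarith [hρ.1]
  have h2 := intervalIntegral.norm_integral_le_of_norm_le_const hbd
  have h3 : ∫ ρ in b..r, ρ * (1 - smoothStep ε b ρ) =
      ∫ ρ in b..(min r (b + ε)), ρ * (1 - smoothStep ε b ρ) := by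
    rcases le_total r (b + ε) with h5 | h5
    · rw [min_eq_left h5]
    · rw [min_eq_right h5, ← intervalIntegral.integral_add_adjacent_intervals
        (hc'.intervalIntegrable b (b + ε)) (hc'.intervalIntegrable (b + ε) r), add_eq_left]
      refine intervalIntegral.integral_zero_ae (Eventually.of_forall fun ρ hρ => ?_)
      rw [Set.uIoc_of_le h5] at hρ
      rw [smoothStep_eq_one hε hρ.1.le, sub_self, mul_zero]
  have h4 : |min r (b + ε) - b| ≤ ε := by
    rw [abs_of_nonneg (sub_nonneg.2 (le_min h.le (by linarith)))]
    linarith [min_le_right r (b + ε)]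
  rw [h1, h3, max_eq_left (by nlinarith), sub_sub_cancel_left, abs_neg, ← Real.norm_eq_abs]
  linarith

end Step

section Tail

/-- The tail `r^{-α}`, smoothly cut off. -/
noncomputable def smoothTail (α r : ℝ) : ℝ := Real.smoothTransition (4 * r - 6) * r ^ (-α)

variable {α : ℝ}

theorem smoothTail_of_le {r : ℝ} (hr : r ≤ 3 / 2) : smoothTail α r = 0 := by
  rw [smoothTail, Real.smoothTransition.zero_of_nonpos (by linarith), zero_mul]

theorem smoothTail_of_ge {r : ℝ} (hr : 7 / 4 ≤ r) : smoothTail α r = r ^ (-α) := by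
  rw [smoothTail, Real.smoothTransition.one_of_one_le (by linarith), one_mul]

theorem contDiff_smoothTail (α : ℝ) : ContDiff ℝ ∞ (smoothTail α) := by
  rw [contDiff_iff_contDiffAt]
  intro r
  rcases lt_or_ge r (3 / 2) with h | h
  · refine (contDiffAt_const (c := (0 : ℝ))).congr_of_eventuallyEq ?_
    filter_upwards [Iio_mem_nhds h] with s hs using smoothTail_of_le (le_of_lt hs)
  · refine ContDiffAt.mul ?_ (Real.contDiffAt_rpow_const_of_ne (by linarith))
    exact (Real.smoothTransition.contDiff.comp
      ((contDiff_const.mul contDiff_id).sub contDiff_const)).contDiffAt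

theorem deriv_smoothTail_of_lt {r : ℝ} (hr : r < 3 / 2) : deriv (smoothTail α) r = 0 := by
  have : smoothTail α =ᶠ[𝓝 r] fun _ => 0 := by
    filter_upwards [Iio_mem_nhds hr] with s hs using smoothTail_of_le (le_of_lt hs)
  rw [this.deriv_eq]
  simp

theorem integrableOn_deriv_smoothTail (hα : 0 < α) :
    IntegrableOn (deriv (smoothTail α)) (Set.Ioi 0) := by
  rw [← Set.Ioc_union_Ioi_eq_Ioi (zero_le_two : (0 : ℝ) ≤ 2), integrableOn_union]
  constructor
  · exact ((contDiff_smoothTail α).continuous_deriv (by simp)).integrableOn_Ioc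
  · have h : IntegrableOn (fun r : ℝ => -α * r ^ (-α - 1)) (Set.Ioi 2) :=
      (integrableOn_Ioi_rpow_of_lt (by linarith) zero_lt_two).const_mul (-α)
    refine h.congr_fun (fun r hr => ?_) measurableSet_Ioi
    have hr' : (2 : ℝ) < r := hr
    have : smoothTail α =ᶠ[𝓝 r] fun r => r ^ (-α) := by
      filter_upwards [Ioi_mem_nhds hr'] with s hs
      have hs' : (2 : ℝ) < s := hs
      exact smoothTail_of_ge (by linarith)
    rw [this.deriv_eq, (Real.hasDerivAt_rpow_const (Or.inl (by linarith))).deriv]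

end Tail

section Profile

variable {α : ℝ}

/-- On the set `J`, which is close to the radius `s₀`, the vorticity gradient `p` has the total mass
`σ` and the angular velocity `Z` is close to `ζ₀`. -/
structure IsRing (p Z : ℝ → ℝ) (J : Set ℝ) (s₀ σ ζ₀ η : ℝ) : Prop where
  measurableSet : MeasurableSet J
  subset : J ⊆ Set.Icc s₀ (s₀ + η)
  integral_eq : ∫ s in J, p s = σ
  integral_abs_le : ∫ s in J, |p s| ≤ 1
  abs_sub_le : ∀ s ∈ J, |Z s - ζ₀| ≤ η

theorem IsProfile.exists_abs_zeta_le {g : ℝ → ℝ} (hα : 0 < α) (hg : IsProfile α g) :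
    ∃ B, ∀ r, 0 ≤ r → |zeta g r| ≤ B := by
  obtain ⟨B, hB⟩ := (isCompact_Icc (a := (0 : ℝ)) (b := 2)).exists_bound_of_continuousOn
    (hg.smooth.continuousOn.mono Set.Icc_subset_Ici_self)
  have hB' : ∀ r, 0 ≤ r → |g r| ≤ max B 1 := by
    intro r hr
    rcases le_or_gt r 2 with h | h
    · exact (hB r ⟨hr, h⟩).trans (le_max_left _ _)
    · rw [hg.decay r h.le, abs_of_nonneg (Real.rpow_nonneg hr _)]
      exact (Real.rpow_le_one_of_one_le_of_nonpos (by linarith) (by linarith)).trans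
        (le_max_right _ _)
  refine ⟨max B 1, fun r hr => ?_⟩
  rcases hr.eq_or_lt with h0 | h0
  · rw [← h0]
    simp [zeta]
  have h1 := intervalIntegral.norm_integral_le_of_norm_le_const (a := 0) (b := r)
    (f := fun ρ => ρ * g ρ) (C := r * max B 1) fun ρ hρ => by
      rw [Set.uIoc_of_le hr] at hρ
      rw [norm_mul, Real.norm_of_nonneg hρ.1.le]
      exact mul_le_mul hρ.2 (hB' ρ hρ.1.le) (norm_nonneg _) hr
  rw [sub_zero, abs_of_pos h0] at h1
  rw [zeta, abs_mul, abs_of_nonneg (by positivity), ← Real.norm_eq_abs (∫ ρ in (0 : ℝ)..r, ρ * g ρ)]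
  rw [inv_mul_le_iff₀ (by positivity)]
  calc _ ≤ _ := h1
    _ = _ := by ring

/-- The rescaled profile `ε g` is the annular patch `1_{1 < r < √2}`, mollified at the scale `ε`, plus
the tail `ε r^{-α}` prescribed at infinity. For small `ε` its gradient concentrates on thin rings at the
radii `1` and `√2`, where the angular velocity of the sharp patch is `0` and `1/4`. -/
theorem exists_profile (hα : 0 < α) {η : ℝ} (hη : 0 < η) : ∃ (g : ℝ → ℝ) (ε : ℝ) (J₁ J₂ : Set ℝ),
    0 < ε ∧ IsProfile α g ∧ (∀ r, 0 < r → r < 1 → deriv g r = 0) ∧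
    IntegrableOn (deriv g) (Set.Ioi 0) ∧ Disjoint J₁ J₂ ∧
    IsRing (fun s => ε * deriv g s) (fun s => ε * zeta g s) J₁ 1 1 0 η ∧
    IsRing (fun s => ε * deriv g s) (fun s => ε * zeta g s) J₂ √2 (-1) (1 / 4) η ∧
    ∫ s in Set.Ioi 0 \ (J₁ ∪ J₂), |ε * deriv g s| ≤ η := by
  have hs2 : √2 ^ 2 = 2 := Real.sq_sqrt (by norm_num)
  have hs2a : 7 / 5 < √2 := Real.lt_sqrt_of_sq_lt (by norm_num)
  have hs2b : √2 < 71 / 50 := (Real.sqrt_lt' (by norm_num)).2 (by norm_num)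
  set K := ∫ r in Set.Ioi (0 : ℝ), |deriv (smoothTail α) r| with hK
  have hK0 : 0 ≤ K := integral_nonneg fun r => abs_nonneg _
  obtain ⟨ε, hε, hε1, hεη, hεK⟩ : ∃ ε : ℝ, 0 < ε ∧ ε ≤ 1 / 20 ∧ 12 * ε ≤ η ∧ ε * K ≤ η := by
    refine ⟨min (1 / 20) (η / (12 * (K + 1))), by positivity, min_le_left _ _, ?_, ?_⟩
    · have h1 := min_le_right (1 / 20) (η / (12 * (K + 1)))
      have h2 : 12 * (η / (12 * (K + 1))) ≤ η := by
        rw [← mul_div_assoc, mul_div_mul_left _ _ (by norm_num : (12 : ℝ) ≠ 0)]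
        exact div_le_self hη.le (by linarith)
      linarith
    · have h1 := min_le_right (1 / 20) (η / (12 * (K + 1)))
      calc _ ≤ η / (12 * (K + 1)) * K := by gcongr
        _ ≤ η := by
          rw [div_mul_eq_mul_div, div_le_iff₀ (by positivity)]
          nlinarith
  let G : ℝ → ℝ := fun r => smoothStep ε 1 r - smoothStep ε √2 r + ε * smoothTail α r
  let g : ℝ → ℝ := fun r => ε⁻¹ * G r
  have hGs : ContDiff ℝ ∞ G := ((contDiff_smoothStep ε 1 (n := ⊤)).sub (contDiff_smoothStep ε √2 (n := ⊤))).add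
    (contDiff_const.mul (contDiff_smoothTail α))
  have hgs : ContDiff ℝ ∞ g := contDiff_const.mul hGs
  have hd : ∀ r, ε * deriv g r = deriv (smoothStep ε 1) r - deriv (smoothStep ε √2) r +
      ε * deriv (smoothTail α) r := by
    intro r
    have d1 := ((contDiff_smoothStep ε 1 (n := 1)).differentiable (by simp) r).hasDerivAt
    have d2 := ((contDiff_smoothStep ε √2 (n := 1)).differentiable (by simp) r).hasDerivAt
    have d3 := ((contDiff_smoothTail α).differentiable (by simp) r).hasDerivAt
    have d4 : HasDerivAt g _ r := ((d1.sub d2).add (d3.const_mul ε)).const_mul ε⁻¹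
    rw [d4.deriv, mul_inv_cancel_left₀ hε.ne']
  have hg0 : ∀ r, r ≤ 1 → g r = 0 := by
    intro r hr
    simp only [g, G]
    rw [smoothStep_eq_zero hε hr, smoothStep_eq_zero hε (by linarith),
      smoothTail_of_le (by linarith)]
    simp
  have hgp : IsProfile α g := by
    refine ⟨hgs.contDiffOn, fun r hr => ?_, 0, 1, one_pos, fun r _ hr => ?_⟩
    · simp only [g, G]
      rw [smoothStep_eq_one hε (by linarith), smoothStep_eq_one hε (by linarith),
        smoothTail_of_ge (by linarith)]
      field_simp
      ring
    · rw [hg0 r hr.le, hg0 0 zero_le_one]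
      ring
  have hcd : Continuous (deriv g) := hgs.continuous_deriv (by simp)
  have hint : IntegrableOn (deriv g) (Set.Ioi 0) := by
    have h1 : ∀ b, b + ε ≤ 2 → IntegrableOn (deriv (smoothStep ε b)) (Set.Ioi 0) := by
      intro b hb
      rw [← Set.Ioc_union_Ioi_eq_Ioi (zero_le_two : (0 : ℝ) ≤ 2), integrableOn_union]
      refine ⟨(continuous_deriv_smoothStep ε b).integrableOn_Ioc,
        integrableOn_zero.congr_fun (fun r hr => ?_) measurableSet_Ioi⟩
      exact (deriv_smoothStep_of_ge hε (hb.trans (le_of_lt hr))).symm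
    have h2 : IntegrableOn (fun r => ε⁻¹ * (deriv (smoothStep ε 1) r - deriv (smoothStep ε √2) r +
        ε * deriv (smoothTail α) r)) (Set.Ioi 0) := (((h1 1 (by linarith)).sub (h1 √2 (by linarith))).add
      ((integrableOn_deriv_smoothTail hα).const_mul ε)).const_mul ε⁻¹
    refine h2.congr_fun (fun r _ => ?_) measurableSet_Ioi
    simp only [← hd]
    rw [inv_mul_cancel_left₀ hε.ne']
  -- the angular velocity of the profile is close to the one of the sharp annular patch
  have hζ : ∀ r, 0 < r → r ≤ 3 / 2 → |ε * zeta g r -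
      (r ^ 2)⁻¹ * (max (r ^ 2 - 1 ^ 2) 0 / 2 - max (r ^ 2 - √2 ^ 2) 0 / 2)| ≤ (r ^ 2)⁻¹ * (4 * ε) := by
    intro r hr0 hr
    have h1 : ε * zeta g r = (r ^ 2)⁻¹ * ((∫ ρ in (0 : ℝ)..r, ρ * smoothStep ε 1 ρ) -
        ∫ ρ in (0 : ℝ)..r, ρ * smoothStep ε √2 ρ) := by
      rw [zeta, mul_left_comm, ← intervalIntegral.integral_const_mul,
        ← intervalIntegral.integral_sub]
      · congr 1
        refine intervalIntegral.integral_congr fun ρ hρ => ?_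
        rw [Set.uIcc_of_le hr0.le] at hρ
        simp only [g, G]
        rw [smoothTail_of_le (hρ.2.trans hr)]
        field_simp
        ring
      · exact (continuous_id.mul
          (contDiff_smoothStep ε 1 (n := 0)).continuous).intervalIntegrable _ _
      · exact (continuous_id.mul
          (contDiff_smoothStep ε √2 (n := 0)).continuous).intervalIntegrable _ _
    have h2 := abs_integral_smoothStep_sub_le hε one_pos hr0.le (by linarith : r ≤ 2)
    have h3 := abs_integral_smoothStep_sub_le hε (by linarith : 0 < √2) hr0.le (by linarith : r ≤ 2)
    rw [h1, ← mul_sub, abs_mul, abs_of_nonneg (by positivity : (0 : ℝ) ≤ (r ^ 2)⁻¹)]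
    refine mul_le_mul_of_nonneg_left ?_ (by positivity)
    rw [abs_le] at h2 h3 ⊢
    constructor <;> linarith [h2.1, h2.2, h3.1, h3.2]
  have hring : ∀ b σ, |σ| = 1 → (∀ s ∈ Set.Ioc b (b + ε), ε * deriv g s =
      σ * deriv (smoothStep ε b) s) → ∫ s in Set.Ioc b (b + ε), ε * deriv g s = σ ∧
      ∫ s in Set.Ioc b (b + ε), |ε * deriv g s| ≤ 1 := by
    intro b σ hσ h
    constructor
    · rw [setIntegral_congr_fun measurableSet_Ioc h, integral_const_mul,
        integral_deriv_smoothStep hε, mul_one]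
    · refine le_of_eq ?_
      rw [← integral_deriv_smoothStep (b := b) hε]
      refine setIntegral_congr_fun measurableSet_Ioc fun s hs => ?_
      simp only [h s hs]
      rw [abs_mul, hσ, one_mul, abs_of_nonneg (deriv_smoothStep_nonneg hε s)]
  refine ⟨g, ε, Set.Ioc 1 (1 + ε), Set.Ioc √2 (√2 + ε), hε, hgp, fun r _ hr => ?_, hint, ?_,
    ⟨measurableSet_Ioc, ?_, ?_, ?_, ?_⟩, ⟨measurableSet_Ioc, ?_, ?_, ?_, ?_⟩, ?_⟩
  · have : ε * deriv g r = 0 := by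
      rw [hd, deriv_smoothStep_of_le hε hr.le, deriv_smoothStep_of_le hε (by linarith),
        deriv_smoothTail_of_lt (by linarith)]
      simp
    exact (mul_eq_zero.1 this).resolve_left hε.ne'
  · rw [Set.disjoint_left]
    intro s h1 h2
    linarith [h1.2, h2.1]
  · exact fun s hs => ⟨hs.1.le, hs.2.trans (by linarith)⟩
  · refine (hring 1 1 (by simp) fun s hs => ?_).1
    rw [hd, deriv_smoothStep_of_le (b := √2) hε (by linarith [hs.2]),
      deriv_smoothTail_of_lt (by linarith [hs.2])]
    ring
  · refine (hring 1 1 (by simp) fun s hs => ?_).2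
    rw [hd, deriv_smoothStep_of_le (b := √2) hε (by linarith [hs.2]),
      deriv_smoothTail_of_lt (by linarith [hs.2])]
    ring
  · intro s hs
    have h1 := hζ s (by linarith [hs.1]) (by linarith [hs.2])
    have h2 : s ≤ 21 / 20 := by linarith [hs.2]
    rw [max_eq_left (by nlinarith [hs.1]), max_eq_right (by rw [hs2]; nlinarith [hs.1])] at h1
    have h3 : (s ^ 2)⁻¹ ≤ 1 := inv_le_one_of_one_le₀ (by nlinarith [hs.1])
    have h4 : 0 ≤ (s ^ 2)⁻¹ := by positivity
    have h5 : 0 ≤ (s ^ 2 - 1 ^ 2) / 2 - 0 / 2 := by nlinarith [hs.1]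
    have h6 : (s ^ 2 - 1 ^ 2) / 2 - 0 / 2 ≤ 2 * ε := by nlinarith [hs.1, hs.2]
    have h7 := mul_le_mul h3 h6 h5 zero_le_one
    have h8 := mul_nonneg h4 h5
    have h9 := mul_le_mul_of_nonneg_right h3 (by positivity : 0 ≤ 4 * ε)
    rw [abs_le] at h1 ⊢
    constructor <;> linarith [h1.1, h1.2]
  · exact fun s hs => ⟨hs.1.le, hs.2.trans (by linarith)⟩
  · refine (hring √2 (-1) (by simp) fun s hs => ?_).1
    rw [hd, deriv_smoothStep_of_ge (b := 1) hε (by linarith [hs.1]),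
      deriv_smoothTail_of_lt (by linarith [hs.2])]
    ring
  · refine (hring √2 (-1) (by simp) fun s hs => ?_).2
    rw [hd, deriv_smoothStep_of_ge (b := 1) hε (by linarith [hs.1]),
      deriv_smoothTail_of_lt (by linarith [hs.2])]
    ring
  · intro s hs
    have h1 := hζ s (by linarith [hs.1]) (by linarith [hs.2])
    have h2 : s ≤ 3 / 2 := by linarith [hs.2]
    have h10 : 2 ≤ s ^ 2 := by rw [← hs2]; exact pow_le_pow_left₀ (by positivity) hs.1.le 2
    rw [max_eq_left (by linarith), max_eq_left (by linarith), hs2] at h1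
    have h3 : (s ^ 2)⁻¹ ≤ 1 / 2 := by
      rw [one_div]
      exact inv_anti₀ (by norm_num) h10
    have h4 : 0 ≤ (s ^ 2)⁻¹ := by positivity
    have h6 : s ^ 2 - 2 ≤ 4 * ε := by nlinarith [hs.1, hs.2]
    have h7 : (s ^ 2)⁻¹ * s ^ 2 = 1 := inv_mul_cancel₀ (by positivity)
    have h8 : 1 / 2 - (s ^ 2)⁻¹ ≤ 4 * ε := by nlinarith
    have h9 := mul_le_mul_of_nonneg_right h3 (by positivity : 0 ≤ 4 * ε)
    rw [abs_le] at h1 ⊢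
    constructor <;> linarith [h1.1, h1.2]
  · calc ∫ s in Set.Ioi 0 \ (Set.Ioc 1 (1 + ε) ∪ Set.Ioc √2 (√2 + ε)), |ε * deriv g s|
        = ∫ s in Set.Ioi 0 \ (Set.Ioc 1 (1 + ε) ∪ Set.Ioc √2 (√2 + ε)),
          ε * |deriv (smoothTail α) s| := by
          refine setIntegral_congr_fun (by measurability) fun s hs => ?_
          have key : ∀ b, s ∉ Set.Ioc b (b + ε) → deriv (smoothStep ε b) s = 0 := by
            intro b hb
            rcases le_or_gt s b with h | h
            · exact deriv_smoothStep_of_le hε h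
            · refine deriv_smoothStep_of_ge hε (le_of_lt ?_)
              by_contra hcon
              exact hb ⟨h, not_lt.1 hcon⟩
          simp only [hd]
          rw [key 1 fun h => hs.2 (Or.inl h), key √2 fun h => hs.2 (Or.inr h), sub_zero, zero_add,
            abs_mul, abs_of_pos hε]
      _ ≤ ∫ s in Set.Ioi 0, ε * |deriv (smoothTail α) s| := by
          refine setIntegral_mono_set ((integrableOn_deriv_smoothTail hα).abs.const_mul ε)
            (Eventually.of_forall fun s => by positivity) ?_
          exact (Set.sdiff_subset).eventuallyLE
      _ = ε * K := integral_const_mul _ _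
      _ ≤ η := hεK

end Profile

/-! ### Rayleigh's equation for the vortex with two rings -/

section Kernel

open scoped BoundedContinuousFunction

theorem abs_min_div_max_sub_le {r s t : ℝ} (hr : 0 ≤ r) (hs : 1 ≤ s) (ht : 1 ≤ t) :
    |min r s / max r s - min r t / max r t| ≤ |s - t| := by
  wlog hst : s ≤ t generalizing s t
  · rw [abs_sub_comm, abs_sub_comm s]
    exact this ht hs (le_of_not_ge hst)
  have hs0 : 0 < s := by linarith
  have ht0 : 0 < t := by linarith
  rw [abs_sub_comm s, abs_of_nonneg (sub_nonneg.2 hst)]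
  rcases le_total r s with h | h
  · rw [min_eq_left h, max_eq_right h, min_eq_left (h.trans hst), max_eq_right (h.trans hst),
      div_sub_div _ _ hs0.ne' ht0.ne', abs_le]
    have h1 : r * (t - s) ≤ s * t * (t - s) := by
      have : r ≤ s * t := by nlinarith
      nlinarith
    constructor
    · rw [le_div_iff₀ (by positivity)]
      nlinarith [mul_nonneg hr (sub_nonneg.2 hst), mul_pos hs0 ht0]
    · rw [div_le_iff₀ (by positivity)]
      linarith
  · have hr0 : 0 < r := by linarith
    rw [min_eq_right h, max_eq_left h]
    rcases le_total r t with h' | h'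
    · rw [min_eq_left h', max_eq_right h', abs_le]
      have e1 : s / r ≤ 1 := (div_le_one hr0).2 h
      have e2 : r / t ≤ 1 := (div_le_one ht0).2 h'
      have e3 : 1 - s / r ≤ r - s := by
        rw [sub_le_iff_le_add, ← sub_le_iff_le_add', le_div_iff₀ hr0]
        nlinarith
      have e4 : 1 - r / t ≤ t - r := by
        rw [sub_le_iff_le_add, ← sub_le_iff_le_add', le_div_iff₀ ht0]
        nlinarith
      constructor <;> linarith
    · rw [min_eq_right h', max_eq_left h', ← sub_div, abs_le]
      constructor
      · rw [le_div_iff₀ hr0]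
        nlinarith
      · rw [div_le_iff₀ hr0]
        nlinarith

theorem min_div_max_mem {r s : ℝ} (hr : 0 ≤ r) (hs : 0 < s) :
    0 ≤ min r s / max r s ∧ min r s / max r s ≤ 1 :=
  ⟨div_nonneg (le_min hr hs.le) (hr.trans (le_max_left _ _)),
    div_le_one_of_le₀ min_le_max (hr.trans (le_max_left _ _))⟩

theorem radialKernel_nonneg (m : ℕ) {r s : ℝ} (hr : 0 ≤ r) (hs : 0 < s) : 0 ≤ radialKernel m r s :=
  pow_nonneg (min_div_max_mem hr hs).1 _

theorem radialKernel_le_one (m : ℕ) {r s : ℝ} (hr : 0 ≤ r) (hs : 0 < s) : radialKernel m r s ≤ 1 :=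
  pow_le_one₀ (min_div_max_mem hr hs).1 (min_div_max_mem hr hs).2

theorem radialKernel_comm (m : ℕ) (r s : ℝ) : radialKernel m r s = radialKernel m s r := by
  rw [radialKernel, radialKernel, min_comm, max_comm]

theorem abs_radialKernel_sub_le (m : ℕ) {r s t : ℝ} (hr : 0 ≤ r) (hs : 1 ≤ s) (ht : 1 ≤ t) :
    |radialKernel m r s - radialKernel m r t| ≤ m * |s - t| := by
  have h1 := min_div_max_mem hr (by linarith : 0 < s)
  have h2 := min_div_max_mem hr (by linarith : 0 < t)
  refine (abs_pow_sub_pow_le _ _ _).trans ?_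
  have h3 : max |min r s / max r s| |min r t / max r t| ^ (m - 1) ≤ 1 := by
    rw [abs_of_nonneg h1.1, abs_of_nonneg h2.1]
    exact pow_le_one₀ (h1.1.trans (le_max_left _ _)) (max_le h1.2 h2.2)
  have h4 := abs_min_div_max_sub_le hr hs ht
  calc _ ≤ |s - t| * m * 1 := by gcongr
    _ = _ := by ring

theorem continuous_radialKernel (m : ℕ) {s : ℝ} (hs : 0 < s) :
    Continuous fun r => radialKernel m |r| s := by
  unfold radialKernel
  refine Continuous.pow (Continuous.div (by fun_prop) (by fun_prop) fun r => ?_) m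
  exact (lt_max_of_lt_right hs).ne'

theorem measurable_radialKernel (m : ℕ) (r : ℝ) : Measurable (radialKernel m r) := by
  unfold radialKernel
  fun_prop

/-- The stream function `r ↦ k(|r|, s)` of a ring at the radius `s`. -/
noncomputable def ringStream (m : ℕ) (s : ℝ) (hs : 0 < s) : ℝ →ᵇ ℂ :=
  BoundedContinuousFunction.ofNormedAddCommGroup (fun r => (radialKernel m |r| s : ℂ))
    (Complex.continuous_ofReal.comp (continuous_radialKernel m hs)) 1 fun r => by
      rw [Complex.norm_real, Real.norm_of_nonneg (radialKernel_nonneg m (abs_nonneg r) hs)]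
      exact radialKernel_le_one m (abs_nonneg r) hs

theorem norm_ringStream_le (m : ℕ) {s : ℝ} (hs : 0 < s) : ‖ringStream m s hs‖ ≤ 1 :=
  BoundedContinuousFunction.norm_ofNormedAddCommGroup_le _ zero_le_one _

/-- An integral operator on the bounded continuous functions, whose norm is bounded by the largest
`L¹` norm of the kernels `κ r`. -/
theorem exists_intOp {κ : ℝ → ℝ → ℂ} {b : ℝ → ℝ} (hc : ∀ s, 0 < s → Continuous fun r => κ r s)
    (hm : ∀ r, AEStronglyMeasurable (κ r) (volume.restrict (Set.Ioi 0)))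
    (hb : ∀ r s, 0 < s → ‖κ r s‖ ≤ b s) (hbi : IntegrableOn b (Set.Ioi 0)) :
    ∃ T : (ℝ →ᵇ ℂ) →L[ℂ] (ℝ →ᵇ ℂ), (∀ ψ r, T ψ r = ∫ s in Set.Ioi (0 : ℝ), κ r s * ψ s) ∧
      ∀ C, (∀ r, ∫ s in Set.Ioi (0 : ℝ), ‖κ r s‖ ≤ C) → ‖T‖ ≤ C := by
  have hmψ : ∀ (ψ : ℝ →ᵇ ℂ) r, AEStronglyMeasurable (fun s => κ r s * ψ s)
      (volume.restrict (Set.Ioi 0)) := fun ψ r =>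
    (hm r).mul ψ.continuous.aestronglyMeasurable
  have hbψ : ∀ (ψ : ℝ →ᵇ ℂ) r, ∀ᵐ s ∂volume.restrict (Set.Ioi (0 : ℝ)),
      ‖κ r s * ψ s‖ ≤ b s * ‖ψ‖ := by
    intro ψ r
    filter_upwards [ae_restrict_mem measurableSet_Ioi] with s hs
    rw [norm_mul]
    exact mul_le_mul (hb r s hs) (ψ.norm_coe_le_norm s) (norm_nonneg _)
      ((norm_nonneg _).trans (hb r s hs))
  have hint : ∀ (ψ : ℝ →ᵇ ℂ) r, IntegrableOn (fun s => κ r s * ψ s) (Set.Ioi 0) := fun ψ r =>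
    (hbi.mul_const ‖ψ‖).mono' (hmψ ψ r) (hbψ ψ r)
  have hκ : ∀ r, IntegrableOn (κ r) (Set.Ioi 0) := fun r => hbi.mono' (hm r) (by
    filter_upwards [ae_restrict_mem measurableSet_Ioi] with s hs using hb r s hs)
  have hcont : ∀ ψ : ℝ →ᵇ ℂ, Continuous fun r => ∫ s in Set.Ioi (0 : ℝ), κ r s * ψ s := fun ψ => by
    refine continuous_of_dominated (hmψ ψ) (hbψ ψ) (hbi.mul_const ‖ψ‖) ?_
    filter_upwards [ae_restrict_mem measurableSet_Ioi] with s hs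
    exact (hc s hs).mul continuous_const
  have hle : ∀ (ψ : ℝ →ᵇ ℂ) r, ‖∫ s in Set.Ioi (0 : ℝ), κ r s * ψ s‖ ≤
      (∫ s in Set.Ioi (0 : ℝ), ‖κ r s‖) * ‖ψ‖ := by
    intro ψ r
    rw [← integral_mul_const]
    refine norm_integral_le_of_norm_le ((hκ r).norm.mul_const _) (Eventually.of_forall fun s => ?_)
    rw [norm_mul]
    exact mul_le_mul_of_nonneg_left (ψ.norm_coe_le_norm s) (norm_nonneg _)
  have hle' : ∀ r, ∫ s in Set.Ioi (0 : ℝ), ‖κ r s‖ ≤ ∫ s in Set.Ioi (0 : ℝ), b s := fun r =>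
    setIntegral_mono_on (hκ r).norm hbi measurableSet_Ioi fun s hs => hb r s hs
  let L : (ℝ →ᵇ ℂ) →ₗ[ℂ] (ℝ →ᵇ ℂ) :=
    { toFun := fun ψ => BoundedContinuousFunction.ofNormedAddCommGroup _ (hcont ψ)
        ((∫ s in Set.Ioi (0 : ℝ), b s) * ‖ψ‖) fun r =>
          (hle ψ r).trans (mul_le_mul_of_nonneg_right (hle' r) (norm_nonneg _))
      map_add' := fun ψ χ => by
        ext r
        simp only [BoundedContinuousFunction.coe_ofNormedAddCommGroup,
          BoundedContinuousFunction.coe_add, Pi.add_apply, mul_add]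
        exact integral_add (hint ψ r) (hint χ r)
      map_smul' := fun a ψ => by
        ext r
        simp only [BoundedContinuousFunction.coe_ofNormedAddCommGroup,
          BoundedContinuousFunction.coe_smul, RingHom.id_apply, smul_eq_mul]
        rw [← integral_const_mul]
        exact integral_congr_ae (Eventually.of_forall fun s => by ring) }
  have hL : ∀ C, (∀ r, ∫ s in Set.Ioi (0 : ℝ), ‖κ r s‖ ≤ C) → ∀ ψ, ‖L ψ‖ ≤ C * ‖ψ‖ := by
    intro C hC ψ
    have hC0 : 0 ≤ C := (integral_nonneg fun s => norm_nonneg _).trans (hC 0)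
    refine (BoundedContinuousFunction.norm_le (by positivity)).2 fun r => ?_
    exact (hle ψ r).trans (mul_le_mul_of_nonneg_right (hC r) (norm_nonneg _))
  refine ⟨L.mkContinuous _ (hL _ hle'), fun ψ r => rfl, fun C hC => ?_⟩
  have hC0 : 0 ≤ C := (integral_nonneg fun s => norm_nonneg _).trans (hC 0)
  exact ContinuousLinearMap.opNorm_le_bound _ hC0 (hL C hC)

variable {p Z : ℝ → ℝ} {J : Set ℝ} {s₀ σ ζ₀ η : ℝ}

/-- The strength of the vorticity perturbation on one ring, as a functional of the stream
function. -/
theorem IsRing.exists_functional (h : IsRing p Z J s₀ σ ζ₀ η) (hp : IntegrableOn p J) :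
    ∃ ℓ : (ℝ →ᵇ ℂ) →L[ℂ] ℂ, (∀ φ : ℝ →ᵇ ℂ, ℓ φ = -(1 / 8) * ∫ s in J, (p s : ℂ) * φ s) ∧
      (∀ φ : ℝ →ᵇ ℂ, ‖ℓ φ‖ ≤ 1 / 8 * ‖φ‖) ∧
      ∀ (φ : ℝ →ᵇ ℂ) (a : ℂ) (D : ℝ), 0 ≤ D → (∀ s ∈ J, ‖φ s - a‖ ≤ D) →
        ‖ℓ φ - -(1 / 8) * σ * a‖ ≤ D := by
  have hpc : IntegrableOn (fun s => (p s : ℂ)) J := hp.ofReal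
  have hint : ∀ φ : ℝ →ᵇ ℂ, IntegrableOn (fun s => (p s : ℂ) * φ s) J := fun φ =>
    hpc.mul_bdd (c := ‖φ‖) φ.continuous.aestronglyMeasurable (Eventually.of_forall φ.norm_coe_le_norm)
  have key : ∀ (φ : ℝ → ℂ) (D : ℝ), 0 ≤ D → (∀ s ∈ J, ‖φ s‖ ≤ D) →
      ‖-(1 / 8) * ∫ s in J, (p s : ℂ) * φ s‖ ≤ 1 / 8 * D := by
    intro φ D hD hφ
    have h1 : ‖∫ s in J, (p s : ℂ) * φ s‖ ≤ ∫ s in J, |p s| * D := by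
      refine norm_integral_le_of_norm_le (hp.abs.mul_const D) ?_
      filter_upwards [ae_restrict_mem h.measurableSet] with s hs
      rw [norm_mul, Complex.norm_real, Real.norm_eq_abs]
      exact mul_le_mul_of_nonneg_left (hφ s hs) (abs_nonneg _)
    rw [integral_mul_const] at h1
    have h2 := mul_le_mul_of_nonneg_right h.integral_abs_le hD
    rw [norm_mul]
    have h3 : ‖(-(1 / 8) : ℂ)‖ = 1 / 8 := by norm_num
    rw [h3]
    linarith
  let L : (ℝ →ᵇ ℂ) →ₗ[ℂ] ℂ :=
    { toFun := fun φ => -(1 / 8) * ∫ s in J, (p s : ℂ) * φ s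
      map_add' := fun φ χ => by
        simp only [BoundedContinuousFunction.coe_add, Pi.add_apply, mul_add]
        rw [integral_add (hint φ) (hint χ), mul_add]
      map_smul' := fun a φ => by
        simp only [BoundedContinuousFunction.coe_smul, RingHom.id_apply, smul_eq_mul]
        have h1 : ∫ s in J, (p s : ℂ) * (a * φ s) = a * ∫ s in J, (p s : ℂ) * φ s := by
          rw [← integral_const_mul]
          exact integral_congr_ae (Eventually.of_forall fun s => by ring)
        rw [h1]
        ring }
  refine ⟨L.mkContinuous (1 / 8) fun φ => key φ ‖φ‖ (norm_nonneg _) fun s _ =>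
    φ.norm_coe_le_norm s, fun φ => rfl, fun φ => key φ ‖φ‖ (norm_nonneg _) fun s _ =>
    φ.norm_coe_le_norm s, fun φ a D hD hφ => ?_⟩
  have h1 := key (fun s => φ s - a) D hD hφ
  have h2 : ∫ s in J, (p s : ℂ) * (φ s - a) = (∫ s in J, (p s : ℂ) * φ s) - σ * a := by
    simp only [mul_sub]
    rw [integral_sub (hint φ) (hpc.mul_const a), integral_mul_const, integral_complex_ofReal, h.integral_eq]
  rw [h2] at h1
  calc _ = ‖-(1 / 8) * ((∫ s in J, (p s : ℂ) * φ s) - σ * a)‖ := by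
        congr 1
        change -(1 / 8) * (∫ s in J, (p s : ℂ) * φ s) - _ = _
        ring
    _ ≤ 1 / 8 * D := h1
    _ ≤ D := by linarith

/-- The inverse of `Z - c` among the bounded continuous functions, for a real function `Z`. -/
theorem exists_boundedContinuous_inv {Zb : ℝ →ᵇ ℂ} (hZ : ∀ r, (Zb r).im = 0) {c : ℂ}
    (hc : 0 < c.im) : ∃ v : ℝ →ᵇ ℂ, (Zb - c • 1) * v = 1 ∧ v * (Zb - c • 1) = 1 ∧
      (∀ r, v r = (Zb r - c)⁻¹) ∧ ‖v‖ ≤ c.im⁻¹ := by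
  have hle : ∀ r, c.im ≤ ‖Zb r - c‖ := fun r => by
    have := Complex.abs_im_le_norm (Zb r - c)
    rw [Complex.sub_im, hZ, zero_sub, abs_neg, abs_of_pos hc] at this
    exact this
  have hne : ∀ r, Zb r - c ≠ 0 := fun r => norm_pos_iff.1 (hc.trans_le (hle r))
  have hb : ∀ r, ‖(Zb r - c)⁻¹‖ ≤ c.im⁻¹ := fun r => by
    rw [norm_inv]
    exact inv_anti₀ hc (hle r)
  refine ⟨BoundedContinuousFunction.ofNormedAddCommGroup (fun r => (Zb r - c)⁻¹)
    ((Zb.continuous.sub continuous_const).inv₀ hne) c.im⁻¹ hb, ?_, ?_, fun r => rfl,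
    BoundedContinuousFunction.norm_ofNormedAddCommGroup_le _ (by positivity) _⟩
  · ext r
    simp [hne r]
  · ext r
    simp [hne r]

end Kernel

/-! ### Existence of an unstable mode -/

section Zero

/-- A disc around the root `1/8 + i/32` that stays away from the real axis and from the angular
velocities `0` and `1/4` of the two rings. -/
theorem mem_disc_bounds {c : ℂ} (hc : c ∈ Metric.closedBall (1 / 8 + Complex.I / 32 : ℂ) (1 / 64)) :
    1 / 64 ≤ c.im ∧ ‖c‖ ≤ 1 / 4 ∧ ‖1 / 4 - c‖ ≤ 1 / 4 ∧ 1 / 16 ≤ ‖c‖ ∧ 1 / 16 ≤ ‖1 / 4 - c‖ := by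
  rw [mem_closedBall_iff_norm] at hc
  have h1 := (Complex.abs_im_le_norm _).trans hc
  have h2 := (Complex.abs_re_le_norm _).trans hc
  rw [abs_le] at h1 h2
  norm_num at h1 h2
  have h3 : ‖(1 / 8 + Complex.I / 32 : ℂ)‖ ≤ 5 / 32 := by
    refine (norm_add_le _ _).trans ?_
    norm_num
  have h4 : ‖(1 / 8 - Complex.I / 32 : ℂ)‖ ≤ 5 / 32 := by
    refine (norm_sub_le _ _).trans ?_
    norm_num
  refine ⟨by linarith, ?_, ?_, ?_, ?_⟩
  · have := norm_add_le (c - (1 / 8 + Complex.I / 32)) (1 / 8 + Complex.I / 32)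
    rw [sub_add_cancel] at this
    linarith
  · have := norm_sub_le (1 / 8 - Complex.I / 32) (c - (1 / 8 + Complex.I / 32))
    rw [show (1 / 8 - Complex.I / 32) - (c - (1 / 8 + Complex.I / 32)) = 1 / 4 - c by ring] at this
    linarith
  · have := (le_abs_self _).trans (Complex.abs_re_le_norm c)
    linarith
  · have := (le_abs_self _).trans (Complex.abs_re_le_norm (1 / 4 - c))
    have h5 : (1 / 4 - c).re = 1 / 4 - c.re := by simp
    rw [h5] at this
    linarith

/-- The dispersion relation of two infinitely thin rings, at the radii `1` and `√2` and on the
fourth angular mode, has the root `1/8 + i/32`; a small perturbation of the relation still has a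
root nearby, by the maximum principle for the reciprocal of the determinant. -/
theorem exists_det_eq_zero {M : ℂ → Matrix (Fin 2) (Fin 2) ℂ}
    (hM : ∀ c ∈ Metric.closedBall (1 / 8 + Complex.I / 32 : ℂ) (1 / 64),
      ∀ i j, DifferentiableAt ℂ (fun c => M c i j) c)
    (hclose : ∀ c ∈ Metric.closedBall (1 / 8 + Complex.I / 32 : ℂ) (1 / 64), ∀ i j,
      ‖M c i j - !![1 / (8 * c), 1 / (32 * c);
        1 / (32 * (1 / 4 - c)), 1 / (8 * (1 / 4 - c))] i j‖ ≤ 1 / 4000) :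
    ∃ c ∈ Metric.closedBall (1 / 8 + Complex.I / 32 : ℂ) (1 / 64), (1 - M c).det = 0 := by
  set c₀ : ℂ := 1 / 8 + Complex.I / 32 with hc₀
  set d : ℂ → ℂ := fun c => (1 - M c).det with hd
  have hdet : ∀ c, d c = (1 - M c 0 0) * (1 - M c 1 1) - M c 0 1 * M c 1 0 := fun c => by
    simp only [hd, Matrix.det_fin_two]
    simp
  have hdd : ∀ c ∈ Metric.closedBall c₀ (1 / 64), DifferentiableAt ℂ d c := by
    intro c hc
    have h := hM c hc
    rw [show d = _ from funext hdet]
    exact (((differentiableAt_const 1).sub (h 0 0)).mul ((differentiableAt_const 1).sub (h 1 1))).sub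
      ((h 0 1).mul (h 1 0))
  let d₀ : ℂ → ℂ := fun c => -((c - c₀) * (c - (1 / 8 - Complex.I / 32))) / (c * (1 / 4 - c))
  have hdiff : ∀ c ∈ Metric.closedBall c₀ (1 / 64), ‖d c - d₀ c‖ ≤ 1 / 200 := by
    intro c hc
    obtain ⟨-, -, -, hc1, hc2⟩ := mem_disc_bounds hc
    have hc1' : c ≠ 0 := norm_pos_iff.1 (by linarith)
    have hc2' : 1 / 4 - c ≠ 0 := norm_pos_iff.1 (by linarith)
    have h00 := hclose c hc 0 0
    have h01 := hclose c hc 0 1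
    have h10 := hclose c hc 1 0
    have h11 := hclose c hc 1 1
    simp only [Matrix.of_apply, Matrix.cons_val_zero, Matrix.cons_val_one, Matrix.cons_val',
      Matrix.cons_val_fin_one] at h00 h01 h10 h11
    have e1 : ‖1 / (8 * c)‖ ≤ 2 := by
      rw [norm_div, norm_mul, div_le_iff₀ (by simp [hc1'])]
      norm_num
      linarith
    have e2 : ‖1 / (8 * (1 / 4 - c))‖ ≤ 2 := by
      rw [norm_div, norm_mul, div_le_iff₀ (mul_pos (by norm_num) (by linarith))]
      norm_num at hc2 ⊢
      linarith
    have e3 : ‖1 / (32 * c)‖ ≤ 1 := by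
      rw [norm_div, norm_mul, div_le_iff₀ (by simp [hc1'])]
      norm_num
      linarith
    have e4 : ‖1 / (32 * (1 / 4 - c))‖ ≤ 1 := by
      rw [norm_div, norm_mul, div_le_iff₀ (mul_pos (by norm_num) (by linarith))]
      norm_num at hc2 ⊢
      linarith
    have h0 : d₀ c = (1 - 1 / (8 * c)) * (1 - 1 / (8 * (1 / 4 - c))) -
        1 / (32 * c) * (1 / (32 * (1 / 4 - c))) := by
      have hN : (c - c₀) * (c - (1 / 8 - Complex.I / 32)) = 17 / 1024 - c * (1 / 4 - c) := by
        rw [hc₀]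
        linear_combination (-1 / 1024 : ℂ) * Complex.I_sq
      simp only [d₀, hN]
      have hq : c + (1 / 4 - c) = 1 / 4 := by ring
      generalize 1 / 4 - c = q at hq hc2' ⊢
      field_simp
      linear_combination 8388608 * hq
    generalize 1 / (8 * c) = a at *
    generalize 1 / (8 * (1 / 4 - c)) = b at *
    generalize 1 / (32 * c) = a' at *
    generalize 1 / (32 * (1 / 4 - c)) = b' at *
    have h1 : d c - d₀ c = (M c 0 0 - a) * (M c 1 1 - b) - (M c 0 0 - a) * (1 - b) -
        (1 - a) * (M c 1 1 - b) - (M c 0 1 - a') * (M c 1 0 - b') - (M c 0 1 - a') * b' -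
        a' * (M c 1 0 - b') := by
      rw [hdet, h0]
      ring
    have n1 : ‖1 - a‖ ≤ 3 := (norm_sub_le _ _).trans (by rw [norm_one]; linarith)
    have n2 : ‖1 - b‖ ≤ 3 := (norm_sub_le _ _).trans (by rw [norm_one]; linarith)
    have hmul : ∀ {x y : ℂ} {s t : ℝ}, ‖x‖ ≤ s → ‖y‖ ≤ t → ‖x * y‖ ≤ s * t := fun hx hy => by
      rw [norm_mul]
      exact mul_le_mul hx hy (norm_nonneg _) ((norm_nonneg _).trans hx)
    rw [h1]
    refine (norm_sub_le_of_le (norm_sub_le_of_le (norm_sub_le_of_le (norm_sub_le_of_le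
      (norm_sub_le_of_le (hmul h00 h11) (hmul h00 n2)) (hmul n1 h11)) (hmul h01 h10))
      (hmul h01 e4)) (hmul e3 h10)).trans ?_
    norm_num
  by_contra hcon
  push Not at hcon
  have hdc : DiffContOnCl ℂ (fun c => (d c)⁻¹) (Metric.ball c₀ (1 / 64)) := by
    refine DifferentiableOn.diffContOnCl ?_
    rw [closure_ball _ (by norm_num)]
    exact fun c hc => ((hdd c hc).inv (hcon c hc)).differentiableWithinAt
  have hfr : ∀ c ∈ frontier (Metric.ball c₀ (1 / 64)), ‖(d c)⁻¹‖ ≤ 160 := by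
    intro c hc
    rw [frontier_ball _ (by norm_num), mem_sphere_iff_norm] at hc
    have hcb : c ∈ Metric.closedBall c₀ (1 / 64) := by
      rw [mem_closedBall_iff_norm, hc]
    obtain ⟨-, h1, h2, h3, h4⟩ := mem_disc_bounds hcb
    have h5 := hdiff c hcb
    have h6 : 3 / 64 ≤ ‖c - (1 / 8 - Complex.I / 32)‖ := by
      have h7 := norm_sub_le_norm_add (Complex.I / 16) (c - c₀)
      rw [hc, show Complex.I / 16 + (c - c₀) = c - (1 / 8 - Complex.I / 32) by rw [hc₀]; ring] at h7
      norm_num at h7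
      linarith
    have h8 : 3 / 256 ≤ ‖d₀ c‖ := by
      simp only [d₀]
      rw [norm_div, norm_neg, norm_mul, norm_mul, hc, le_div_iff₀ (by nlinarith)]
      have : ‖c‖ * ‖1 / 4 - c‖ ≤ 1 / 4 * (1 / 4) :=
        mul_le_mul h1 h2 (norm_nonneg _) (by norm_num)
      nlinarith
    have h9 : 1 / 160 ≤ ‖d c‖ := by
      have := norm_sub_norm_le (d₀ c) (d c)
      rw [norm_sub_rev] at this
      linarith
    rw [norm_inv, inv_le_comm₀ (by linarith) (by norm_num)]
    linarith
  have hmem : c₀ ∈ Metric.closedBall c₀ (1 / 64) := Metric.mem_closedBall_self (by norm_num)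
  have h1 := Complex.norm_le_of_forall_mem_frontier_norm_le Metric.isBounded_ball hdc hfr
    (subset_closure (Metric.mem_ball_self (by norm_num : (0 : ℝ) < 1 / 64)))
  have h2 := hdiff c₀ hmem
  have h3 : d₀ c₀ = 0 := by simp [d₀]
  rw [h3, sub_zero] at h2
  have h4 : 0 < ‖d c₀‖ := norm_pos_iff.2 (hcon c₀ hmem)
  rw [norm_inv, inv_le_comm₀ h4 (by norm_num)] at h1
  norm_num at h1 h2
  linarith

end Zero

section Unstable

open scoped BoundedContinuousFunction

variable {p Z : ℝ → ℝ} {J₁ J₂ : Set ℝ} {s₁ s₂ σ₁ σ₂ ζ₁ ζ₂ η : ℝ}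

theorem IsRing.subset_Ioi {J : Set ℝ} {s σ ζ : ℝ} (h : IsRing p Z J s σ ζ η) (hs : 1 ≤ s) :
    J ⊆ Set.Ioi 0 := fun x hx => by
  have := (h.subset hx).1
  exact lt_of_lt_of_le one_pos (hs.trans this)

/-- The stream function induced by the vorticity is, up to an operator of small norm, a combination
of the stream functions of two infinitely thin rings. -/
theorem exists_remainder (hp : IntegrableOn p (Set.Ioi 0)) (hJ : Disjoint J₁ J₂) (hη : 0 ≤ η)
    (h₁ : IsRing p Z J₁ s₁ σ₁ ζ₁ η) (h₂ : IsRing p Z J₂ s₂ σ₂ ζ₂ η) (hs₁ : 1 ≤ s₁) (hs₂ : 1 ≤ s₂)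
    (hrest : ∫ s in Set.Ioi 0 \ (J₁ ∪ J₂), |p s| ≤ η) :
    ∃ T : (ℝ →ᵇ ℂ) →L[ℂ] (ℝ →ᵇ ℂ), ‖T‖ ≤ 2 * η ∧ ∀ (φ : ℝ →ᵇ ℂ) r,
      -(1 / 8) * ∫ s in Set.Ioi (0 : ℝ), (radialKernel 4 |r| s : ℂ) * (p s * φ s) = T φ r +
        -(1 / 8) * (∫ s in J₁, (p s : ℂ) * φ s) * radialKernel 4 |r| s₁ +
        -(1 / 8) * (∫ s in J₂, (p s : ℂ) * φ s) * radialKernel 4 |r| s₂ := by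
  classical
  have hsub₁ := h₁.subset_Ioi hs₁
  have hsub₂ := h₂.subset_Ioi hs₂
  have hm₁ := h₁.measurableSet
  have hm₂ := h₂.measurableSet
  have hs₁0 : 0 < s₁ := by linarith
  have hs₂0 : 0 < s₂ := by linarith
  -- the kernel with the radius `s` frozen on the rings
  let k' : ℝ → ℝ → ℝ := fun r s => J₁.indicator (fun _ => radialKernel 4 |r| s₁) s +
    J₂.indicator (fun _ => radialKernel 4 |r| s₂) s
  let κ : ℝ → ℝ → ℂ := fun r s => ((-(1 / 8) * p s * (radialKernel 4 |r| s - k' r s) : ℝ) : ℂ)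
  let e : ℝ → ℝ := fun s => (1 / 8) * (J₁.indicator (fun s => 4 * η * |p s|) s +
    J₂.indicator (fun s => 4 * η * |p s|) s + (Set.Ioi 0 \ (J₁ ∪ J₂)).indicator (fun s => |p s|) s)
  have hrad : ∀ r s, 0 < s → |radialKernel 4 |r| s| ≤ 1 := fun r s hs => by
    rw [abs_of_nonneg (radialKernel_nonneg 4 (abs_nonneg r) hs)]
    exact radialKernel_le_one 4 (abs_nonneg r) hs
  have hκe : ∀ r s, 0 < s → ‖κ r s‖ ≤ e s := by
    intro r s hs
    have hn : ‖κ r s‖ = 1 / 8 * (|p s| * |radialKernel 4 |r| s - k' r s|) := by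
      simp only [κ]
      rw [Complex.norm_real, norm_mul, norm_mul, Real.norm_eq_abs, Real.norm_eq_abs,
        Real.norm_eq_abs, mul_assoc]
      norm_num
    have hclose : ∀ {t}, 1 ≤ t → t ≤ s → s ≤ t + η →
        |radialKernel 4 |r| s - radialKernel 4 |r| t| ≤ 4 * η := by
      intro t ht hts hst
      refine (abs_radialKernel_sub_le 4 (abs_nonneg r) (ht.trans hts) ht).trans ?_
      rw [abs_of_nonneg (by linarith)]
      push_cast
      linarith
    rw [hn]
    simp only [e]
    refine mul_le_mul_of_nonneg_left ?_ (by norm_num)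
    by_cases c₁ : s ∈ J₁
    · have c₂ : s ∉ J₂ := Set.disjoint_left.1 hJ c₁
      have c₃ : s ∉ Set.Ioi 0 \ (J₁ ∪ J₂) := fun h => h.2 (Or.inl c₁)
      simp only [k', Set.indicator_of_mem c₁, Set.indicator_of_notMem c₂,
        Set.indicator_of_notMem c₃, add_zero]
      rw [mul_comm]
      have hi := h₁.subset c₁
      exact mul_le_mul_of_nonneg_right (hclose hs₁ hi.1 hi.2) (abs_nonneg _)
    by_cases c₂ : s ∈ J₂
    · have c₃ : s ∉ Set.Ioi 0 \ (J₁ ∪ J₂) := fun h => h.2 (Or.inr c₂)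
      simp only [k', Set.indicator_of_notMem c₁, Set.indicator_of_mem c₂,
        Set.indicator_of_notMem c₃, add_zero, zero_add]
      rw [mul_comm]
      have hi := h₂.subset c₂
      exact mul_le_mul_of_nonneg_right (hclose hs₂ hi.1 hi.2) (abs_nonneg _)
    · have c₃ : s ∈ Set.Ioi 0 \ (J₁ ∪ J₂) := ⟨hs, by simp [c₁, c₂]⟩
      simp only [k', Set.indicator_of_notMem c₁, Set.indicator_of_notMem c₂,
        Set.indicator_of_mem c₃, add_zero, zero_add, sub_zero]
      exact mul_le_of_le_one_right (abs_nonneg _) (hrad r s hs)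
  have hpa : IntegrableOn (fun s => |p s|) (Set.Ioi 0) := hp.abs
  have hp4 : IntegrableOn (fun s => 4 * η * |p s|) (Set.Ioi 0) := hpa.const_mul _
  have hm₃ : MeasurableSet (Set.Ioi (0 : ℝ) \ (J₁ ∪ J₂)) := measurableSet_Ioi.diff (hm₁.union hm₂)
  have i₁ : IntegrableOn (J₁.indicator fun s => 4 * η * |p s|) (Set.Ioi 0) := hp4.indicator hm₁
  have i₂ : IntegrableOn (J₂.indicator fun s => 4 * η * |p s|) (Set.Ioi 0) := hp4.indicator hm₂
  have i₃ : IntegrableOn ((Set.Ioi 0 \ (J₁ ∪ J₂)).indicator fun s => |p s|) (Set.Ioi 0) :=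
    hpa.indicator hm₃
  have i₁₂ : IntegrableOn (fun s => J₁.indicator (fun s => 4 * η * |p s|) s +
      J₂.indicator (fun s => 4 * η * |p s|) s) (Set.Ioi 0) := i₁.add i₂
  have he : IntegrableOn e (Set.Ioi 0) := (i₁₂.add i₃).const_mul _
  have hei : ∫ s in Set.Ioi (0 : ℝ), e s ≤ 2 * η := by
    simp only [e]
    rw [integral_const_mul, integral_add i₁₂ i₃, integral_add i₁ i₂,
      setIntegral_indicator hm₁, setIntegral_indicator hm₂, setIntegral_indicator hm₃,
      Set.inter_eq_self_of_subset_right hsub₁, Set.inter_eq_self_of_subset_right hsub₂,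
      Set.inter_eq_self_of_subset_right Set.sdiff_subset, integral_const_mul, integral_const_mul]
    have a₁ := mul_le_mul_of_nonneg_left h₁.integral_abs_le (by linarith : 0 ≤ 4 * η)
    have a₂ := mul_le_mul_of_nonneg_left h₂.integral_abs_le (by linarith : 0 ≤ 4 * η)
    linarith
  have hκm : ∀ r, AEStronglyMeasurable (κ r) (volume.restrict (Set.Ioi 0)) := by
    intro r
    refine Complex.continuous_ofReal.comp_aestronglyMeasurable ?_
    have hk' : Measurable (k' r) :=
      (measurable_const.indicator hm₁).add (measurable_const.indicator hm₂)
    exact (hp.aestronglyMeasurable.const_mul _).mul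
      ((measurable_radialKernel 4 |r|).sub hk').aestronglyMeasurable
  have hκc : ∀ s, 0 < s → Continuous fun r => κ r s := by
    intro s hs
    refine Complex.continuous_ofReal.comp (continuous_const.mul
      ((continuous_radialKernel 4 hs).sub (Continuous.add ?_ ?_)))
    · by_cases c₁ : s ∈ J₁
      · simpa only [Set.indicator_of_mem c₁] using continuous_radialKernel 4 hs₁0
      · simpa only [Set.indicator_of_notMem c₁] using continuous_const
    · by_cases c₂ : s ∈ J₂
      · simpa only [Set.indicator_of_mem c₂] using continuous_radialKernel 4 hs₂0
      · simpa only [Set.indicator_of_notMem c₂] using continuous_const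
  obtain ⟨T, hT, hTn⟩ := exists_intOp hκc hκm hκe he
  have hκi : ∀ r, IntegrableOn (κ r) (Set.Ioi 0) := fun r => he.mono' (hκm r) (by
    filter_upwards [ae_restrict_mem measurableSet_Ioi] with s hs using hκe r s hs)
  refine ⟨T, hTn _ fun r => ?_, fun φ r => ?_⟩
  · exact (setIntegral_mono_on (hκi r).norm he measurableSet_Ioi fun s hs => hκe r s hs).trans hei
  · have hpφ : IntegrableOn (fun s => (p s : ℂ) * φ s) (Set.Ioi 0) :=
      hp.ofReal.mul_bdd (c := ‖φ‖) φ.continuous.aestronglyMeasurable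
        (Eventually.of_forall φ.norm_coe_le_norm)
    have hκφ : IntegrableOn (fun s => κ r s * φ s) (Set.Ioi 0) :=
      (hκi r).mul_bdd (c := ‖φ‖) φ.continuous.aestronglyMeasurable
        (Eventually.of_forall φ.norm_coe_le_norm)
    have j₁ : IntegrableOn (J₁.indicator fun s => -(1 / 8) * (radialKernel 4 |r| s₁ : ℂ) *
        ((p s : ℂ) * φ s)) (Set.Ioi 0) := IntegrableOn.indicator (hpφ.const_mul _) hm₁
    have j₂ : IntegrableOn (J₂.indicator fun s => -(1 / 8) * (radialKernel 4 |r| s₂ : ℂ) *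
        ((p s : ℂ) * φ s)) (Set.Ioi 0) := IntegrableOn.indicator (hpφ.const_mul _) hm₂
    have e₁ : ∫ s in Set.Ioi (0 : ℝ), J₁.indicator (fun s => -(1 / 8) *
        (radialKernel 4 |r| s₁ : ℂ) * ((p s : ℂ) * φ s)) s =
        -(1 / 8) * (∫ s in J₁, (p s : ℂ) * φ s) * radialKernel 4 |r| s₁ := by
      rw [setIntegral_indicator hm₁, Set.inter_eq_self_of_subset_right hsub₁, integral_const_mul]
      ring
    have e₂ : ∫ s in Set.Ioi (0 : ℝ), J₂.indicator (fun s => -(1 / 8) *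
        (radialKernel 4 |r| s₂ : ℂ) * ((p s : ℂ) * φ s)) s =
        -(1 / 8) * (∫ s in J₂, (p s : ℂ) * φ s) * radialKernel 4 |r| s₂ := by
      rw [setIntegral_indicator hm₂, Set.inter_eq_self_of_subset_right hsub₂, integral_const_mul]
      ring
    have j₁' : IntegrableOn (fun s => κ r s * φ s + J₁.indicator (fun s => -(1 / 8) *
        (radialKernel 4 |r| s₁ : ℂ) * ((p s : ℂ) * φ s)) s) (Set.Ioi 0) := hκφ.add j₁
    rw [hT, ← e₁, ← e₂, ← integral_add hκφ j₁, ← integral_add j₁' j₂,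
      ← integral_const_mul]
    refine integral_congr_ae (Eventually.of_forall fun s => ?_)
    simp only [κ, k', Set.indicator_apply]
    split_ifs <;> push_cast <;> ring

end Unstable

section Unstable

open scoped BoundedContinuousFunction

variable {p Z : ℝ → ℝ} {J₁ J₂ : Set ℝ} {s₁ s₂ σ₁ σ₂ ζ₁ ζ₂ η : ℝ}

/-- The resolvent of the multiplication by a real function. -/
theorem exists_mulResolvent {Zb : ℝ →ᵇ ℂ} (hZ : ∀ r, (Zb r).im = 0) :
    ∃ w : ℂ → (ℝ →ᵇ ℂ), ∀ c : ℂ, 0 < c.im →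
      DifferentiableAt ℂ w c ∧ (∀ r, w c r = (Zb r - c)⁻¹) ∧ ‖w c‖ ≤ c.im⁻¹ := by
  refine ⟨fun c => Ring.inverse (Zb - c • 1), fun c hc => ?_⟩
  obtain ⟨v, e1, e2, e3, e4⟩ := exists_boundedContinuous_inv hZ hc
  let u : (ℝ →ᵇ ℂ)ˣ := ⟨Zb - c • 1, v, e1, e2⟩
  have hwv : Ring.inverse (Zb - c • 1) = v := Ring.inverse_unit u
  refine ⟨?_, fun r => (congrArg (fun f : ℝ →ᵇ ℂ => f r) hwv).trans (e3 r),
    (congrArg norm hwv).trans_le e4⟩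
  have h : DifferentiableAt ℂ Ring.inverse (Zb - c • 1) :=
    (analyticAt_inverse (𝕜 := ℂ) u).differentiableAt
  have h2 : DifferentiableAt ℂ (fun c : ℂ => Zb - c • 1) c :=
    (differentiableAt_const _).sub (differentiableAt_id.smul_const _)
  exact h.comp c h2

/-- Neumann series: the solution operator `f ↦ x` of the equation `x = f + T (w c * x)`, when `T` is
small. -/
theorem exists_neumann {A : Type*} [NormedRing A] [NormedAlgebra ℂ A] [CompleteSpace A]
    (T : A →L[ℂ] A) {w : ℂ → A} {B : Set ℂ} {δ : ℝ} (hδ : δ ≤ 1 / 2)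
    (hw : ∀ c ∈ B, ‖T‖ * ‖w c‖ ≤ δ) (hwd : ∀ c ∈ B, DifferentiableAt ℂ w c) :
    ∃ R : ℂ → A →L[ℂ] A, ∀ c ∈ B, DifferentiableAt ℂ R c ∧
      (∀ f, R c f = f + T (w c * R c f)) ∧ ∀ f, ‖R c f - f‖ ≤ 2 * δ * ‖f‖ := by
  let mulE := ContinuousLinearMap.mul ℂ A
  let E : ℂ → A →L[ℂ] A := fun c => T ∘L mulE (w c)
  have hEn : ∀ c ∈ B, ‖E c‖ ≤ δ := fun c hc =>
    ((ContinuousLinearMap.opNorm_comp_le _ _).trans (mul_le_mul_of_nonneg_left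
      (ContinuousLinearMap.opNorm_mul_apply_le ℂ A (w c)) (norm_nonneg _))).trans (hw c hc)
  have hEd : ∀ c ∈ B, DifferentiableAt ℂ E c := fun c hc =>
    ((ContinuousLinearMap.compL ℂ A A A T).differentiableAt).comp c
      (mulE.differentiableAt.comp c (hwd c hc))
  have hunit : ∀ c ∈ B, IsUnit (1 - E c) := fun c hc => by
    have h1 : ‖E c‖ < 1 := (hEn c hc).trans_lt (by linarith)
    exact isUnit_one_sub_of_norm_lt_one h1
  refine ⟨fun c => Ring.inverse (1 - E c), fun c hc => ?_⟩
  have hR : ∀ f, Ring.inverse (1 - E c) f = f + T (w c * Ring.inverse (1 - E c) f) := fun f => by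
    have h1 := congrArg (fun S : A →L[ℂ] A => S f) (Ring.mul_inverse_cancel _ (hunit c hc))
    exact sub_eq_iff_eq_add.1 h1
  refine ⟨?_, hR, fun f => ?_⟩
  · obtain ⟨u, hu⟩ := hunit c hc
    have h := (analyticAt_inverse (𝕜 := ℂ) u).differentiableAt
    rw [hu] at h
    exact h.comp c ((differentiableAt_const _).sub (hEd c hc))
  · set x := Ring.inverse (1 - E c) f with hx
    have h2 : ‖E c x‖ ≤ δ * ‖x‖ :=
      ((E c).le_opNorm _).trans (mul_le_mul_of_nonneg_right (hEn c hc) (norm_nonneg _))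
    have h3 : x - f = E c x := sub_eq_iff_eq_add'.2 (hR f)
    have h4 : ‖x‖ ≤ ‖f‖ + ‖x - f‖ := by
      have := norm_add_le f (x - f)
      rwa [add_sub_cancel] at this
    have hδ0 : 0 ≤ δ := (norm_nonneg _).trans (hEn c hc)
    rw [← h3] at h2
    have h5 : δ * ‖x - f‖ ≤ 1 / 2 * ‖x - f‖ := mul_le_mul_of_nonneg_right hδ (norm_nonneg _)
    have h6 := mul_le_mul_of_nonneg_left h4 hδ0
    linarith

/-- The functional of a thin ring, applied to the stream function of the response to another ring,
is close to its value for infinitely thin rings. -/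
theorem IsRing.norm_functional_sub_le {J : Set ℝ} {s₀ σ ζ₀ : ℝ} (h : IsRing p Z J s₀ σ ζ₀ η)
    (hη : 0 ≤ η) (hη' : η ≤ 1 / 10 ^ 8) (hs₀ : 1 ≤ s₀) {l : (ℝ →ᵇ ℂ) →L[ℂ] ℂ}
    (hl : ∀ φ : ℝ →ᵇ ℂ, ‖l φ‖ ≤ 1 / 8 * ‖φ‖)
    (hlc : ∀ (φ : ℝ →ᵇ ℂ) (a : ℂ) (D : ℝ), 0 ≤ D → (∀ s ∈ J, ‖φ s - a‖ ≤ D) →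
      ‖l φ - -(1 / 8) * σ * a‖ ≤ D) {t : ℝ} (ht : 0 < t) {c : ℂ} (hc : 0 < c.im)
    (hζc : 1 / 16 ≤ ‖(ζ₀ : ℂ) - c‖) {w x : ℝ →ᵇ ℂ} (hw : ∀ s, 0 < s → w s = ((Z s : ℂ) - c)⁻¹)
    (hw64 : ‖w‖ ≤ 64) (hx : ‖x - ringStream 4 t ht‖ ≤ 256 * η) :
    ‖l (w * x) - -(1 / 8) * σ * ((radialKernel 4 s₀ t : ℂ) * (ζ₀ - c)⁻¹)‖ ≤ 1 / 4000 := by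
  have hJ0 := h.subset_Ioi hs₀
  set f := ringStream 4 t ht with hf
  have a1 : ‖l (w * (x - f))‖ ≤ 1 / 8 * (64 * (256 * η)) := by
    refine (hl _).trans (mul_le_mul_of_nonneg_left ?_ (by norm_num))
    exact (norm_mul_le _ _).trans (mul_le_mul hw64 hx (norm_nonneg _) (by norm_num))
  have a2 : ‖l (w * f) - -(1 / 8) * σ * ((radialKernel 4 s₀ t : ℂ) * (ζ₀ - c)⁻¹)‖ ≤
      64 * (4 * η) + 64 * (16 * η) := by
    refine hlc _ _ _ (by positivity) fun s hs => ?_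
    have hs0 : 0 < s := hJ0 hs
    have hsJ := h.subset hs
    have hws : w s = ((Z s : ℂ) - c)⁻¹ := hw s hs0
    have hwn : ‖w s‖ ≤ 64 := (w.norm_coe_le_norm s).trans hw64
    have hfs : f s = (radialKernel 4 s t : ℂ) := by
      change ((radialKernel 4 |s| t : ℝ) : ℂ) = _
      rw [abs_of_pos hs0]
    have b1 : ‖(radialKernel 4 s t : ℂ) - radialKernel 4 s₀ t‖ ≤ 4 * η := by
      rw [← Complex.ofReal_sub, Complex.norm_real, Real.norm_eq_abs, radialKernel_comm 4 s,
        radialKernel_comm 4 s₀]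
      refine (abs_radialKernel_sub_le 4 ht.le (hs₀.trans hsJ.1) hs₀).trans ?_
      rw [abs_of_nonneg (by linarith [hsJ.1])]
      push_cast
      linarith [hsJ.2]
    have hne : (Z s : ℂ) - c ≠ 0 := fun h0 => by
      have h5 := congrArg Complex.im h0
      simp at h5
      exact (hc).ne' h5
    have hne' : (ζ₀ : ℂ) - c ≠ 0 := norm_pos_iff.1 (by linarith)
    have b2 : ‖w s - ((ζ₀ : ℂ) - c)⁻¹‖ ≤ 64 * (16 * η) := by
      have e1 : w s - ((ζ₀ : ℂ) - c)⁻¹ = w s * (((ζ₀ : ℂ) - c)⁻¹ * -((Z s : ℂ) - ζ₀)) := by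
        rw [hws]
        field_simp
        ring
      have e2 : ‖((ζ₀ : ℂ) - c)⁻¹‖ ≤ 16 := by
        rw [norm_inv, inv_le_comm₀ (by linarith) (by norm_num)]
        norm_num at hζc ⊢
        exact hζc
      have e3 : ‖-((Z s : ℂ) - ζ₀)‖ ≤ η := by
        rw [norm_neg, ← Complex.ofReal_sub, Complex.norm_real]
        exact h.abs_sub_le s hs
      rw [e1, norm_mul, norm_mul]
      gcongr
    have b3 : ‖(radialKernel 4 s₀ t : ℂ)‖ ≤ 1 := by
      have hs00 : 0 < s₀ := by linarith
      rw [Complex.norm_real, Real.norm_of_nonneg (radialKernel_nonneg 4 hs00.le ht)]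
      exact radialKernel_le_one 4 hs00.le ht
    have e1 : (w * f) s - (radialKernel 4 s₀ t : ℂ) * (ζ₀ - c)⁻¹ =
        w s * ((radialKernel 4 s t : ℂ) - radialKernel 4 s₀ t) +
        (radialKernel 4 s₀ t : ℂ) * (w s - ((ζ₀ : ℂ) - c)⁻¹) := by
      rw [BoundedContinuousFunction.mul_apply, hfs]
      ring
    rw [e1]
    refine (norm_add_le _ _).trans (add_le_add ?_ ?_)
    · rw [norm_mul]
      gcongr
    · rw [norm_mul]
      calc _ ≤ 1 * (64 * (16 * η)) := by gcongr
        _ = _ := one_mul _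
  have e1 : l (w * x) - -(1 / 8) * σ * ((radialKernel 4 s₀ t : ℂ) * (ζ₀ - c)⁻¹) =
      l (w * (x - f)) +
      (l (w * f) - -(1 / 8) * σ * ((radialKernel 4 s₀ t : ℂ) * (ζ₀ - c)⁻¹)) := by
    rw [mul_sub, map_sub]
    ring
  rw [e1]
  refine (norm_add_le _ _).trans ?_
  linarith

/-- Rayleigh's equation on the fourth angular mode has a solution for the vortex with two rings. The
equation is reduced to the two unknown strengths of the perturbation on the rings by inverting the
small remainder; then the reduced `2 × 2` determinant has a root by `exists_det_eq_zero`. -/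
theorem exists_rayleigh (hp : IntegrableOn p (Set.Ioi 0)) (hJ : Disjoint J₁ J₂)
    (hη : 0 < η) (hη' : η ≤ 1 / 10 ^ 8) (h₁ : IsRing p Z J₁ 1 1 0 η)
    (h₂ : IsRing p Z J₂ √2 (-1) (1 / 4) η)
    (hrest : ∫ s in Set.Ioi 0 \ (J₁ ∪ J₂), |p s| ≤ η) {Zb : ℝ →ᵇ ℂ}
    (hZr : ∀ r, (Zb r).im = 0) (hZ : ∀ s, 0 < s → Zb s = Z s) :
    ∃ c : ℂ, 0 < c.im ∧ ∃ ψ : ℝ →ᵇ ℂ, ψ ≠ 0 ∧ ∀ r, ψ r =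
      -(1 / 8) * ∫ s in Set.Ioi (0 : ℝ), (radialKernel 4 |r| s : ℂ) * (p s * (ψ s / (Z s - c))) := by
  have hs2 : √2 ^ 2 = 2 := Real.sq_sqrt (by norm_num)
  have hs2a : 1 < √2 := Real.lt_sqrt_of_sq_lt (by norm_num)
  have hs20 : 0 < √2 := by linarith
  obtain ⟨T, hTn, hT⟩ := exists_remainder hp hJ hη.le h₁ h₂ le_rfl hs2a.le hrest
  have hsub₁ := h₁.subset_Ioi le_rfl
  have hsub₂ := h₂.subset_Ioi hs2a.le
  obtain ⟨ℓ₁, hℓ₁, hℓn₁, hℓc₁⟩ := h₁.exists_functional (hp.mono_set hsub₁)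
  obtain ⟨ℓ₂, hℓ₂, hℓn₂, hℓc₂⟩ := h₂.exists_functional (hp.mono_set hsub₂)
  set B := Metric.closedBall (1 / 8 + Complex.I / 32 : ℂ) (1 / 64) with hB
  have hBim : ∀ c ∈ B, 0 < c.im := fun c hc => by linarith [(mem_disc_bounds hc).1]
  obtain ⟨w, hw⟩ := exists_mulResolvent hZr
  have hwZ : ∀ c ∈ B, ∀ s, 0 < s → w c s = ((Z s : ℂ) - c)⁻¹ := fun c hc s hs => by
    rw [(hw c (hBim c hc)).2.1, hZ s hs]
  have hw64 : ∀ c ∈ B, ‖w c‖ ≤ 64 := fun c hc => by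
    refine (hw c (hBim c hc)).2.2.trans ?_
    rw [inv_le_comm₀ (hBim c hc) (by norm_num)]
    have := (mem_disc_bounds hc).1
    norm_num at this ⊢
    exact this
  obtain ⟨R, hR⟩ := exists_neumann T (w := w) (B := B) (δ := 128 * η) (by linarith)
    (fun c hc => by
      have := mul_le_mul hTn (hw64 c hc) (norm_nonneg _) (by positivity)
      linarith)
    (fun c hc => (hw c (hBim c hc)).1)
  let k : Fin 2 → (ℝ →ᵇ ℂ) := ![ringStream 4 1 one_pos, ringStream 4 √2 hs20]
  let ℓ : Fin 2 → (ℝ →ᵇ ℂ) →L[ℂ] ℂ := ![ℓ₁, ℓ₂]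
  let M : ℂ → Matrix (Fin 2) (Fin 2) ℂ := fun c => Matrix.of fun i j => ℓ i (w c * R c (k j))
  have hMd : ∀ c ∈ B, ∀ i j, DifferentiableAt ℂ (fun c => M c i j) c := by
    intro c hc i j
    have h1 : DifferentiableAt ℂ (fun c => R c (k j)) c :=
      (hR c hc).1.clm_apply (differentiableAt_const _)
    exact ((ℓ i).differentiableAt).comp c ((hw c (hBim c hc)).1.mul h1)
  have hk12 : radialKernel 4 1 √2 = 1 / 4 := by
    rw [radialKernel, min_eq_left hs2a.le, max_eq_right hs2a.le, div_pow, one_pow,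
      show √2 ^ 4 = (√2 ^ 2) ^ 2 by ring, hs2]
    norm_num
  have hkk : ∀ s : ℝ, 0 < s → radialKernel 4 s s = 1 := fun s hs => by
    rw [radialKernel, min_self, max_self, div_self hs.ne', one_pow]
  have hRk : ∀ c ∈ B, ∀ {t : ℝ} (ht : 0 < t),
      ‖R c (ringStream 4 t ht) - ringStream 4 t ht‖ ≤ 256 * η := fun c hc t ht => by
    have h1 := mul_le_mul_of_nonneg_left (norm_ringStream_le 4 ht) (by positivity : 0 ≤ 256 * η)
    have h2 := (hR c hc).2.2 (ringStream 4 t ht)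
    linarith
  obtain ⟨c, hc, hdet⟩ := exists_det_eq_zero hMd (by
    intro c hc i j
    obtain ⟨-, -, -, hc1, hc2⟩ := mem_disc_bounds hc
    have z1 : (1 : ℝ) / 16 ≤ ‖((0 : ℝ) : ℂ) - c‖ := by simpa using hc1
    have z2 : (1 : ℝ) / 16 ≤ ‖((1 / 4 : ℝ) : ℂ) - c‖ := by
      push_cast
      exact hc2
    have hc0 : c ≠ 0 := norm_pos_iff.1 (by linarith)
    have hc4 : 1 / 4 - c ≠ 0 := norm_pos_iff.1 (by linarith)
    have q00 : ‖M c 0 0 - 1 / (8 * c)‖ ≤ 1 / 4000 := by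
      refine (congrArg (fun a => ‖M c 0 0 - a‖) ?_).trans_le (h₁.norm_functional_sub_le hη.le hη' le_rfl hℓn₁ hℓc₁ one_pos (hBim c hc) z1
        (hwZ c hc) (hw64 c hc) (hRk c hc one_pos))
      rw [hkk 1 one_pos]
      push_cast
      field_simp
      ring
    have q01 : ‖M c 0 1 - 1 / (32 * c)‖ ≤ 1 / 4000 := by
      refine (congrArg (fun a => ‖M c 0 1 - a‖) ?_).trans_le (h₁.norm_functional_sub_le hη.le hη' le_rfl hℓn₁ hℓc₁ hs20 (hBim c hc) z1
        (hwZ c hc) (hw64 c hc) (hRk c hc hs20))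
      rw [hk12]
      push_cast
      field_simp
      norm_num
    have q10 : ‖M c 1 0 - 1 / (32 * (1 / 4 - c))‖ ≤ 1 / 4000 := by
      refine (congrArg (fun a => ‖M c 1 0 - a‖) ?_).trans_le (h₂.norm_functional_sub_le hη.le hη' hs2a.le hℓn₂ hℓc₂ one_pos (hBim c hc) z2
        (hwZ c hc) (hw64 c hc) (hRk c hc one_pos))
      rw [radialKernel_comm, hk12]
      push_cast
      field_simp
      norm_num
    have q11 : ‖M c 1 1 - 1 / (8 * (1 / 4 - c))‖ ≤ 1 / 4000 := by
      refine (congrArg (fun a => ‖M c 1 1 - a‖) ?_).trans_le (h₂.norm_functional_sub_le hη.le hη' hs2a.le hℓn₂ hℓc₂ hs20 (hBim c hc) z2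
        (hwZ c hc) (hw64 c hc) (hRk c hc hs20))
      rw [hkk √2 hs20]
      push_cast
      field_simp
    fin_cases i <;> fin_cases j
    exacts [q00, q01, q10, q11])
  obtain ⟨v, hv0, hv⟩ := Matrix.exists_mulVec_eq_zero_iff.2 hdet
  have hv' : ∀ i, v i = M c i 0 * v 0 + M c i 1 * v 1 := by
    intro i
    have h1 := congrFun hv i
    rw [Matrix.sub_mulVec, Matrix.one_mulVec] at h1
    simp only [Pi.sub_apply, Pi.zero_apply, Matrix.mulVec, dotProduct, Fin.sum_univ_two] at h1
    exact sub_eq_zero.1 h1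
  let ψ : ℝ →ᵇ ℂ := R c (v 0 • k 0 + v 1 • k 1)
  have hψv : ∀ i, ℓ i (w c * ψ) = v i := by
    intro i
    rw [hv' i]
    simp only [ψ, map_add, map_smul, mul_add, mul_smul_comm, smul_eq_mul]
    simp only [M, Matrix.of_apply]
    ring
  refine ⟨c, hBim c hc, ψ, fun h0 => hv0 ?_, fun r => ?_⟩
  · ext i
    rw [← hψv i, h0, mul_zero, map_zero]
    rfl
  · have h1 := (hR c hc).2.1 (v 0 • k 0 + v 1 • k 1)
    have h2 : ψ r = T (w c * ψ) r + v 0 * radialKernel 4 |r| 1 + v 1 * radialKernel 4 |r| √2 := by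
      have h3 := congrArg (fun f : ℝ →ᵇ ℂ => f r) h1
      refine h3.trans ?_
      change v 0 * (radialKernel 4 |r| 1 : ℂ) + v 1 * (radialKernel 4 |r| √2 : ℂ) + _ = _
      simp only [ψ]
      ring
    have h3 : ∫ s in Set.Ioi (0 : ℝ), (radialKernel 4 |r| s : ℂ) * (p s * (ψ s / (Z s - c))) =
        ∫ s in Set.Ioi (0 : ℝ), (radialKernel 4 |r| s : ℂ) * (p s * (w c * ψ) s) := by
      refine setIntegral_congr_fun measurableSet_Ioi fun s hs => ?_
      have : w c s = ((Z s : ℂ) - c)⁻¹ := hwZ c hc s hs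
      simp only [BoundedContinuousFunction.mul_apply, this]
      ring
    have h4 := hψv 0
    have h5 := hψv 1
    rw [h3, hT, h2, ← hℓ₁, ← hℓ₂]
    simp only [ℓ, Matrix.cons_val_zero, Matrix.cons_val_one] at h4 h5
    rw [h4, h5]

end Unstable

section Unstable

open scoped BoundedContinuousFunction

/-- The vortex with two rings is linearly unstable. The scaling of the profile by `ε⁻¹` multiplies the
phase velocity `c` of the unstable mode by `ε⁻¹`. -/
theorem exists_unstable {α : ℝ} (hα : 0 < α) (hα1 : α < 1) : ∃ g : ℝ → ℝ, IsProfile α g ∧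
    ∃ z ∈ spec (Lst 4 g), 0 < z.re := by
  obtain ⟨g, ε, J₁, J₂, hε, hg, hg0, hint, hJ, h₁, h₂, hrest⟩ :=
    exists_profile hα (η := 1 / 10 ^ 8) (by norm_num)
  obtain ⟨B, hB⟩ := hg.exists_abs_zeta_le hα
  -- the angular velocity as a continuous function of the radius
  let e₀ : Plane := EuclideanSpace.single 0 1
  have hang : ∀ r : ℝ, r ≠ 0 → angularVelocity g (r • e₀) = zeta g |r| := by
    intro r hr
    have h1 : ‖r • e₀‖ = |r| := by simp [e₀, norm_smul]
    have h2 : r • e₀ ≠ 0 := by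
      rw [← norm_ne_zero_iff, h1]
      exact abs_ne_zero.2 hr
    rw [angularVelocity, if_neg h2, h1]
  have hcont : Continuous fun r : ℝ => angularVelocity g (r • e₀) :=
    hg.contDiff_angularVelocity.continuous.comp (continuous_id.smul continuous_const)
  let Zb : BoundedContinuousFunction ℝ ℂ := BoundedContinuousFunction.ofNormedAddCommGroup
    (fun r => ((ε * angularVelocity g (r • e₀) : ℝ) : ℂ))
    (Complex.continuous_ofReal.comp (continuous_const.mul hcont))
    (ε * max B |angularVelocity g 0|) (fun r => by
      rw [Complex.norm_real, norm_mul, Real.norm_of_nonneg hε.le]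
      refine mul_le_mul_of_nonneg_left ?_ hε.le
      by_cases hr : r = 0
      · rw [hr, zero_smul]
        exact le_max_right _ _
      · rw [hang r hr]
        exact (hB _ (abs_nonneg r)).trans (le_max_left _ _))
  obtain ⟨c, hc, ψ, hψ, heq⟩ := exists_rayleigh (hint.const_mul ε) hJ (by norm_num) le_rfl h₁ h₂
    hrest (Zb := Zb) (fun r => Complex.ofReal_im _) (fun s hs => by
      change ((ε * angularVelocity g (s • e₀) : ℝ) : ℂ) = _
      rw [hang s hs.ne', abs_of_pos hs])
  have hεc : (ε : ℂ) ≠ 0 := by exact_mod_cast hε.ne'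
  have hcε : (c / ε).im = c.im / ε := Complex.div_ofReal_im c ε
  -- the equation is invariant under scaling of the profile
  have heq' : ∀ r, ψ r = -(1 / (2 * (4 : ℕ))) * ∫ s in Set.Ioi (0 : ℝ),
      (radialKernel 4 |r| s : ℂ) * (deriv g s * (ψ s / (zeta g s - c / ε))) := by
    intro r
    rw [heq r]
    have h1 : (-(1 / 8) : ℂ) = -(1 / (2 * (4 : ℕ))) := by norm_num
    rw [h1]
    congr 1
    refine integral_congr_ae (Eventually.of_forall fun s => ?_)
    have h2 : ((ε * zeta g s : ℝ) : ℂ) - c = ε * (zeta g s - c / ε) := by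
      push_cast
      field_simp
    have h3 : ∀ a b d : ℂ, ε * a * (b / (ε * d)) = a * (b / d) := fun a b d => by
      rw [mul_comm (ε : ℂ) a, mul_assoc, mul_div_assoc', mul_div_mul_left _ _ hεc]
    simp only [h2]
    rw [Complex.ofReal_mul, h3]
  obtain ⟨r₀, hr₀⟩ : ∃ r, ψ r ≠ 0 := by
    by_contra hcon
    push Not at hcon
    exact hψ (BoundedContinuousFunction.ext hcon)
  have hr₀' : r₀ ≠ 0 := by
    intro h0
    apply hr₀
    rw [heq' r₀, h0]
    have h1 : ∀ s ∈ Set.Ioi (0 : ℝ), (radialKernel 4 |0| s : ℂ) *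
        (deriv g s * (ψ s / (zeta g s - c / ε))) = 0 := fun s hs => by
      have hs' : (0 : ℝ) < s := hs
      simp [radialKernel, min_eq_left hs'.le]
    rw [setIntegral_congr_fun measurableSet_Ioi h1]
    simp
  have hψabs : ψ |r₀| = ψ r₀ := by rw [heq' |r₀|, heq' r₀, abs_abs]
  refine ⟨g, hg, _, mem_spec_of_rayleigh (m := 4) hα hα1 (by norm_num) hg one_pos hg0 (c := c / ε) ?_
    ψ.continuous ψ.norm_coe_le_norm (abs_pos.2 hr₀') (by rwa [hψabs]) fun r hr => ?_, ?_⟩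
  · rw [hcε]
    exact (div_pos hc hε).ne'
  · rw [heq' r, abs_of_pos hr]
  · have h1 : (-(Complex.I * (4 : ℕ) * (c / ε))).re = 4 * (c.im / ε) := by
      rw [← hcε]
      simp
    rw [h1]
    have := div_pos hc hε
    positivity

end Unstable

end EulerVortex

theorem theorem3p1 (α : ℝ) (hα0 : 0 < α) (hα1 : α < 1) :
    (∀ m : ℕ, 2 ≤ m → ∀ g : ℝ → ℝ, EulerVortex.IsProfile α g →
      ∀ z ∈ EulerVortex.spec (EulerVortex.Lst m g), z.re ≠ 0 →
        z ∈ EulerVortex.discreteSpec (EulerVortex.Lst m g) ∧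
        (z.im = 0 →
          ∃ Ω : EulerVortex.L2m m, Ω ≠ 0 ∧ EulerVortex.Lst m g Ω (z • Ω) ∧
            ∀ᵐ x, ((Ω : Lp ℂ 2 (volume : Measure EulerVortex.Plane)) x).im = 0)) ∧
    (∃ g : ℝ → ℝ, EulerVortex.IsProfile α g ∧
      ∃ m : ℕ, 2 ≤ m ∧ ∃ z ∈ EulerVortex.spec (EulerVortex.Lst m g), 0 < z.re) := by
  refine ⟨fun m hm g hg z hz hre => ?_, ?_⟩
  · obtain ⟨h1, Ω, h2, h3⟩ := EulerVortex.mem_discreteSpec_Lst hα0 hα1 hm hg hz hre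
    exact ⟨h1, fun him => EulerVortex.exists_real_eigenfunction hα0 hα1 hm hg him h2 h3⟩
  · obtain ⟨g, hg, z, hz, hre⟩ := EulerVortex.exists_unstable hα0 hα1
    exact ⟨g, hg, 4, by norm_num, z, hz, hre⟩
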